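/- All vector spaces are over $\mathbb{C}$. Let $\mathfrak{k}$ be the centerless Neveu--Schwarz algebra: the Lie superalgebra with even basis $L_n$ ($n\in\mathbb{Z}$), odd basis $G_r$ ($r\in\mathbb{Z}+\frac12$), and brackets $[L_m,L_n]=(n-m)L_{m+n}$, $[L_m,G_r]=(r-\frac m2)G_{m+r}$, $[G_r,G_s]=-2L_{r+s}$. Let $\mathfrak{k}^+$ be spanned by the $L_n$, $G_r$ with $n\ge-1$, $r\ge-\frac12$, and let $\mathfrak{k}_{\ge0}$ be spanned by those with $n\ge0$, $r\ge\frac12$. Let $A=\mathbb{C}[t,t^{-1}]\otimes\Lambda(\xi)$ and $A^+=\mathbb{C}[t]\otimes\Lambda(\xi)$ with $t$ even and $\xi$ odd, regarded as abelian Lie superalgebras on which $L_i$ acts as $t^{i+1}\partial_t+\frac{i+1}{2}t^i\xi\partial_\xi$ and $G_r$ acts as $t^{r+1/2}(\xi\partial_t-\partial_\xi)$. Let $\overline{U}^+$ (respectively $\overline{U}^{++}$) be the quotient of the universal enveloping superalgebra $U(\mathfrak{k}^+\ltimes A)$ (respectively $U(\mathfrak{k}^+\ltimes A^+)$) by the left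 ideal, which is two-sided, generated by $t^i\cdot t^j-t^{i+j}$, $t^0-1$, $t^i\cdot\xi-t^i\xi$ and $\xi\cdot\xi$ for all $i,j\in\mathbb{Z}$ (respectively $i,j\in\mathbb{Z}_{\ge0}$). In either algebra put, for integers $n\ge0$, $$L'_n=\sum_{i=0}^{n+1}(-1)^{i+1}\binom{n+1}{i}t^{n+1-i}\cdot L_{i-1}+\frac{n+1}{2}\sum_{i=0}^{n}(-1)^i\binom ni t^{n-i}\xi\cdot G_{i-\frac12},$$ $$G'_{n-\frac12}=\sum_{i=0}^n(-1)^i\binom ni\bigl(t^{n-i}\cdot G_{i-\frac12}-2t^{n-i}\xi\cdot L_{i-1}\bigr),$$ and let $\mathcal{T}$ be the span of the $L'_n$ ($n\ge0$) and $G'_{m-\frac12}$ ($m\ge1$). Let $\mathcal{K}=\mathbb{C}[t^{\pm1},\xi,\partial_t,\partial_\xi]$ be the Weyl superalgebra and $\mathcal{K}^+$ its subalgebra generated by $t,\xi,\partial_t,\partial_\xi$. Tensor products of superalgebras carry the product $(a\otimes b)(a'\otimes b')=(-1)^{|b||a'|}aa'\otimes bb'$. Then: 1. The elements $L'_n$ ($n\ge0$)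 and $G'_{m-\frac12}$ ($m\ge1$) of $\overline{U}^+$ are linearly independent, and $\mathcal{T}\subset\overline{U}^+$ is a Lie subsuperalgebra for the supercommutator. 2. There are algebra homomorphisms $\kappa:\mathcal{K}\to\overline{U}^+$ with $t^{\pm1}\mapsto t^{\pm1}$, $\xi\mapsto\xi$, $\partial_t\mapsto L_{-1}$, $\partial_\xi\mapsto\xi\cdot L_{-1}-G_{-\frac12}$, and $u:U(\mathcal{T})\to\overline{U}^+$ extending the inclusion of $\mathcal{T}$, and the map $\iota:\mathcal{K}\otimes U(\mathcal{T})\to\overline{U}^+$, $\iota(x\otimes y)=\kappa(x)u(y)$, is an isomorphism of associative superalgebras. 3. The natural homomorphism $j:\overline{U}^{++}\to\overline{U}^+$ is injective and maps the space $\mathcal{T}$ of $\overline{U}^{++}$ onto that of $\overline{U}^+$; identifying $\overline{U}^{++}$ with its image, $\iota$ restricts to an isomorphism of associative superalgebras $\mathcal{K}^+\otimes U(\mathcal{T})\cong\overline{U}^{++}$. 4. The Lie superalgebra $\mathcal{T}$ is isomorphic to $\mathfrak{k}_{\ge0}$. -/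

import Mathlib

open scoped TensorProduct

noncomputable section

namespace ContactSuper

/-! ### Superspaces -/

theorem zmod2_cases (i : ZMod 2) : i = 0 ∨ i = 1 := by
  revert i; decide

/-- The subspace on which an (involutive) endomorphism `σ` acts as `(-1) ^ i`.  Over `ℂ`, a
`ℤ/2`-grading is the same thing as the involution `x ↦ (-1) ^ |x| x`. -/
def eigen {M : Type*} [AddCommGroup M] [Module ℂ M] (σ : M →ₗ[ℂ] M) (i : ZMod 2) :
    Submodule ℂ M where
  carrier := {x | σ x = ((-1 : ℤˣ) ^ i) • x}
  add_mem' {x y} hx hy := by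
    simp only [Set.mem_ofPred_eq] at *
    rw [map_add, hx, hy, smul_add]
  zero_mem' := by simp
  smul_mem' c x hx := by
    simp only [Set.mem_ofPred_eq] at *
    rw [map_smul, hx, smul_comm]

theorem mem_eigen {M : Type*} [AddCommGroup M] [Module ℂ M] (σ : M →ₗ[ℂ] M) (i : ZMod 2) (x : M) :
    x ∈ eigen σ i ↔ σ x = ((-1 : ℤˣ) ^ i) • x := Iff.rfl

/-- The decomposition `x = (x + σ x) / 2 + (x - σ x) / 2`. -/
@[reducible] def decompositionOfInvolution {M : Type*} [AddCommGroup M] [Module ℂ M]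
    (σ : M →ₗ[ℂ] M) (hσ : ∀ x, σ (σ x) = x) (P : ZMod 2 → Submodule ℂ M)
    (hP : ∀ i x, x ∈ P i ↔ σ x = ((-1 : ℤˣ) ^ i) • x) : DirectSum.Decomposition P :=
  DirectSum.Decomposition.ofLinearMap P
    (DirectSum.lof ℂ (ZMod 2) (fun i => P i) 0 ∘ₗ
        LinearMap.codRestrict (P 0) ((1 / 2 : ℂ) • (LinearMap.id + σ)) (fun x => by
          simp only [hP, LinearMap.smul_apply, LinearMap.add_apply, LinearMap.id_apply, map_smul,
            map_add, hσ, uzpow_zero, one_smul, add_comm]) +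
      DirectSum.lof ℂ (ZMod 2) (fun i => P i) 1 ∘ₗ
        LinearMap.codRestrict (P 1) ((1 / 2 : ℂ) • (LinearMap.id - σ)) (fun x => by
          simp only [hP, LinearMap.smul_apply, LinearMap.sub_apply, LinearMap.id_apply, map_smul,
            map_sub, hσ, uzpow_one, Units.smul_def, Units.val_neg, Units.val_one,
            neg_smul, one_smul, ← smul_neg, neg_sub]))
    (by
      refine LinearMap.ext fun x => ?_
      simp only [LinearMap.comp_apply, LinearMap.add_apply, map_add, DirectSum.coeLinearMap_lof,
        LinearMap.codRestrict_apply, LinearMap.smul_apply, LinearMap.sub_apply, LinearMap.id_apply]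
      module)
    (by
      refine DirectSum.linearMap_ext ℂ fun i => LinearMap.ext fun x => ?_
      have hx := (hP i x).1 x.2
      simp only [LinearMap.comp_apply, LinearMap.add_apply, DirectSum.coeLinearMap_lof,
        LinearMap.id_apply]
      rcases zmod2_cases i with rfl | rfl
      · have h1 : σ (x : M) = x := by rw [hx, uzpow_zero, one_smul]
        rw [Subtype.ext (a1 := LinearMap.codRestrict (P 0) _ _ _) (a2 := x) (by simp [h1]; module),
          Subtype.ext (a1 := LinearMap.codRestrict (P 1) _ _ _) (a2 := 0) (by simp [h1]),
          map_zero, add_zero]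
      · have h1 : σ (x : M) = -x := by
          rw [hx, uzpow_one, Units.smul_def, Units.val_neg, Units.val_one, neg_smul, one_smul]
        rw [Subtype.ext (a1 := LinearMap.codRestrict (P 0) _ _ _) (a2 := 0) (by simp [h1]),
          Subtype.ext (a1 := LinearMap.codRestrict (P 1) _ _ _) (a2 := x) (by simp [h1]; module),
          map_zero, zero_add])

/-- An algebra with an involutive automorphism is a superalgebra. -/
@[reducible] def gradedOfInvolution {B : Type*} [Ring B] [Algebra ℂ B]
    (σ : B →ₐ[ℂ] B) (hσ : ∀ x, σ (σ x) = x) (P : ZMod 2 → Submodule ℂ B)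
    (hP : ∀ i x, x ∈ P i ↔ σ x = ((-1 : ℤˣ) ^ i) • x) : GradedAlgebra P where
  toDecomposition := decompositionOfInvolution σ.toLinearMap hσ P hP
  one_mem := by rw [hP, map_one, uzpow_zero, one_smul]
  mul_mem i j x y hx hy := by
    rw [hP] at *
    rw [map_mul, hx, hy, smul_mul_smul_comm, uzpow_add]

/-- The subspace of `B ⊗ C` of parity `k`, for superalgebras `B` and `C`. -/
def tensorParity {B C : Type*} [Ring B] [Algebra ℂ B] [Ring C] [Algebra ℂ C]
    (P : ZMod 2 → Submodule ℂ B) (Q : ZMod 2 → Submodule ℂ C) [GradedAlgebra P] [GradedAlgebra Q]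
    (k : ZMod 2) : Submodule ℂ (P ᵍ⊗[ℂ] Q) :=
  Submodule.span ℂ {z | ∃ i j : ZMod 2, i + j = k ∧ ∃ b ∈ P i, ∃ c ∈ Q j, z = b ᵍ⊗ₜ[ℂ] c}

/-! ### Lie superalgebras -/

/-- A Lie superalgebra over `ℂ`. -/
structure LieSuperalgebra where
  carrier : Type
  [addCommGroup : AddCommGroup carrier]
  [module : Module ℂ carrier]
  /-- `parity 0` is the even part, `parity 1` is the odd part. -/
  parity : ZMod 2 → Submodule ℂ carrier
  isInternal : DirectSum.IsInternal parity
  bracket : carrier →ₗ[ℂ] carrier →ₗ[ℂ] carrier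
  bracket_mem : ∀ {i j : ZMod 2} {x y : carrier}, x ∈ parity i → y ∈ parity j →
    bracket x y ∈ parity (i + j)
  bracket_skew : ∀ {i j : ZMod 2} {x y : carrier}, x ∈ parity i → y ∈ parity j →
    bracket x y = -(((-1 : ℤˣ) ^ (i * j)) • bracket y x)
  bracket_jacobi : ∀ {i j k : ZMod 2} {x y z : carrier},
    x ∈ parity i → y ∈ parity j → z ∈ parity k →
    bracket x (bracket y z) =
      bracket (bracket x y) z + ((-1 : ℤˣ) ^ (i * j)) • bracket y (bracket x z)

namespace LieSuperalgebra

instance : CoeSort LieSuperalgebra Type := ⟨carrier⟩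

attribute [instance] addCommGroup module

variable (L : LieSuperalgebra)

theorem bijective_coe : Function.Bijective (DirectSum.coeLinearMap L.parity) := L.isInternal

/-- The parity involution `x ↦ (-1) ^ |x| x` of a Lie superalgebra. -/
def sigma : L →ₗ[ℂ] L :=
  (DirectSum.toModule ℂ (ZMod 2) L fun i =>
      (((-1 : ℤˣ) ^ i : ℤˣ) : ℤ) • (L.parity i).subtype) ∘ₗ
    (LinearEquiv.ofBijective (DirectSum.coeLinearMap L.parity) L.bijective_coe).symm.toLinearMap

theorem sigma_of_mem {i : ZMod 2} {x : L} (hx : x ∈ L.parity i) :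
    L.sigma x = ((-1 : ℤˣ) ^ i) • x := by
  have h : (LinearEquiv.ofBijective (DirectSum.coeLinearMap L.parity) L.bijective_coe).symm x =
      DirectSum.lof ℂ (ZMod 2) (fun i => L.parity i) i ⟨x, hx⟩ := by
    rw [LinearEquiv.symm_apply_eq, LinearEquiv.ofBijective_apply, DirectSum.coeLinearMap_lof]
  rw [sigma, LinearMap.comp_apply, LinearEquiv.coe_coe, h, DirectSum.toModule_lof]
  rfl

/-- Every element is the sum of its even and odd parts. -/
theorem exists_add (x : L) : ∃ a ∈ L.parity 0, ∃ b ∈ L.parity 1, x = a + b := by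
  have h : x ∈ ⨆ i, L.parity i := by
    rw [L.isInternal.submodule_iSup_eq_top]; trivial
  have h2 : (⨆ i, L.parity i) ≤ L.parity 0 ⊔ L.parity 1 := by
    refine iSup_le fun i => ?_
    rcases zmod2_cases i with rfl | rfl
    · exact le_sup_left
    · exact le_sup_right
  obtain ⟨a, ha, b, hb, hab⟩ := Submodule.mem_sup.1 (h2 h)
  exact ⟨a, ha, b, hb, hab.symm⟩

theorem sigma_zero_one {a b : L} (ha : a ∈ L.parity 0) (hb : b ∈ L.parity 1) :
    L.sigma (a + b) = a - b := by
  rw [map_add, L.sigma_of_mem ha, L.sigma_of_mem hb, uzpow_zero, uzpow_one, one_smul,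
    Units.smul_def, Units.val_neg, Units.val_one, neg_smul, one_smul, sub_eq_add_neg]

theorem sigma_sigma (x : L) : L.sigma (L.sigma x) = x := by
  obtain ⟨a, ha, b, hb, rfl⟩ := L.exists_add x
  rw [L.sigma_zero_one ha hb, sub_eq_add_neg, L.sigma_zero_one ha (neg_mem hb)]
  abel

theorem mem_parity_iff (i : ZMod 2) (x : L) :
    x ∈ L.parity i ↔ L.sigma x = ((-1 : ℤˣ) ^ i) • x := by
  refine ⟨L.sigma_of_mem, fun h => ?_⟩
  obtain ⟨a, ha, b, hb, rfl⟩ := L.exists_add x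
  rw [L.sigma_zero_one ha hb] at h
  rcases zmod2_cases i with rfl | rfl
  · rw [uzpow_zero, one_smul] at h
    have : b = 0 := by
      have h3 : (2 : ℂ) • b = 0 := by
        have h4 : a - b + (b - a) = a + b + (b - a) := congrArg (· + (b - a)) h
        calc (2 : ℂ) • b = a + b + (b - a) := by module
          _ = a - b + (b - a) := h4.symm
          _ = 0 := by abel
      simpa using h3
    rw [this, add_zero]; exact ha
  · rw [uzpow_one, Units.smul_def, Units.val_neg, Units.val_one, neg_smul, one_smul] at h
    have : a = 0 := by
      have h3 : (2 : ℂ) • a = 0 := by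
        calc (2 : ℂ) • a = a - b + (a + b) := by module
          _ = -(a + b) + (a + b) := by rw [h]
          _ = 0 := by abel
      simpa using h3
    rw [this, zero_add]; exact hb

/-- `S` is a subalgebra (that is, a sub-superalgebra): it is spanned by its homogeneous elements
and closed under the bracket. -/
structure IsSubalgebra (S : Submodule ℂ L) : Prop where
  homogeneous : S ≤ ⨆ i, S ⊓ L.parity i
  bracket_mem : ∀ {x y : L}, x ∈ S → y ∈ S → L.bracket x y ∈ S

variable {L}

theorem IsSubalgebra.sigma_mem {S : Submodule ℂ L} (hS : L.IsSubalgebra S) {x : L} (hx : x ∈ S) :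
    L.sigma x ∈ S := by
  have : S ≤ S.comap L.sigma := hS.homogeneous.trans (iSup_le fun i y hy => by
    rw [Submodule.mem_comap, L.sigma_of_mem hy.2, Units.smul_def]
    exact zsmul_mem hy.1 _)
  exact this hx

/-- A subalgebra, as a Lie superalgebra. -/
def IsSubalgebra.toLieSuperalgebra {S : Submodule ℂ L} (hS : L.IsSubalgebra S) :
    LieSuperalgebra where
  carrier := S
  parity i := (L.parity i).comap S.subtype
  isInternal :=
    letI := decompositionOfInvolution (L.sigma.restrict fun _ => hS.sigma_mem)
      (fun x => Subtype.ext (L.sigma_sigma x)) (fun i => (L.parity i).comap S.subtype)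
      (fun i x => by
        rw [Submodule.mem_comap, L.mem_parity_iff, Subtype.ext_iff]; rfl)
    DirectSum.Decomposition.isInternal _
  bracket := LinearMap.mk₂ ℂ (fun x y => ⟨L.bracket x y, hS.bracket_mem x.2 y.2⟩)
    (fun x y z => Subtype.ext (by simp)) (fun c x y => Subtype.ext (by simp))
    (fun x y z => Subtype.ext (by simp)) (fun c x y => Subtype.ext (by simp))
  bracket_mem hx hy := L.bracket_mem hx hy
  bracket_skew hx hy := Subtype.ext (L.bracket_skew hx hy)
  bracket_jacobi hx hy hz := Subtype.ext (L.bracket_jacobi hx hy hz)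

/-- The elements of `S`, as elements of the subalgebra. -/
def IsSubalgebra.of {S : Submodule ℂ L} (hS : L.IsSubalgebra S) :
    S →ₗ[ℂ] hS.toLieSuperalgebra where
  toFun x := x
  map_add' _ _ := rfl
  map_smul' _ _ := rfl

/-- An isomorphism of Lie superalgebras (of parity zero). -/
structure Iso (L M : LieSuperalgebra) where
  toLinearEquiv : L ≃ₗ[ℂ] M
  map_parity : ∀ i x, x ∈ L.parity i → toLinearEquiv x ∈ M.parity i
  map_bracket : ∀ x y, toLinearEquiv (L.bracket x y) =
    M.bracket (toLinearEquiv x) (toLinearEquiv y)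

/-- The bilinear map with `[x, y] = x y - (-1) ^ (|x| |y|) y x` for homogeneous `x` and `y`. -/
def supercommutator {B : Type} [Ring B] [Algebra ℂ B] (P : ZMod 2 → Submodule ℂ B)
    [GradedAlgebra P] : B →ₗ[ℂ] B →ₗ[ℂ] B :=
  LinearMap.mul ℂ B - ∑ i : ZMod 2, ∑ j : ZMod 2, (((-1 : ℤˣ) ^ (i * j) : ℤˣ) : ℤ) •
    ((LinearMap.mul ℂ B).flip.compl₁₂ (GradedAlgebra.proj P i) (GradedAlgebra.proj P j))

theorem supercommutator_apply {B : Type} [Ring B] [Algebra ℂ B] (P : ZMod 2 → Submodule ℂ B)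
    [GradedAlgebra P] {i j : ZMod 2} {x y : B} (hx : x ∈ P i) (hy : y ∈ P j) :
    supercommutator P x y = x * y - ((-1 : ℤˣ) ^ (i * j)) • (y * x) := by
  have hp : ∀ (i k : ZMod 2) (x : B), x ∈ P i → GradedAlgebra.proj P k x = if k = i then x else 0 := by
    intro i k x hx
    rw [GradedAlgebra.proj_apply]
    split_ifs with h
    · subst h; exact DirectSum.decompose_of_mem_same _ hx
    · exact DirectSum.decompose_of_mem_ne _ hx (Ne.symm h)
  simp only [supercommutator, LinearMap.sub_apply, LinearMap.mul_apply', LinearMap.sum_apply,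
    LinearMap.smul_apply, LinearMap.compl₁₂_apply, LinearMap.flip_apply, hp i _ x hx, hp j _ y hy]
  congr 1
  rw [Finset.sum_eq_single i, Finset.sum_eq_single j]
  · simp [Units.smul_def]
  · intro b _ hb; simp [hb]
  · simp
  · intro b _ hb; simp [hb]
  · simp

/-- An associative superalgebra is a Lie superalgebra under the supercommutator. -/
def ofAssociative {B : Type} [Ring B] [Algebra ℂ B] (P : ZMod 2 → Submodule ℂ B)
    [GradedAlgebra P] : LieSuperalgebra where
  carrier := B
  parity := P
  isInternal := DirectSum.Decomposition.isInternal P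
  bracket := supercommutator P
  bracket_mem {i j x y} hx hy := by
    rw [supercommutator_apply P hx hy, Units.smul_def]
    exact sub_mem (SetLike.mul_mem_graded hx hy)
      (zsmul_mem (add_comm i j ▸ SetLike.mul_mem_graded hy hx) _)
  bracket_skew {i j x y} hx hy := by
    rw [supercommutator_apply P hx hy, supercommutator_apply P hy hx, mul_comm j i]
    rcases zmod2_cases (i * j) with h | h <;> rw [h] <;> simp [Units.smul_def]
  bracket_jacobi {i j k x y z} hx hy hz := by
    have hm : ∀ {i j : ZMod 2} {x y : B}, x ∈ P i → y ∈ P j → supercommutator P x y ∈ P (i + j) := by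
      intro i j x y hx hy
      rw [supercommutator_apply P hx hy, Units.smul_def]
      exact sub_mem (SetLike.mul_mem_graded hx hy)
        (zsmul_mem (add_comm i j ▸ SetLike.mul_mem_graded hy hx) _)
    rw [supercommutator_apply P hx (hm hy hz), supercommutator_apply P (hm hx hy) hz,
      supercommutator_apply P hy (hm hx hz), supercommutator_apply P hy hz,
      supercommutator_apply P hx hy, supercommutator_apply P hx hz]
    have e : (1 + 1 : ZMod 2) = 0 := rfl
    rcases zmod2_cases i with rfl | rfl <;> rcases zmod2_cases j with rfl | rfl <;>
      rcases zmod2_cases k with rfl | rfl <;>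
      simp only [e, add_zero, zero_add, mul_zero, mul_one, uzpow_zero, uzpow_one,
        Units.smul_def, Units.val_neg, Units.val_one, neg_smul, one_smul] <;> noncomm_ring

end LieSuperalgebra

/-! ### Universal enveloping algebras -/

/-- The defining relations `x y = (-1) ^ (|x| |y|) y x + [x, y]` of `U(L)`. -/
inductive UEA.Rel (L : LieSuperalgebra) : TensorAlgebra ℂ L → TensorAlgebra ℂ L → Prop
  | bracket {i j : ZMod 2} {x y : L} (hx : x ∈ L.parity i) (hy : y ∈ L.parity j) :
    UEA.Rel L (TensorAlgebra.ι ℂ x * TensorAlgebra.ι ℂ y)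
      (((-1 : ℤˣ) ^ (i * j)) • (TensorAlgebra.ι ℂ y * TensorAlgebra.ι ℂ x) +
        TensorAlgebra.ι ℂ (L.bracket x y))

/-- The universal enveloping algebra `U(L)` of a Lie superalgebra. -/
def UEA (L : LieSuperalgebra) : Type := RingQuot (UEA.Rel L)

namespace UEA

variable (L : LieSuperalgebra)

instance : Ring (UEA L) := inferInstanceAs (Ring (RingQuot (UEA.Rel L)))

instance : Algebra ℂ (UEA L) := inferInstanceAs (Algebra ℂ (RingQuot (UEA.Rel L)))

/-- The canonical map `L → U(L)`. -/
def ι : L →ₗ[ℂ] UEA L := (RingQuot.mkAlgHom ℂ (UEA.Rel L)).toLinearMap ∘ₗ TensorAlgebra.ι ℂ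

variable {L}

theorem ι_mul_ι {i j : ZMod 2} {x y : L} (hx : x ∈ L.parity i) (hy : y ∈ L.parity j) :
    ι L x * ι L y = ((-1 : ℤˣ) ^ (i * j)) • (ι L y * ι L x) + ι L (L.bracket x y) := by
  have h := RingQuot.mkAlgHom_rel ℂ (Rel.bracket hx hy)
  rw [map_mul, map_add, Units.smul_def, map_zsmul, map_mul] at h
  exact h

/-- The universal property of `U(L)`. -/
def lift {B : Type*} [Ring B] [Algebra ℂ B] (f : L →ₗ[ℂ] B)
    (hf : ∀ {i j : ZMod 2} {x y : L}, x ∈ L.parity i → y ∈ L.parity j →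
      f x * f y = ((-1 : ℤˣ) ^ (i * j)) • (f y * f x) + f (L.bracket x y)) : UEA L →ₐ[ℂ] B :=
  RingQuot.liftAlgHom ℂ ⟨TensorAlgebra.lift ℂ f, by
    rintro _ _ ⟨hx, hy⟩
    rw [map_mul, map_add, Units.smul_def, map_zsmul, map_mul]
    simp only [TensorAlgebra.lift_ι_apply]
    exact hf hx hy⟩

theorem lift_ι {B : Type*} [Ring B] [Algebra ℂ B] (f : L →ₗ[ℂ] B)
    (hf : ∀ {i j : ZMod 2} {x y : L}, x ∈ L.parity i → y ∈ L.parity j →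
      f x * f y = ((-1 : ℤˣ) ^ (i * j)) • (f y * f x) + f (L.bracket x y)) (x : L) :
    lift f hf (ι L x) = f x := by
  refine (RingQuot.liftAlgHom_mkAlgHom_apply ℂ (TensorAlgebra.lift ℂ f) _ _).trans ?_
  rw [TensorAlgebra.lift_ι_apply]

theorem hom_ext {B : Type*} [Ring B] [Algebra ℂ B] {f g : UEA L →ₐ[ℂ] B}
    (h : ∀ x, f (ι L x) = g (ι L x)) : f = g :=
  RingQuot.ringQuot_ext' (A := TensorAlgebra ℂ L) (S := ℂ) (s := Rel L) f g
    (TensorAlgebra.hom_ext (LinearMap.ext h))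

theorem adjoin_ι : Algebra.adjoin ℂ (Set.range (ι L)) = ⊤ := by
  let S := Algebra.adjoin ℂ (Set.range (ι L))
  let f : UEA L →ₐ[ℂ] S := lift
    ((ι L).codRestrict (Subalgebra.toSubmodule S) fun x => Algebra.subset_adjoin ⟨x, rfl⟩)
    (fun hx hy => Subtype.ext (ι_mul_ι hx hy))
  have h : S.val.comp f = AlgHom.id ℂ _ := hom_ext fun x => by
    rw [AlgHom.comp_apply, lift_ι]; rfl
  refine Algebra.eq_top_iff.2 fun x => ?_
  have := DFunLike.congr_fun h x
  rw [AlgHom.comp_apply, AlgHom.id_apply] at this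
  rw [← this]
  exact (f x).2

variable (L)

theorem sigma_aux {i j : ZMod 2} {x y : L} (hx : x ∈ L.parity i) (hy : y ∈ L.parity j) :
    (ι L ∘ₗ L.sigma) x * (ι L ∘ₗ L.sigma) y =
      ((-1 : ℤˣ) ^ (i * j)) • ((ι L ∘ₗ L.sigma) y * (ι L ∘ₗ L.sigma) x) +
        (ι L ∘ₗ L.sigma) (L.bracket x y) := by
  simp only [LinearMap.comp_apply, L.sigma_of_mem hx, L.sigma_of_mem hy,
    L.sigma_of_mem (L.bracket_mem hx hy), Units.smul_def, map_zsmul]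
  simp only [← Units.smul_def, smul_mul_smul_comm]
  rw [ι_mul_ι hx hy, smul_add, uzpow_add, mul_comm ((-1 : ℤˣ) ^ j), smul_comm]

/-- The automorphism `x ↦ (-1) ^ |x| x` of `U(L)`. -/
def sigma : UEA L →ₐ[ℂ] UEA L := lift (ι L ∘ₗ L.sigma) (sigma_aux L)

theorem sigma_ι (x : L) : sigma L (ι L x) = ι L (L.sigma x) :=
  lift_ι _ (sigma_aux L) x

theorem sigma_sigma (x : UEA L) : sigma L (sigma L x) = x := by
  have : (sigma L).comp (sigma L) = AlgHom.id ℂ _ := hom_ext fun x => by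
    rw [AlgHom.comp_apply, sigma_ι, sigma_ι, L.sigma_sigma, AlgHom.id_apply]
  exact DFunLike.congr_fun this x

/-- The parity of `U(L)`: the grading for which the canonical map `L → U(L)` is even. -/
def parity (i : ZMod 2) : Submodule ℂ (UEA L) := eigen (sigma L).toLinearMap i

instance : GradedAlgebra (parity L) :=
  gradedOfInvolution (sigma L) (sigma_sigma L) _ fun _ _ => Iff.rfl

end UEA

/-! ### The centerless Neveu-Schwarz algebra, extended by `A = ℂ[t, t⁻¹] ⊗ Λ(1)` -/

/-- The basis of `𝔨 ⋉ A`: `L n` is `L_n`, `G n` is `G_{n - 1/2}`, `t k` is `t ^ k` and `θ k` is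
`t ^ k ξ`. -/
inductive Ix : Type
  | L (n : ℤ)
  | G (n : ℤ)
  | t (k : ℤ)
  | θ (k : ℤ)

namespace Ix

/-- The parity of a basis element. -/
def par : Ix → ZMod 2
  | L _ => 0
  | G _ => 1
  | t _ => 0
  | θ _ => 1

/-- The bracket of `𝔨 ⋉ A` on the basis.  The first four lines are the brackets of `𝔨`:
`[L_m, L_n] = (n - m) L_{m+n}`, `[L_m, G_r] = (r - m/2) G_{m+r}`, `[G_r, G_s] = -2 L_{r+s}`.
The next four are the actions of `L_m = t ^ (m+1) ∂_t + (m+1)/2 t ^ m ξ ∂_ξ` and of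
`G_{m-1/2} = t ^ m ξ ∂_t - t ^ m ∂_ξ` on `A`; the bracket of `A` with itself is zero. -/
def br : Ix → Ix → (Ix →₀ ℂ)
  | L m, L n => Finsupp.single (L (m + n)) ((n : ℂ) - m)
  | L m, G n => Finsupp.single (G (m + n)) ((n : ℂ) - 1 / 2 - m / 2)
  | G n, L m => Finsupp.single (G (m + n)) (-((n : ℂ) - 1 / 2 - m / 2))
  | G m, G n => Finsupp.single (L (m + n - 1)) (-2)
  | L m, t k => Finsupp.single (t (m + k)) (k : ℂ)
  | L m, θ k => Finsupp.single (θ (m + k)) ((k : ℂ) + (m + 1) / 2)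
  | G m, t k => Finsupp.single (θ (m + k - 1)) (k : ℂ)
  | G m, θ k => Finsupp.single (t (m + k)) (-1)
  | t k, L m => Finsupp.single (t (m + k)) (-(k : ℂ))
  | θ k, L m => Finsupp.single (θ (m + k)) (-((k : ℂ) + (m + 1) / 2))
  | t k, G m => Finsupp.single (θ (m + k - 1)) (-(k : ℂ))
  | θ k, G m => Finsupp.single (t (m + k)) (-1)
  | t _, t _ => 0
  | t _, θ _ => 0
  | θ _, t _ => 0
  | θ _, θ _ => 0

/-- The bilinear extension of `br`. -/
def bracket : (Ix →₀ ℂ) →ₗ[ℂ] (Ix →₀ ℂ) →ₗ[ℂ] (Ix →₀ ℂ) :=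
  Finsupp.linearCombination ℂ fun a => Finsupp.linearCombination ℂ (br a)

/-- The part of parity `i`. -/
def parity (i : ZMod 2) : Submodule ℂ (Ix →₀ ℂ) := Finsupp.supported ℂ ℂ {b | b.par = i}

theorem bracket_single (a b : Ix) (c d : ℂ) :
    bracket (Finsupp.single a c) (Finsupp.single b d) = (c * d) • br a b := by
  simp [bracket, Finsupp.linearCombination_single, smul_smul]

theorem supported_induction {S : Set Ix} {P : (Ix →₀ ℂ) → Prop} (h0 : P 0)
    (hadd : ∀ x y, P x → P y → P (x + y)) (hs : ∀ b ∈ S, ∀ c, P (Finsupp.single b c))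
    {x : Ix →₀ ℂ} (hx : x ∈ Finsupp.supported ℂ ℂ S) : P x := by
  rw [← Finsupp.sum_single x, Finsupp.sum]
  refine Finset.sum_induction _ P hadd h0 fun b hb => hs b (hx hb) _

theorem single_mem {S : Set Ix} {b : Ix} (hb : b ∈ S) (c : ℂ) :
    Finsupp.single b c ∈ Finsupp.supported ℂ ℂ S := Finsupp.single_mem_supported ℂ c hb

/-- The parity involution on the basis. -/
def sigma : (Ix →₀ ℂ) →ₗ[ℂ] (Ix →₀ ℂ) :=
  Finsupp.linearCombination ℂ fun b => ((-1 : ℤˣ) ^ b.par) • Finsupp.single b (1 : ℂ)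

theorem sigma_apply (x : Ix →₀ ℂ) (b : Ix) : sigma x b = ((-1 : ℤˣ) ^ b.par) • x b := by
  induction x using Finsupp.induction_linear with
  | zero => simp
  | add x y hx hy => simp [hx, hy]
  | single a c =>
    classical
    simp only [sigma, Finsupp.linearCombination_single, Finsupp.smul_apply, Finsupp.single_apply,
      Units.smul_def]
    split_ifs with h
    · subst h; simp [mul_comm]
    · simp

theorem sigma_sigma (x : Ix →₀ ℂ) : sigma (sigma x) = x := by
  ext b
  rw [sigma_apply, sigma_apply, smul_smul, Int.units_mul_self, one_smul]

theorem mem_parity_iff (i : ZMod 2) (x : Ix →₀ ℂ) :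
    x ∈ parity i ↔ sigma x = ((-1 : ℤˣ) ^ i) • x := by
  have key : ∀ a : ℂ, -a = a → a = 0 := fun a h => by linear_combination (-1 / 2 : ℂ) * h
  constructor
  · intro h
    ext b
    rw [sigma_apply, Finsupp.smul_apply]
    by_cases hb : x b = 0
    · simp [hb]
    · have : b.par = i := h (Finsupp.mem_support_iff.2 hb)
      rw [this]
  · intro h b hb
    have hb' := Finsupp.mem_support_iff.1 hb
    have h2 := DFunLike.congr_fun h b
    rw [sigma_apply, Finsupp.smul_apply] at h2
    by_contra hne
    apply hb'
    simp only [Set.mem_ofPred_eq] at hne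
    rcases zmod2_cases b.par with e | e <;> rcases zmod2_cases i with rfl | rfl <;>
      simp only [e, not_true_eq_false, uzpow_zero, uzpow_one, Units.smul_def, Units.val_neg,
        Units.val_one, neg_smul, one_smul] at hne h2
    · exact key _ h2.symm
    · exact key _ h2

theorem br_mem (a b : Ix) : br a b ∈ parity (a.par + b.par) := by
  cases a <;> cases b <;> first | exact zero_mem _ | exact Finsupp.single_mem_supported ℂ _ (by
    simp only [Set.mem_ofPred_eq, par]; rfl)

theorem br_skew (a b : Ix) : br a b = -(((-1 : ℤˣ) ^ (a.par * b.par)) • br b a) := by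
  cases a <;> cases b <;> simp [br, par, Units.smul_def, add_comm, neg_add_eq_sub]

theorem single_eq_add {i j k : Ix} {a b c : ℂ} (hj : j = i) (hk : k = i) (h : a = b + c) :
    Finsupp.single i a = Finsupp.single j b + Finsupp.single k c := by
  subst hj; subst hk; rw [h, Finsupp.single_add]

theorem bracket_br (a b c : Ix) : bracket (Finsupp.single a 1) (br b c) =
    bracket (br a b) (Finsupp.single c 1) +
      ((-1 : ℤˣ) ^ (a.par * b.par)) • bracket (Finsupp.single b 1) (br a c) := by
  cases a <;> cases b <;> cases c <;>
    simp only [br, par, bracket_single, map_zero, LinearMap.zero_apply, smul_zero, add_zero,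
      mul_zero, mul_one, one_mul, uzpow_zero, uzpow_one, Units.smul_def, Units.val_neg,
      Units.val_one, neg_smul, one_smul, Finsupp.smul_single, smul_eq_mul, ← Finsupp.single_neg]
  all_goals
    exact single_eq_add (by congr 1; ring) (by congr 1; ring) (by push_cast; ring)

end Ix

open Ix in
/-- The Lie superalgebra `𝔨 ⋉ A`. -/
def kTilde : LieSuperalgebra where
  carrier := Ix →₀ ℂ
  parity := Ix.parity
  isInternal :=
    letI := decompositionOfInvolution Ix.sigma Ix.sigma_sigma Ix.parity Ix.mem_parity_iff
    DirectSum.Decomposition.isInternal _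
  bracket := Ix.bracket
  bracket_mem {i j x y} hx hy := by
    refine supported_induction (P := fun x => bracket x y ∈ parity (i + j)) ?_ ?_ ?_ hx
    · simp
    · intro x x' h h'; rw [map_add, LinearMap.add_apply]; exact add_mem h h'
    · rintro a rfl c
      refine supported_induction (P := fun y => bracket _ y ∈ parity (a.par + j)) ?_ ?_ ?_ hy
      · simp
      · intro x x' h h'; rw [map_add]; exact add_mem h h'
      · rintro b rfl d
        rw [bracket_single]
        exact Submodule.smul_mem _ _ (br_mem a b)
  bracket_skew {i j x y} hx hy := by
    refine supported_induction (P := fun x => bracket x y =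
      -(((-1 : ℤˣ) ^ (i * j)) • bracket y x)) ?_ ?_ ?_ hx
    · simp
    · intro x x' h h'
      rw [map_add, LinearMap.add_apply, h, h', map_add, smul_add, neg_add]
    · rintro a rfl c
      refine supported_induction (P := fun y => bracket _ y =
        -(((-1 : ℤˣ) ^ (a.par * j)) • bracket y _)) ?_ ?_ ?_ hy
      · simp
      · intro x x' h h'
        rw [map_add, h, h', map_add, LinearMap.add_apply, smul_add, neg_add]
      · rintro b rfl d
        rw [bracket_single, bracket_single, br_skew a b, smul_neg, smul_comm, mul_comm d]
  bracket_jacobi {i j k x y z} hx hy hz := by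
    refine supported_induction (P := fun x => bracket x (bracket y z) =
      bracket (bracket x y) z + ((-1 : ℤˣ) ^ (i * j)) • bracket y (bracket x z)) ?_ ?_ ?_ hx
    · simp
    · intro x x' h h'
      simp only [map_add, LinearMap.add_apply, h, h', smul_add]
      abel
    · rintro a rfl c
      refine supported_induction (P := fun y => bracket (Finsupp.single a c) (bracket y z) =
        bracket (bracket (Finsupp.single a c) y) z +
          ((-1 : ℤˣ) ^ (a.par * j)) • bracket y (bracket (Finsupp.single a c) z)) ?_ ?_ ?_ hy
      · simp
      · intro x x' h h'
        simp only [map_add, LinearMap.add_apply, h, h', smul_add]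
        abel
      · rintro b rfl d
        refine supported_induction (P := fun z =>
          bracket (Finsupp.single a c) (bracket (Finsupp.single b d) z) =
          bracket (bracket (Finsupp.single a c) (Finsupp.single b d)) z +
            ((-1 : ℤˣ) ^ (a.par * b.par)) •
              bracket (Finsupp.single b d) (bracket (Finsupp.single a c) z)) ?_ ?_ ?_ hz
        · simp
        · intro x x' h h'
          simp only [map_add, h, h', smul_add]
          abel
        · rintro e rfl f
          have hs : ∀ (b : Ix) (c : ℂ), Finsupp.single b c = c • Finsupp.single b (1 : ℂ) := by
            intro b c; rw [Finsupp.smul_single, smul_eq_mul, mul_one]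
          rw [hs a c, hs b d, hs e f]
          simp only [map_smul, LinearMap.smul_apply]
          rw [bracket_single b e, bracket_single a b, bracket_single a e, mul_one, one_smul,
            one_smul, one_smul, bracket_br a b e]
          simp only [smul_add, smul_smul, smul_comm _ ((-1 : ℤˣ) ^ (a.par * b.par))]
          congr 3
          · ring

theorem Ix.supported_homogeneous (S : Set Ix) : Finsupp.supported ℂ ℂ S ≤
    ⨆ i, Finsupp.supported ℂ ℂ S ⊓ Ix.parity i := fun x hx => by
  refine Ix.supported_induction (P := fun x => x ∈ ⨆ i, Finsupp.supported ℂ ℂ S ⊓ Ix.parity i)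
    (zero_mem _) (fun _ _ h h' => add_mem h h') (fun b hb c => ?_) hx
  exact Submodule.mem_iSup_of_mem b.par ⟨Ix.single_mem hb c, Finsupp.single_mem_supported ℂ c rfl⟩

theorem Ix.bracket_mem_supported {S : Set Ix}
    (hS : ∀ a ∈ S, ∀ b ∈ S, Ix.br a b ∈ Finsupp.supported ℂ ℂ S) {x y : Ix →₀ ℂ}
    (hx : x ∈ Finsupp.supported ℂ ℂ S) (hy : y ∈ Finsupp.supported ℂ ℂ S) :
    Ix.bracket x y ∈ Finsupp.supported ℂ ℂ S := by
  refine Ix.supported_induction (P := fun x => Ix.bracket x y ∈ Finsupp.supported ℂ ℂ S)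
    ?_ ?_ ?_ hx
  · simp
  · intro x x' h h'; rw [map_add, LinearMap.add_apply]; exact add_mem h h'
  · intro a ha c
    refine Ix.supported_induction (P := fun y => Ix.bracket _ y ∈ Finsupp.supported ℂ ℂ S)
      ?_ ?_ ?_ hy
    · simp
    · intro x x' h h'; rw [map_add]; exact add_mem h h'
    · intro b hb d
      rw [Ix.bracket_single]
      exact Submodule.smul_mem _ _ (hS a ha b hb)

theorem isSubalgebra_supported {S : Set Ix}
    (hS : ∀ a ∈ S, ∀ b ∈ S, Ix.br a b ∈ Finsupp.supported ℂ ℂ S) :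
    kTilde.IsSubalgebra (Finsupp.supported ℂ ℂ S) where
  homogeneous := Ix.supported_homogeneous S
  bracket_mem hx hy := Ix.bracket_mem_supported hS hx hy

/-- The basis elements `L_n` with `n ≥ 0` and `G_r` with `r ≥ 0` (that is, `r ≥ 1/2`). -/
def Ix.geZero : Set Ix := {b | match b with
  | .L n => 0 ≤ n
  | .G n => 1 ≤ n
  | .t _ => False
  | .θ _ => False}

theorem supported_coef {S : Set Ix} {b : Ix} {c : ℂ} (h : c = 0 ∨ b ∈ S) :
    Finsupp.single b c ∈ Finsupp.supported ℂ ℂ S := by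
  rcases h with rfl | h
  · rw [Finsupp.single_zero]; exact zero_mem _
  · exact Ix.single_mem h c

theorem isSubalgebra_geZero : kTilde.IsSubalgebra (Finsupp.supported ℂ ℂ Ix.geZero) :=
  isSubalgebra_supported fun a ha b hb => by
    cases a <;> cases b <;> simp only [Ix.geZero, Set.mem_ofPred_eq] at ha hb <;>
      first
      | exact zero_mem _
      | exact ha.elim
      | exact hb.elim
      | exact supported_coef (Or.inr (by simp only [Ix.geZero, Set.mem_ofPred_eq]; omega))

/-- The Lie superalgebra `𝔨_{≥ 0}`, spanned by the `L_n` and `G_r` with `n ≥ 0`, `r ≥ 1/2`. -/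
def kGeZero : LieSuperalgebra := isSubalgebra_geZero.toLieSuperalgebra

/-- The two algebras of functions: `laurent` stands for `A = ℂ[t, t⁻¹] ⊗ Λ(1)` and `poly` stands
for `A⁺ = ℂ[t] ⊗ Λ(1)`. -/
inductive Fun : Type
  | laurent
  | poly

/-- The exponents of `t` that are allowed. -/
def Fun.exps : Fun → Set ℤ
  | .laurent => Set.univ
  | .poly => {k | 0 ≤ k}

theorem Fun.natCast_mem (r : Fun) (k : ℕ) : (k : ℤ) ∈ r.exps := by
  cases r
  · trivial
  · exact Int.natCast_nonneg k

theorem Fun.add_mem (r : Fun) {j k : ℤ} (hj : j ∈ r.exps) (hk : k ∈ r.exps) :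
    j + k ∈ r.exps := by
  cases r
  · trivial
  · exact add_nonneg (a := j) (b := k) hj hk

theorem Fun.shift (r : Fun) {m k : ℤ} (hm : -1 ≤ m) (hk : k ∈ r.exps) :
    (k : ℂ) = 0 ∨ m + k ∈ r.exps := by
  cases r
  · right; trivial
  · by_cases h : k = 0
    · left; simp [h]
    · right
      simp only [Fun.exps, Set.mem_ofPred_eq] at *
      omega

/-- The basis of `𝔨⁺ ⋉ A` (or `𝔨⁺ ⋉ A⁺`): `L_n` with `n ≥ -1`, `G_r` with `r ≥ -1/2`, and `t ^ k`,
`t ^ k ξ`. -/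
def Fun.ix (r : Fun) : Set Ix := {b | match b with
  | .L n => -1 ≤ n
  | .G n => 0 ≤ n
  | .t k => k ∈ r.exps
  | .θ k => k ∈ r.exps}

theorem Fun.t_mem (r : Fun) {k : ℤ} (hk : k ∈ r.exps) : Ix.t k ∈ r.ix := hk

theorem Fun.θ_mem (r : Fun) {k : ℤ} (hk : k ∈ r.exps) : Ix.θ k ∈ r.ix := hk

theorem Fun.L_mem (r : Fun) {n : ℤ} (hn : -1 ≤ n) : Ix.L n ∈ r.ix := hn

theorem Fun.G_mem (r : Fun) {n : ℤ} (hn : 0 ≤ n) : Ix.G n ∈ r.ix := hn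

theorem br_mem_supported_ix (r : Fun) {a b : Ix} (ha : a ∈ r.ix) (hb : b ∈ r.ix) :
    Ix.br a b ∈ Finsupp.supported ℂ ℂ r.ix := by
  have hθ : ∀ m k : ℤ, -1 ≤ m → k ∈ r.exps → (k : ℂ) + (m + 1) / 2 = 0 ∨ m + k ∈ r.exps := by
    intro m k hm hk
    by_cases h : m = -1
    · subst h
      rcases r.shift hm hk with h | h
      · left; rw [h]; norm_num
      · exact Or.inr h
    · right
      obtain ⟨n, rfl⟩ := Int.eq_ofNat_of_zero_le (show 0 ≤ m by omega)
      exact r.add_mem (r.natCast_mem n) hk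
  have hG : ∀ m k : ℤ, 0 ≤ m → k ∈ r.exps → (k : ℂ) = 0 ∨ m + k - 1 ∈ r.exps := by
    intro m k hm hk
    have := r.shift (m := m - 1) (by omega) hk
    rwa [sub_add_eq_add_sub] at this
  have hG' : ∀ m k : ℤ, 0 ≤ m → k ∈ r.exps → m + k ∈ r.exps := by
    intro m k hm hk
    obtain ⟨n, rfl⟩ := Int.eq_ofNat_of_zero_le hm
    exact r.add_mem (r.natCast_mem n) hk
  have hLL : ∀ m n : ℤ, -1 ≤ m → -1 ≤ n → (n : ℂ) - m = 0 ∨ -1 ≤ m + n := by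
    intro m n hm hn
    by_cases h : m = n
    · left; simp [h]
    · right; omega
  have hLG : ∀ m n : ℤ, -1 ≤ m → 0 ≤ n → (n : ℂ) - 1 / 2 - m / 2 = 0 ∨ 0 ≤ m + n := by
    intro m n hm hn
    by_cases h : m = -1 ∧ n = 0
    · left; rw [h.1, h.2]; norm_num
    · right; omega
  cases a <;> cases b <;> simp only [Fun.ix, Set.mem_ofPred_eq] at ha hb <;> unfold Ix.br <;>
    first
    | exact zero_mem _
    | refine supported_coef ?_
  all_goals simp only [Fun.ix, Set.mem_ofPred_eq, neg_eq_zero]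
  · exact hLL _ _ ha hb
  · exact hLG _ _ ha hb
  · exact r.shift ha hb
  · exact hθ _ _ ha hb
  · exact hLG _ _ hb ha
  · right; omega
  · exact hG _ _ ha hb
  · exact Or.inr (hG' _ _ ha hb)
  · exact r.shift hb ha
  · exact hG _ _ hb ha
  · exact hθ _ _ hb ha
  · exact Or.inr (hG' _ _ hb ha)

/-- The Lie superalgebra `𝔨⁺ ⋉ A` (for `laurent`), respectively `𝔨⁺ ⋉ A⁺` (for `poly`). -/
def kPlus (r : Fun) : LieSuperalgebra :=
  (isSubalgebra_supported (S := r.ix) fun _ ha _ hb =>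
    br_mem_supported_ix r ha hb).toLieSuperalgebra

/-- The linear combinations of the basis elements in `r.ix` are the elements of `kPlus r`. -/
def kPlusOf (r : Fun) : Finsupp.supported ℂ ℂ r.ix →ₗ[ℂ] kPlus r where
  toFun x := x
  map_add' _ _ := rfl
  map_smul' _ _ := rfl

/-- A basis element of `𝔨⁺ ⋉ A`, as an element of `U(𝔨⁺ ⋉ A)`. -/
def ugen (r : Fun) (b : Ix) (hb : b ∈ r.ix) : UEA (kPlus r) :=
  UEA.ι (kPlus r) (kPlusOf r ⟨Finsupp.single b 1, Ix.single_mem hb 1⟩)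

/-- The generators `t^i · t^j - t^(i+j)`, `t^0 - 1`, `t^i · ξ - t^i ξ` and `ξ · ξ`. -/
inductive idealGen (r : Fun) : UEA (kPlus r) → Prop
  | mul (i j : ℤ) (hi : i ∈ r.exps) (hj : j ∈ r.exps) : idealGen r
      (ugen r (.t i) (r.t_mem hi) * ugen r (.t j) (r.t_mem hj) -
        ugen r (.t (i + j)) (r.t_mem (r.add_mem hi hj)))
  | one : idealGen r (ugen r (.t 0) (r.t_mem (r.natCast_mem 0)) - 1)
  | mul_xi (i : ℤ) (hi : i ∈ r.exps) : idealGen r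
      (ugen r (.t i) (r.t_mem hi) * ugen r (.θ 0) (r.θ_mem (r.natCast_mem 0)) -
        ugen r (.θ i) (r.θ_mem hi))
  | xi_xi : idealGen r (ugen r (.θ 0) (r.θ_mem (r.natCast_mem 0)) *
      ugen r (.θ 0) (r.θ_mem (r.natCast_mem 0)))

/-- The left ideal generated by these elements. -/
def leftIdeal (r : Fun) : Ideal (UEA (kPlus r)) := Ideal.span {x | idealGen r x}

section TwoSided

variable (r : Fun)

/-- `ugen`, extended by zero. -/
def egen (b : Ix) : UEA (kPlus r) := by
  classical exact if h : b ∈ r.ix then ugen r b h else 0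

variable {r}

theorem egen_eq {b : Ix} (hb : b ∈ r.ix) : egen r b = ugen r b hb := by
  rw [egen, dif_pos hb]

theorem ι_single {b : Ix} {c : ℂ} (h : Finsupp.single b c ∈ Finsupp.supported ℂ ℂ r.ix) :
    UEA.ι (kPlus r) (kPlusOf r ⟨Finsupp.single b c, h⟩) = c • egen r b := by
  by_cases hb : b ∈ r.ix
  · rw [egen_eq hb, ugen, ← map_smul, ← map_smul]
    congr 2
    apply Subtype.ext
    show Finsupp.single b c = c • Finsupp.single b (1 : ℂ)
    rw [Finsupp.smul_single, smul_eq_mul, mul_one]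
  · have hc : c = 0 := by
      by_contra hc
      exact hb (h (Finsupp.mem_support_iff.2 (by simpa using hc)))
    subst hc
    rw [zero_smul]
    have : (⟨Finsupp.single b 0, h⟩ : Finsupp.supported ℂ ℂ r.ix) = 0 :=
      Subtype.ext (Finsupp.single_zero b)
    rw [this, map_zero, map_zero]

theorem bracket_kPlusOf {a b : Ix} (ha : a ∈ r.ix) (hb : b ∈ r.ix) :
    (kPlus r).bracket (kPlusOf r ⟨Finsupp.single a 1, Ix.single_mem ha 1⟩)
      (kPlusOf r ⟨Finsupp.single b 1, Ix.single_mem hb 1⟩) =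
      kPlusOf r ⟨Ix.br a b, br_mem_supported_ix r ha hb⟩ := by
  apply Subtype.ext
  refine (Ix.bracket_single a b 1 1).trans ?_
  rw [mul_one, one_smul]
  rfl

theorem kPlusOf_single_mem {a : Ix} (ha : a ∈ r.ix) :
    kPlusOf r ⟨Finsupp.single a 1, Ix.single_mem ha 1⟩ ∈ (kPlus r).parity a.par :=
  Finsupp.single_mem_supported ℂ (s := {b : Ix | b.par = a.par}) (1 : ℂ) rfl

theorem egen_mul {a b : Ix} (ha : a ∈ r.ix) (hb : b ∈ r.ix) : egen r a * egen r b =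
    ((-1 : ℤˣ) ^ (a.par * b.par)) • (egen r b * egen r a) +
      UEA.ι (kPlus r) (kPlusOf r ⟨Ix.br a b, br_mem_supported_ix r ha hb⟩) := by
  rw [egen_eq ha, egen_eq hb, ugen, ugen,
    UEA.ι_mul_ι (kPlusOf_single_mem ha) (kPlusOf_single_mem hb), bracket_kPlusOf ha hb]

theorem ι_zero (h : (0 : Ix →₀ ℂ) ∈ Finsupp.supported ℂ ℂ r.ix) :
    UEA.ι (kPlus r) (kPlusOf r ⟨0, h⟩) = 0 := by
  have : (⟨0, h⟩ : Finsupp.supported ℂ ℂ r.ix) = 0 := rfl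
  rw [this, map_zero, map_zero]

theorem t_mul_t {i j : ℤ} (hi : i ∈ r.exps) (hj : j ∈ r.exps) :
    egen r (.t i) * egen r (.t j) = egen r (.t j) * egen r (.t i) := by
  rw [egen_mul (r := r) (a := .t i) (b := .t j) hi hj]
  simp only [Ix.par, mul_zero, uzpow_zero, one_smul, Ix.br]
  rw [ι_zero, add_zero]

theorem t_mul_θ {i j : ℤ} (hi : i ∈ r.exps) (hj : j ∈ r.exps) :
    egen r (.t i) * egen r (.θ j) = egen r (.θ j) * egen r (.t i) := by
  rw [egen_mul (r := r) (a := .t i) (b := .θ j) hi hj]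
  simp only [Ix.par, zero_mul, uzpow_zero, one_smul, Ix.br]
  rw [ι_zero, add_zero]

theorem θ_mul_θ {i j : ℤ} (hi : i ∈ r.exps) (hj : j ∈ r.exps) :
    egen r (.θ i) * egen r (.θ j) = -(egen r (.θ j) * egen r (.θ i)) := by
  rw [egen_mul (r := r) (a := .θ i) (b := .θ j) hi hj]
  simp only [Ix.par, mul_one, uzpow_one, Ix.br, Units.smul_def, Units.val_neg, Units.val_one,
    neg_smul, one_smul]
  rw [ι_zero, add_zero]

theorem t_mul_L {k m : ℤ} (hk : k ∈ r.exps) (hm : -1 ≤ m) :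
    egen r (.t k) * egen r (.L m) =
      egen r (.L m) * egen r (.t k) - (k : ℂ) • egen r (.t (m + k)) := by
  rw [egen_mul (r := r) (a := .t k) (b := .L m) hk hm]
  simp only [Ix.par, mul_zero, uzpow_zero, one_smul, Ix.br, ι_single, neg_smul, sub_eq_add_neg]

theorem θ_mul_L {k m : ℤ} (hk : k ∈ r.exps) (hm : -1 ≤ m) :
    egen r (.θ k) * egen r (.L m) =
      egen r (.L m) * egen r (.θ k) - ((k : ℂ) + (m + 1) / 2) • egen r (.θ (m + k)) := by
  rw [egen_mul (r := r) (a := .θ k) (b := .L m) hk hm]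
  simp only [Ix.par, mul_zero, uzpow_zero, one_smul, Ix.br, ι_single, neg_smul, sub_eq_add_neg]

theorem t_mul_G {k m : ℤ} (hk : k ∈ r.exps) (hm : 0 ≤ m) :
    egen r (.t k) * egen r (.G m) =
      egen r (.G m) * egen r (.t k) - (k : ℂ) • egen r (.θ (m + k - 1)) := by
  rw [egen_mul (r := r) (a := .t k) (b := .G m) hk hm]
  simp only [Ix.par, zero_mul, uzpow_zero, one_smul, Ix.br, ι_single, neg_smul, sub_eq_add_neg]

theorem θ_mul_G {k m : ℤ} (hk : k ∈ r.exps) (hm : 0 ≤ m) :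
    egen r (.θ k) * egen r (.G m) =
      -(egen r (.G m) * egen r (.θ k)) - egen r (.t (m + k)) := by
  rw [egen_mul (r := r) (a := .θ k) (b := .G m) hk hm]
  simp only [Ix.par, mul_one, uzpow_one, Ix.br, ι_single, neg_smul, one_smul, sub_eq_add_neg,
    Units.smul_def, Units.val_neg, Units.val_one]

/-- The projection modulo the left ideal. -/
def qmap (r : Fun) : UEA (kPlus r) →ₗ[UEA (kPlus r)] UEA (kPlus r) ⧸ leftIdeal r :=
  (leftIdeal r).mkQ

theorem qmap_mul (u v : UEA (kPlus r)) : qmap r (u * v) = u • qmap r v := by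
  rw [← smul_eq_mul, map_smul]

theorem qmap_csmul (c : ℂ) (v : UEA (kPlus r)) :
    qmap r (c • v) = algebraMap ℂ (UEA (kPlus r)) c • qmap r v := by
  rw [Algebra.smul_def, qmap_mul]

theorem qmap_gen {x : UEA (kPlus r)} (hx : idealGen r x) : qmap r x = 0 :=
  (Submodule.Quotient.mk_eq_zero _).2 (Ideal.subset_span hx)

theorem q_tt {i j : ℤ} (hi : i ∈ r.exps) (hj : j ∈ r.exps) :
    qmap r (egen r (.t i) * egen r (.t j)) = qmap r (egen r (.t (i + j))) := by
  rw [egen_eq (b := .t i) hi, egen_eq (b := .t j) hj, egen_eq (b := .t (i + j)) (r.add_mem hi hj),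
    ← sub_eq_zero, ← map_sub]
  exact qmap_gen (.mul i j hi hj)

theorem q_tξ {i : ℤ} (hi : i ∈ r.exps) :
    qmap r (egen r (.t i) * egen r (.θ 0)) = qmap r (egen r (.θ i)) := by
  rw [egen_eq (b := .t i) hi, egen_eq (b := .θ i) hi, egen_eq (b := .θ 0) (r.natCast_mem 0),
    ← sub_eq_zero, ← map_sub]
  exact qmap_gen (.mul_xi i hi)

theorem q_ξξ : qmap r (egen r (.θ 0) * egen r (.θ 0)) = 0 := by
  rw [egen_eq (b := .θ 0) (r.natCast_mem 0)]
  exact qmap_gen .xi_xi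

theorem q_tθ {i j : ℤ} (hi : i ∈ r.exps) (hj : j ∈ r.exps) :
    qmap r (egen r (.t i) * egen r (.θ j)) = qmap r (egen r (.θ (i + j))) := by
  have h0 : (0 : ℤ) ∈ r.exps := r.natCast_mem 0
  rw [qmap_mul, ← q_tξ hj, ← qmap_mul, ← mul_assoc, ← q_tξ (r.add_mem hi hj),
    t_mul_θ (r.add_mem hi hj) h0, qmap_mul _ (egen r (.t (i + j))), ← q_tt hi hj, ← qmap_mul,
    mul_assoc, t_mul_θ hj h0, ← mul_assoc, t_mul_θ hi h0, mul_assoc]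

theorem q_θt {i j : ℤ} (hi : i ∈ r.exps) (hj : j ∈ r.exps) :
    qmap r (egen r (.θ i) * egen r (.t j)) = qmap r (egen r (.θ (i + j))) := by
  rw [← t_mul_θ hj hi, q_tθ hj hi, add_comm]

theorem q_ξθ {i : ℤ} (hi : i ∈ r.exps) : qmap r (egen r (.θ 0) * egen r (.θ i)) = 0 := by
  rw [qmap_mul, ← q_tξ hi, ← qmap_mul, ← mul_assoc, ← t_mul_θ hi (show (0 : ℤ) ∈ r.exps from r.natCast_mem 0), mul_assoc,
    qmap_mul, q_ξξ, smul_zero]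

theorem q_θξ {i : ℤ} (hi : i ∈ r.exps) : qmap r (egen r (.θ i) * egen r (.θ 0)) = 0 := by
  rw [θ_mul_θ hi (show (0 : ℤ) ∈ r.exps from r.natCast_mem 0), map_neg, q_ξθ hi, neg_zero]

theorem q_gen_mul {x : UEA (kPlus r)} (hx : idealGen r x) {b : Ix} (hb : b ∈ r.ix) :
    qmap r (x * egen r b) = 0 := by
  have h0 : (0 : ℤ) ∈ r.exps := r.natCast_mem 0
  have hqx := qmap_gen hx
  -- it is enough that `x` commutes or anticommutes with the basis element modulo the ideal
  have plus : ∀ y, x * egen r b = egen r b * x + y → qmap r y = 0 → qmap r (x * egen r b) = 0 := by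
    intro y h hy
    rw [h, map_add, qmap_mul, hqx, smul_zero, hy, add_zero]
  have minus : ∀ y, x * egen r b = -(egen r b * x) + y → qmap r y = 0 →
      qmap r (x * egen r b) = 0 := by
    intro y h hy
    rw [h, map_add, map_neg, qmap_mul, hqx, smul_zero, hy, neg_zero, add_zero]
  have q0 : ∀ {c : ℂ} {u v : UEA (kPlus r)}, (c ≠ 0 → qmap r u = qmap r v) →
      qmap r (c • u) = qmap r (c • v) := by
    intro c u v h
    by_cases hc : c = 0
    · simp [hc]
    · rw [qmap_csmul, qmap_csmul, h hc]
  have sL : ∀ {m k : ℤ}, -1 ≤ m → k ∈ r.exps → (k : ℂ) ≠ 0 → m + k ∈ r.exps :=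
    fun hm hk h => (r.shift hm hk).resolve_left h
  have sG : ∀ {m k : ℤ}, 0 ≤ m → k ∈ r.exps → (k : ℂ) ≠ 0 → m + k - 1 ∈ r.exps := by
    intro m k hm hk h
    have := (r.shift (m := m - 1) (by omega) hk).resolve_left h
    rwa [sub_add_eq_add_sub] at this
  have sN : ∀ {m k : ℤ}, 0 ≤ m → k ∈ r.exps → m + k ∈ r.exps := by
    intro m k hm hk
    obtain ⟨n, rfl⟩ := Int.eq_ofNat_of_zero_le hm
    exact r.add_mem (r.natCast_mem n) hk
  have sM : ∀ {m : ℤ}, -1 ≤ m → ((m : ℂ) + 1) / 2 ≠ 0 → m ∈ r.exps := by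
    intro m hm h
    have : 0 ≤ m := by
      by_contra hlt
      have : m = -1 := by omega
      subst this
      exact h (by norm_num)
    simpa using sN this h0
  cases hx with
  | mul i j hi hj =>
    have hij := r.add_mem hi hj
    rw [← egen_eq (b := .t i) hi, ← egen_eq (b := .t j) hj, ← egen_eq (b := .t (i + j)) hij] at *
    cases b with
    | L m =>
      refine plus (y := -((i : ℂ) • (egen r (.t (m + i)) * egen r (.t j))
        + (j : ℂ) • (egen r (.t i) * egen r (.t (m + j)))
        - ((i : ℂ) + j) • egen r (.t (m + (i + j))))) ?_ ?_
      · rw [sub_mul, mul_assoc, t_mul_L hj hb, mul_sub, ← mul_assoc, t_mul_L hi hb,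
          t_mul_L hij hb]
        push_cast
        simp only [sub_mul, mul_sub, mul_assoc, smul_mul_assoc, mul_smul_comm]
        abel
      · rw [map_neg, map_sub, map_add,
          q0 (u := egen r (.t (m + i)) * egen r (.t (j))) (v := egen r (.t (m + (i + j)))) (fun h => by
            rw [q_tt (sL hb hi h) hj, add_assoc]),
          q0 (u := egen r (.t (i)) * egen r (.t (m + j))) (v := egen r (.t (m + (i + j)))) (fun h => by
            rw [q_tt hi (sL hb hj h), add_left_comm]), add_smul, map_add, sub_self, neg_zero]
    | G m =>
      refine plus (y := -((i : ℂ) • (egen r (.θ (m + i - 1)) * egen r (.t j))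
        + (j : ℂ) • (egen r (.t i) * egen r (.θ (m + j - 1)))
        - ((i : ℂ) + j) • egen r (.θ (m + (i + j) - 1)))) ?_ ?_
      · rw [sub_mul, mul_assoc, t_mul_G hj hb, mul_sub, ← mul_assoc, t_mul_G hi hb,
          t_mul_G hij hb]
        push_cast
        simp only [sub_mul, mul_sub, mul_assoc, smul_mul_assoc, mul_smul_comm]
        abel
      · rw [map_neg, map_sub, map_add,
          q0 (u := egen r (.θ (m + i - 1)) * egen r (.t (j))) (v := egen r (.θ (m + (i + j) - 1))) (fun h => by
            rw [q_θt (sG hb hi h) hj]; congr 3; ring),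
          q0 (u := egen r (.t (i)) * egen r (.θ (m + j - 1))) (v := egen r (.θ (m + (i + j) - 1))) (fun h => by
            rw [q_tθ hi (sG hb hj h)]; congr 3; ring), add_smul, map_add, sub_self, neg_zero]
    | t k =>
      refine plus 0 ?_ (map_zero _)
      rw [sub_mul, mul_assoc, t_mul_t hj hb, ← mul_assoc, t_mul_t hi hb, t_mul_t hij hb, mul_sub,
        mul_assoc, add_zero]
    | θ k =>
      refine plus 0 ?_ (map_zero _)
      rw [sub_mul, mul_assoc, t_mul_θ hj hb, ← mul_assoc, t_mul_θ hi hb, t_mul_θ hij hb, mul_sub,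
        mul_assoc, add_zero]
  | one =>
    rw [← egen_eq (b := .t 0) h0] at *
    refine plus 0 ?_ (map_zero _)
    rw [sub_mul, mul_sub, add_zero, one_mul, mul_one]
    congr 1
    cases b with
    | L m => rw [t_mul_L h0 hb, Int.cast_zero, zero_smul, sub_zero]
    | G m => rw [t_mul_G h0 hb, Int.cast_zero, zero_smul, sub_zero]
    | t k => exact t_mul_t h0 hb
    | θ k => exact t_mul_θ h0 hb
  | mul_xi i hi =>
    rw [← egen_eq (b := .t i) hi, ← egen_eq (b := .θ i) hi, ← egen_eq (b := .θ 0) h0] at *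
    cases b with
    | L m =>
      refine plus (y := -((i : ℂ) • (egen r (.t (m + i)) * egen r (.θ 0))
        + (((m : ℂ) + 1) / 2) • (egen r (.t i) * egen r (.θ m))
        - ((i : ℂ) + (m + 1) / 2) • egen r (.θ (m + i)))) ?_ ?_
      · rw [sub_mul, mul_assoc, θ_mul_L h0 hb, mul_sub, ← mul_assoc, t_mul_L hi hb,
          θ_mul_L hi hb, Int.cast_zero, zero_add, add_zero]
        simp only [sub_mul, mul_sub, mul_assoc, smul_mul_assoc, mul_smul_comm]
        abel
      · rw [map_neg, map_sub, map_add,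
          q0 (u := egen r (.t (m + i)) * egen r (.θ (0))) (v := egen r (.θ (m + i))) (fun h => by rw [q_tξ (sL hb hi h)]),
          q0 (u := egen r (.t (i)) * egen r (.θ (m))) (v := egen r (.θ (m + i))) (fun h => by rw [q_tθ hi (sM hb h), add_comm]),
          add_smul, map_add, sub_self, neg_zero]
    | G m =>
      refine minus (y := (i : ℂ) • (egen r (.θ (m + i - 1)) * egen r (.θ 0))
        - (egen r (.t i) * egen r (.t m) - egen r (.t (m + i)))) ?_ ?_
      · rw [sub_mul, mul_assoc, θ_mul_G h0 hb, mul_sub, mul_neg, ← mul_assoc, t_mul_G hi hb,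
          θ_mul_G hi hb, add_zero]
        simp only [sub_mul, mul_sub, mul_assoc, smul_mul_assoc]
        abel
      · rw [map_sub, q0 (v := 0) (fun h => by rw [q_θξ (sG hb hi h), map_zero]), smul_zero,
          map_zero, map_sub, q_tt hi (by simpa using sN hb h0), add_comm i m, sub_self, sub_zero]
    | t k =>
      refine plus 0 ?_ (map_zero _)
      rw [sub_mul, mul_assoc, ← t_mul_θ hb h0, ← mul_assoc, t_mul_t hi hb, ← t_mul_θ hb hi, mul_sub,
        mul_assoc, add_zero]
    | θ k =>
      refine minus 0 ?_ (map_zero _)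
      rw [sub_mul, mul_assoc, θ_mul_θ h0 hb, mul_neg, ← mul_assoc, t_mul_θ hi hb, θ_mul_θ hi hb,
        mul_sub, mul_assoc, add_zero]
      abel
  | xi_xi =>
    rw [← egen_eq (b := .θ 0) h0] at *
    cases b with
    | L m =>
      refine plus (y := -((((m : ℂ) + 1) / 2) • (egen r (.θ m) * egen r (.θ 0))
        + (((m : ℂ) + 1) / 2) • (egen r (.θ 0) * egen r (.θ m)))) ?_ ?_
      · rw [mul_assoc, θ_mul_L h0 hb, mul_sub, ← mul_assoc, θ_mul_L h0 hb, Int.cast_zero, zero_add,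
          add_zero]
        simp only [sub_mul, mul_assoc, smul_mul_assoc, mul_smul_comm]
        abel
      · rw [map_neg, map_add, q0 (u := egen r (.θ (m)) * egen r (.θ (0))) (v := 0) (fun h => by rw [q_θξ (sM hb h), map_zero]),
          q0 (u := egen r (.θ (0)) * egen r (.θ (m))) (v := 0) (fun h => by rw [q_ξθ (sM hb h), map_zero]), smul_zero, map_zero, add_zero,
          neg_zero]
    | G m =>
      refine plus 0 ?_ (map_zero _)
      rw [mul_assoc, θ_mul_G h0 hb, add_zero, mul_sub, mul_neg, ← mul_assoc, θ_mul_G h0 hb,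
        add_zero, ← t_mul_θ (by simpa using sN hb h0) h0]
      simp only [sub_mul, neg_mul, mul_assoc]
      abel
    | t k =>
      refine plus 0 ?_ (map_zero _)
      rw [mul_assoc, ← t_mul_θ hb h0, ← mul_assoc, ← t_mul_θ hb h0, mul_assoc, add_zero]
    | θ k =>
      refine plus 0 ?_ (map_zero _)
      rw [mul_assoc, θ_mul_θ h0 hb, mul_neg, ← mul_assoc, θ_mul_θ h0 hb, neg_mul, neg_neg,
        mul_assoc, add_zero]

theorem mul_mem_leftIdeal {x : UEA (kPlus r)} (hx : x ∈ leftIdeal r) (y : UEA (kPlus r)) :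
    x * y ∈ leftIdeal r := by
  let S : Subalgebra ℂ (UEA (kPlus r)) :=
    { carrier := {y | ∀ x ∈ leftIdeal r, x * y ∈ leftIdeal r}
      mul_mem' := fun {a b} ha hb x hx => by
        rw [← mul_assoc]; exact hb _ (ha _ hx)
      add_mem' := fun {a b} ha hb x hx => by
        rw [mul_add]; exact add_mem (ha _ hx) (hb _ hx)
      algebraMap_mem' := fun c x hx => by
        rw [← Algebra.commutes]; exact Ideal.mul_mem_left _ _ hx }
  have hS : ∀ z : kPlus r, UEA.ι (kPlus r) z ∈ S := by
    intro z
    have : ∀ w (hw : w ∈ Finsupp.supported ℂ ℂ r.ix),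
        UEA.ι (kPlus r) (kPlusOf r ⟨w, hw⟩) ∈ S := by
      intro w hw
      have hsum : (⟨w, hw⟩ : Finsupp.supported ℂ ℂ r.ix) = ∑ b ∈ w.support.attach,
          w b • ⟨Finsupp.single b.1 1, Ix.single_mem (hw b.2) 1⟩ := by
        apply Subtype.ext
        rw [Submodule.coe_sum]
        simp only [Submodule.coe_smul, Finsupp.smul_single, smul_eq_mul, mul_one]
        rw [Finset.sum_attach w.support (fun b => Finsupp.single b (w b))]
        exact (Finsupp.sum_single w).symm
      rw [hsum, map_sum, map_sum]
      refine sum_mem fun b _ => ?_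
      rw [map_smul, map_smul]
      refine S.smul_mem ?_ _
      intro x hx
      show x * ugen r b.1 (hw b.2) ∈ leftIdeal r
      rw [← egen_eq (hw b.2)]
      induction hx using Submodule.span_induction with
      | mem x hx => exact (Submodule.Quotient.mk_eq_zero _).1 (q_gen_mul hx (hw b.2))
      | zero => rw [zero_mul]; exact zero_mem _
      | add x y _ _ hx hy => rw [add_mul]; exact add_mem hx hy
      | smul a x _ hx => rw [smul_eq_mul, mul_assoc]; exact Ideal.mul_mem_left _ _ hx
    exact this z.1 z.2
  have htop : S = ⊤ := by
    rw [eq_top_iff, ← UEA.adjoin_ι, Algebra.adjoin_le_iff]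
    rintro _ ⟨z, rfl⟩
    exact hS z
  have hy : y ∈ S := by rw [htop]; trivial
  exact hy x hx

instance : (leftIdeal r).IsTwoSided := ⟨fun y hx => mul_mem_leftIdeal hx y⟩

end TwoSided

/-! ### The algebras `Ū⁺` and `Ū⁺⁺` -/

/-- `Ū⁺ = U(𝔨⁺ ⋉ A) / I⁺` (for `laurent`), respectively `Ū⁺⁺ = U(𝔨⁺ ⋉ A⁺) / I⁺⁺` (for `poly`). -/
def Ubar (r : Fun) : Type := UEA (kPlus r) ⧸ leftIdeal r

namespace Ubar

instance (r : Fun) : Ring (Ubar r) := inferInstanceAs (Ring (UEA (kPlus r) ⧸ leftIdeal r))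

instance (r : Fun) : Algebra ℂ (Ubar r) :=
  inferInstanceAs (Algebra ℂ (UEA (kPlus r) ⧸ leftIdeal r))

/-- The quotient map. -/
def mk (r : Fun) : UEA (kPlus r) →ₐ[ℂ] Ubar r := Ideal.Quotient.mkₐ ℂ (leftIdeal r)

theorem mk_eq_zero {r : Fun} {x : UEA (kPlus r)} : mk r x = 0 ↔ x ∈ leftIdeal r :=
  Ideal.Quotient.eq_zero_iff_mem

theorem mk_surjective (r : Fun) : Function.Surjective (mk r) :=
  Ideal.Quotient.mkₐ_surjective ℂ (leftIdeal r)

theorem sigma_ugen (r : Fun) (b : Ix) (hb : b ∈ r.ix) :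
    UEA.sigma (kPlus r) (ugen r b hb) = ((-1 : ℤˣ) ^ b.par) • ugen r b hb := by
  rw [ugen, UEA.sigma_ι, (kPlus r).sigma_of_mem (kPlusOf_single_mem hb), Units.smul_def,
    Units.smul_def, map_zsmul]

theorem sigma_mem_leftIdeal (r : Fun) {x : UEA (kPlus r)} (hx : x ∈ leftIdeal r) :
    UEA.sigma (kPlus r) x ∈ leftIdeal r := by
  induction hx using Submodule.span_induction with
  | mem x hx =>
    have hm : x ∈ leftIdeal r := Ideal.subset_span hx
    cases hx with
    | mul i j hi hj =>
      simp only [map_sub, map_mul, sigma_ugen, Ix.par, uzpow_zero, one_smul]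
      exact hm
    | one =>
      simp only [map_sub, map_one, sigma_ugen, Ix.par, uzpow_zero, one_smul]
      exact hm
    | mul_xi i hi =>
      simp only [map_sub, map_mul, sigma_ugen, Ix.par, uzpow_zero, uzpow_one, one_smul,
        Units.smul_def, Units.val_neg, Units.val_one, neg_smul, mul_neg]
      rw [← neg_sub', neg_mem_iff]
      exact hm
    | xi_xi =>
      simp only [map_mul, sigma_ugen, Ix.par, uzpow_one, one_smul,
        Units.smul_def, Units.val_neg, Units.val_one, neg_smul, mul_neg, neg_mul, neg_neg]
      exact hm
  | zero => rw [map_zero]; exact zero_mem _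
  | add x y _ _ hx hy => rw [map_add]; exact add_mem hx hy
  | smul a x _ hx => rw [smul_eq_mul, map_mul]; exact Ideal.mul_mem_left _ _ hx

/-- The automorphism `x ↦ (-1) ^ |x| x` induced from that of the enveloping algebra. -/
def sigma (r : Fun) : Ubar r →ₐ[ℂ] Ubar r :=
  Ideal.Quotient.liftₐ (leftIdeal r) ((mk r).comp (UEA.sigma (kPlus r))) fun _ hx =>
    mk_eq_zero.2 (sigma_mem_leftIdeal r hx)

theorem sigma_mk (r : Fun) (x : UEA (kPlus r)) :
    sigma r (mk r x) = mk r (UEA.sigma (kPlus r) x) := rfl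

theorem sigma_sigma (r : Fun) (x : Ubar r) : sigma r (sigma r x) = x := by
  obtain ⟨x, rfl⟩ := mk_surjective r x
  rw [sigma_mk, sigma_mk, UEA.sigma_sigma]

/-- The parity induced from that of the enveloping algebra. -/
def parity (r : Fun) (i : ZMod 2) : Submodule ℂ (Ubar r) := eigen (sigma r).toLinearMap i

instance (r : Fun) : GradedAlgebra (parity r) :=
  gradedOfInvolution (sigma r) (sigma_sigma r) _ fun _ _ => Iff.rfl

variable (r : Fun)

/-- The image of a basis element of `𝔨⁺ ⋉ A`. -/
def gen (b : Ix) (hb : b ∈ r.ix) : Ubar r := mk r (ugen r b hb)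

/-- The element `t ^ k`. -/
def t (k : ℕ) : Ubar r := gen r (.t k) (r.t_mem (r.natCast_mem k))

/-- The element `t ^ k ξ`. -/
def θ (k : ℕ) : Ubar r := gen r (.θ k) (r.θ_mem (r.natCast_mem k))

/-- `L i` is the element `L_{i-1}`. -/
def L (i : ℕ) : Ubar r := gen r (.L ((i : ℤ) - 1)) (r.L_mem (by omega))

/-- `G i` is the element `G_{i-1/2}`. -/
def G (i : ℕ) : Ubar r := gen r (.G i) (r.G_mem (Int.natCast_nonneg i))

/-- The element `t⁻¹` of `Ū⁺`. -/
def tinv : Ubar .laurent := gen .laurent (.t (-1)) (Fun.laurent.t_mem trivial)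

/-- The element `L'_n`. -/
def Lprime (n : ℕ) : Ubar r :=
  ∑ i ∈ Finset.range (n + 2), ((-1) ^ (i + 1) * ((n + 1).choose i : ℂ)) • (t r (n + 1 - i) * L r i)
    + (((n : ℂ) + 1) / 2) • ∑ i ∈ Finset.range (n + 1),
      ((-1) ^ i * (n.choose i : ℂ)) • (θ r (n - i) * G r i)

/-- `Gprime n` is the element `G'_{n-1/2}`. -/
def Gprime (n : ℕ) : Ubar r :=
  ∑ i ∈ Finset.range (n + 1), ((-1) ^ i * (n.choose i : ℂ)) •
    (t r (n - i) * G r i - (2 : ℂ) • (θ r (n - i) * L r i))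

/-- The elements `L'_n`, `n ≥ 0`, and `G'_{m-1/2}`, `m ≥ 1`. -/
def primed : ℕ ⊕ ℕ → Ubar r
  | .inl n => Lprime r n
  | .inr m => Gprime r (m + 1)

/-- The space `𝒯` spanned by these elements. -/
def T : Submodule ℂ (Ubar r) := Submodule.span ℂ (Set.range (primed r))

end Ubar

/-! ### The Weyl superalgebra -/

/-- The generators `t`, `t⁻¹`, `ξ`, `∂_t`, `∂_ξ`. -/
inductive WeylGen : Type
  | t
  | tinv
  | ξ
  | dt
  | dξ

namespace Weyl

/-- A generator, as an element of the free algebra. -/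
abbrev fg (g : WeylGen) : FreeAlgebra ℂ WeylGen := FreeAlgebra.ι ℂ g

open WeylGen in
/-- The defining relations of the Weyl superalgebra: `∂_t` and `∂_ξ` are the partial derivatives. -/
inductive Rel : FreeAlgebra ℂ WeylGen → FreeAlgebra ℂ WeylGen → Prop
  | t_tinv : Rel (fg t * fg tinv) 1
  | tinv_t : Rel (fg tinv * fg t) 1
  | ξ_t : Rel (fg ξ * fg t) (fg t * fg ξ)
  | ξ_ξ : Rel (fg ξ * fg ξ) 0
  | dt_t : Rel (fg dt * fg t) (fg t * fg dt + 1)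
  | dt_ξ : Rel (fg dt * fg ξ) (fg ξ * fg dt)
  | dξ_t : Rel (fg dξ * fg t) (fg t * fg dξ)
  | dξ_ξ : Rel (fg dξ * fg ξ) (-(fg ξ * fg dξ) + 1)
  | dt_dξ : Rel (fg dt * fg dξ) (fg dξ * fg dt)
  | dξ_dξ : Rel (fg dξ * fg dξ) 0

end Weyl

/-- The Weyl superalgebra `𝒦 = ℂ[t, t⁻¹, ξ, ∂_t, ∂_ξ]`. -/
def Weyl : Type := RingQuot Weyl.Rel

namespace Weyl

instance : Ring Weyl := inferInstanceAs (Ring (RingQuot Rel))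

instance : Algebra ℂ Weyl := inferInstanceAs (Algebra ℂ (RingQuot Rel))

/-- The quotient map. -/
def mk : FreeAlgebra ℂ WeylGen →ₐ[ℂ] Weyl := RingQuot.mkAlgHom ℂ Rel

/-- The generators of the Weyl superalgebra. -/
def gen (g : WeylGen) : Weyl := mk (fg g)

theorem mk_rel {a b : FreeAlgebra ℂ WeylGen} (h : Rel a b) : mk a = mk b :=
  RingQuot.mkAlgHom_rel ℂ h

theorem hom_ext {B : Type*} [Ring B] [Algebra ℂ B] {f g : Weyl →ₐ[ℂ] B}
    (h : ∀ x, f (gen x) = g (gen x)) : f = g :=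
  RingQuot.ringQuot_ext' (A := FreeAlgebra ℂ WeylGen) (S := ℂ) (s := Rel) f g
    (FreeAlgebra.hom_ext (funext h))

/-- `ξ` and `∂_ξ` are odd, the other generators are even. -/
def genPar : WeylGen → ZMod 2
  | .t => 0
  | .tinv => 0
  | .ξ => 1
  | .dt => 0
  | .dξ => 1

/-- The parity automorphism on the free algebra, composed with the quotient map. -/
def sigmaAux : FreeAlgebra ℂ WeylGen →ₐ[ℂ] Weyl :=
  FreeAlgebra.lift ℂ fun g => ((-1 : ℤˣ) ^ genPar g) • gen g

theorem sigmaAux_fg (g : WeylGen) : sigmaAux (fg g) = ((-1 : ℤˣ) ^ genPar g) • mk (fg g) :=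
  FreeAlgebra.lift_ι_apply _ _

theorem sigmaAux_rel {a b : FreeAlgebra ℂ WeylGen} (h : Rel a b) : sigmaAux a = sigmaAux b := by
  have h' := mk_rel h
  cases h <;>
    simp only [map_mul, map_one, map_add, map_neg, map_zero] at h' <;>
    simp only [map_mul, map_one, map_add, map_neg, map_zero, sigmaAux_fg, genPar,
      uzpow_zero, uzpow_one, one_smul, Units.smul_def, Units.val_neg, Units.val_one, neg_smul,
      mul_neg, neg_mul, neg_neg, h']

/-- The automorphism `x ↦ (-1) ^ |x| x`. -/
def sigma : Weyl →ₐ[ℂ] Weyl := RingQuot.liftAlgHom ℂ ⟨sigmaAux, fun _ _ => sigmaAux_rel⟩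

theorem sigma_gen (g : WeylGen) : sigma (gen g) = ((-1 : ℤˣ) ^ genPar g) • gen g :=
  (RingQuot.liftAlgHom_mkAlgHom_apply ℂ sigmaAux (fun _ _ => sigmaAux_rel) (fg g)).trans
    (sigmaAux_fg g)

theorem sigma_sigma (x : Weyl) : sigma (sigma x) = x := by
  have : sigma.comp sigma = AlgHom.id ℂ _ := hom_ext fun g => by
    rw [AlgHom.comp_apply, sigma_gen, Units.smul_def, map_zsmul, sigma_gen, ← Units.smul_def,
      smul_smul, Int.units_mul_self, one_smul, AlgHom.id_apply]
  exact DFunLike.congr_fun this x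

/-- The parity of the Weyl superalgebra. -/
def parity (i : ZMod 2) : Submodule ℂ Weyl := eigen sigma.toLinearMap i

instance : GradedAlgebra parity :=
  gradedOfInvolution sigma sigma_sigma _ fun _ _ => Iff.rfl

/-- The subalgebra `𝒦⁺ = A⁺[∂_t, ∂_ξ]` generated by `t`, `ξ`, `∂_t` and `∂_ξ`. -/
def plus : Subalgebra ℂ Weyl := Algebra.adjoin ℂ {gen .t, gen .ξ, gen .dt, gen .dξ}

theorem sigma_mem_plus {x : Weyl} (hx : x ∈ plus) : sigma x ∈ plus := by
  have : plus ≤ plus.comap sigma := by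
    refine Algebra.adjoin_le fun y hy => ?_
    have hy' : y ∈ plus := Algebra.subset_adjoin hy
    have : ∃ g, y = gen g := by
      rcases hy with rfl | rfl | rfl | rfl <;> exact ⟨_, rfl⟩
    obtain ⟨g, rfl⟩ := this
    show sigma (gen g) ∈ plus
    rw [sigma_gen, Units.smul_def]
    exact zsmul_mem hy' _
  exact this hx

/-- The parity of `𝒦⁺`. -/
def plusParity (i : ZMod 2) : Submodule ℂ plus := (parity i).comap plus.val.toLinearMap

instance : GradedAlgebra plusParity :=
  gradedOfInvolution ((sigma.comp plus.val).codRestrict plus fun x => sigma_mem_plus x.2)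
    (fun x => Subtype.ext (sigma_sigma x)) _ fun _ _ => by
      rw [Subtype.ext_iff]; exact Iff.rfl

end Weyl

/-- The superalgebra `Ū⁺`, as a Lie superalgebra under the supercommutator. -/
def UbarLie : LieSuperalgebra := LieSuperalgebra.ofAssociative (Ubar.parity .laurent)

end ContactSuper

end

open ContactSuper

/-!
Write `ℂ[t]`-linear combinations of the `L_{i-1}` and the `G_{i-1/2}` as polynomials in a second
variable: for `F = ∑ aᵢ(t) xⁱ` put `P F = ∑ aᵢ(t) L_{i-1}` and `Q F = ∑ aᵢ(t) G_{i-1/2}`.  Here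
`P F` behaves like a vector field in a moving frame: its bracket with a function of `t` is governed
by the value of `F` at `x = t`, and its bracket with `P H` is the bracket of the fields `F ∂ₓ` and
`H ∂ₓ`, corrected by the derivatives of the coefficients `aᵢ(t)`.  These relations (`ContactFields`)
follow from their instances at the powers `xⁱ`, or at any other set of `ℂ[t]`-generators
(`ActsOnFunctions.P_P_of_generators` and its companions).

The generators `(x - t)ᵏ` are adapted to the problem: for `k ≥ 1` they vanish at `x = t`, so that
the fields `P ((x - t)ᵏ)` and `Q ((x - t)ᵏ)` almost commute with functions, and the translation
`L_{-1} = P 1` does not see `x - t` at all.  What remains is a correction by multiples of `ξ`: the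
elements `ℓ k` and `g k` of `CentredRelations.splitRelations`, which for `k ≥ 1` are
`(-1)ⁿ L'_n` with `n = k - 1` and `(-1)ᵏ G'_{k-1/2}`, supercommute with `t`, `ξ`, `∂_t = L_{-1}` and
`∂_ξ = ξ L_{-1} - G_{-1/2}`, and satisfy the relations of `𝔨_{≥ 0}` among each other; the elements
with `k = 0` encode `∂_t` and `∂_ξ`.

All these changes of generators are invertible over any algebra.  Hence the relations of `Ū⁺` and
those of `𝒦 ⊗ U(𝔨_{≥ 0})` are equivalent, and the universal properties yield homomorphisms in both
directions, which are mutually inverse (`Ubar.splitEquiv`).  The adjoint action of `𝔨_{≥ 0}` on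
the function `t` shows that `𝔨_{≥ 0}` embeds in `U(𝔨_{≥ 0})` (`ι_kGeZero_injective`), hence in `Ū⁺`,
with image `𝒯` (`Ubar.ofLie_range`).  This makes `𝒯` a Lie superalgebra isomorphic to `𝔨_{≥ 0}`, and
the primed elements a basis of it.

The algebra `Ū⁺⁺` is spanned by the products of the monomials in `t, ∂_t, ξ, ∂_ξ` with elements of
`U(𝔨_{≥ 0})` (`Ubar.monomialSpan_eq_top`).  The monomials are linearly independent in `𝒦`, so that
these products are sent injectively to `𝒦 ⊗ U(𝔨_{≥ 0}) ≅ Ū⁺`; thus `Ū⁺⁺ → Ū⁺` is injective.  Its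
image is generated by `𝒦⁺` and `𝒯`, hence is the image of `𝒦⁺ ⊗ U(𝒯)`.
-/

noncomputable section

namespace ContactSuper

open Polynomial

variable {B : Type*} [Ring B] [Algebra ℂ B]

/-! ### Vector fields with polynomial coefficients -/

/-- The derivative with respect to the variable of the coefficients. -/
def dCoeff : Derivation ℂ ℂ[X][X] ℂ[X][X] :=
  (PolynomialModule.equivPolynomialSelf (R := ℂ[X])).toLinearMap.compDer
    (Polynomial.derivative' (R := ℂ)).mapCoeffs

theorem dCoeff_C (a : ℂ[X]) : dCoeff (C a) = C (derivative a) := by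
  simp [dCoeff]

theorem dCoeff_X : dCoeff X = 0 := by
  simp [dCoeff]

theorem dCoeff_C_mul (a : ℂ[X]) (F : ℂ[X][X]) :
    dCoeff (C a * F) = C (derivative a) * F + C a * dCoeff F := by
  rw [Derivation.leibniz, dCoeff_C, smul_eq_mul, smul_eq_mul]
  ring

/-- The sum `∑ aᵢ(t) eᵢ` attached to a polynomial `∑ aᵢ xⁱ` with coefficients in `ℂ[X]`. -/
def polySum (t : B) (e : ℕ → B) : ℂ[X][X] →ₗ[ℂ] B :=
  Polynomial.lsum fun i => LinearMap.mulRight ℂ (e i) ∘ₗ (aeval t).toLinearMap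

theorem polySum_C_mul_X_pow (t : B) (e : ℕ → B) (a : ℂ[X]) (i : ℕ) :
    polySum t e (C a * X ^ i) = aeval t a * e i := by
  simp [polySum, C_mul_X_pow_eq_monomial, sum_monomial_index]

theorem polySum_C_mul (t : B) (e : ℕ → B) (a : ℂ[X]) (F : ℂ[X][X]) :
    polySum t e (C a * F) = aeval t a * polySum t e F := by
  induction F using Polynomial.induction_on' with
  | add p q hp hq => rw [mul_add, map_add, hp, hq, map_add, mul_add]
  | monomial n b =>
    rw [← C_mul_X_pow_eq_monomial, ← mul_assoc, ← C_mul, polySum_C_mul_X_pow,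
      polySum_C_mul_X_pow, map_mul, mul_assoc]

theorem polySum_X_pow (t : B) (e : ℕ → B) (i : ℕ) : polySum t e (X ^ i) = e i := by
  simpa using polySum_C_mul_X_pow t e 1 i

/-- The commutation relations of the vector fields `P F = F(t, x) ∂ₓ` and of the odd contact
fields `Q F` with the functions of `t` and `ξ`, where `F` is a polynomial in `x` with coefficients
depending on `t`.  The field `P (x ^ i)` acts on functions of `(t, ξ)` as `L_{i-1}` does, and
`Q (x ^ i)` as `G_{i-1/2}`; the value of `F` at `x = t` is `F.eval X`. -/
structure ActsOnFunctions (t ξ : B) (P Q : ℂ[X][X] →ₗ[ℂ] B) : Prop where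
  ξ_t : ξ * t = t * ξ
  ξ_ξ : ξ * ξ = 0
  P_C : ∀ a F, P (C a * F) = aeval t a * P F
  Q_C : ∀ a F, Q (C a * F) = aeval t a * Q F
  P_t : ∀ F b, P F * aeval t b = aeval t b * P F + aeval t (F.eval X * derivative b)
  P_ξ : ∀ F, P F * ξ = ξ * P F + (1 / 2 : ℂ) • (aeval t ((derivative F).eval X) * ξ)
  Q_t : ∀ F b, Q F * aeval t b = aeval t b * Q F + aeval t (F.eval X * derivative b) * ξ
  Q_ξ : ∀ F, Q F * ξ = -(ξ * Q F) - aeval t (F.eval X)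

/-- The bracket of `P F` and `P H`: besides the bracket of fields in `x`, the functions of `t` in
front of one field are differentiated by the other one. -/
def brPP (F H : ℂ[X][X]) : ℂ[X][X] :=
  F * derivative H - derivative F * H + C (F.eval X) * dCoeff H - C (H.eval X) * dCoeff F

/-- The part `Q (brPQ F H)` of the bracket of `P F` and `Q H`. -/
def brPQ (F H : ℂ[X][X]) : ℂ[X][X] :=
  F * derivative H - (1 / 2 : ℂ) • (derivative F * H) + C (F.eval X) * dCoeff H

/-- The part `ξ Q (brQQ F H)` of the bracket of `Q F` and `Q H`. -/
def brQQ (F H : ℂ[X][X]) : ℂ[X][X] :=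
  C (F.eval X) * dCoeff H + C (H.eval X) * dCoeff F

/-- The commutation relations of the fields `P F` and `Q F` with functions and with each other. -/
structure ContactFields (t ξ : B) (P Q : ℂ[X][X] →ₗ[ℂ] B) : Prop
    extends ActsOnFunctions t ξ P Q where
  P_P : ∀ F H, P F * P H = P H * P F + P (brPP F H)
  P_Q : ∀ F H, P F * Q H = Q H * P F + Q (brPQ F H) - ξ * P (C (H.eval X) * dCoeff F)
  Q_Q : ∀ F H, Q F * Q H = -(Q H * Q F) - (2 : ℂ) • P (F * H) + ξ * Q (brQQ F H)

theorem ξ_mul_aeval {t ξ : B} (h : ξ * t = t * ξ) (a : ℂ[X]) :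
    ξ * aeval t a = aeval t a * ξ := by
  have : Commute ξ (aeval t a) := by
    have h' : Commute ξ t := h
    induction a using Polynomial.induction_on' with
    | add p q hp hq => rw [map_add]; exact hp.add_right hq
    | monomial n c =>
      rw [aeval_monomial]
      exact (Algebra.commute_algebraMap_right c ξ).mul_right (h'.pow_right n)
  exact this

/-- Induction on a polynomial in `x` over `ℂ[t]`, expanded in a set of `ℂ[t]`-generators. -/
theorem span_induction_C {e : ℕ → ℂ[X][X]} (he : Submodule.span ℂ[X] (Set.range e) = ⊤)
    {p : ℂ[X][X] → Prop} (h : ∀ i, p (e i)) (hadd : ∀ F H, p F → p H → p (F + H))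
    (hC : ∀ a F, p F → p (C a * F)) (F : ℂ[X][X]) : p F := by
  have hF : F ∈ Submodule.span ℂ[X] (Set.range e) := by rw [he]; trivial
  induction hF using Submodule.span_induction with
  | mem x hx => obtain ⟨i, rfl⟩ := hx; exact h i
  | zero => simpa using hC 0 _ (h 0)
  | add x y _ _ hx hy => exact hadd _ _ hx hy
  | smul a x _ hx => rw [smul_eq_C_mul]; exact hC a x hx

/-- The relations have only to be checked on generators over `ℂ[t]`, and on the function `t`. -/
theorem ActsOnFunctions.of_generators {t ξ : B} {P Q : ℂ[X][X] →ₗ[ℂ] B} {e : ℕ → ℂ[X][X]}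
    (he : Submodule.span ℂ[X] (Set.range e) = ⊤)
    (ξ_t : ξ * t = t * ξ) (ξ_ξ : ξ * ξ = 0)
    (P_C : ∀ a F, P (C a * F) = aeval t a * P F) (Q_C : ∀ a F, Q (C a * F) = aeval t a * Q F)
    (P_t : ∀ i, P (e i) * t = t * P (e i) + aeval t ((e i).eval X))
    (P_ξ : ∀ i, P (e i) * ξ =
      ξ * P (e i) + (1 / 2 : ℂ) • (aeval t ((derivative (e i)).eval X) * ξ))
    (Q_t : ∀ i, Q (e i) * t = t * Q (e i) + aeval t ((e i).eval X) * ξ)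
    (Q_ξ : ∀ i, Q (e i) * ξ = -(ξ * Q (e i)) - aeval t ((e i).eval X)) :
    ActsOnFunctions t ξ P Q := by
  have hξ := ξ_mul_aeval ξ_t
  have P_t' : ∀ F b, P F * aeval t b = aeval t b * P F + aeval t (F.eval X * derivative b) := by
    intro F b
    induction F using span_induction_C he with
    | h i =>
      induction b using Polynomial.induction_on with
      | C z => simp [Algebra.commutes]
      | add p q hp hq => simp only [map_add, mul_add, hp, hq, add_mul]; abel
      | monomial n z h =>
        rw [pow_succ, ← mul_assoc]
        generalize C z * X ^ n = b at h ⊢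
        rw [map_mul, ← mul_assoc, h, aeval_X, add_mul, mul_assoc, P_t, derivative_mul,
          derivative_X, mul_one, mul_add (eval X (e i)), ← mul_assoc (eval X (e i)), map_add,
          map_mul _ _ X, aeval_X, mul_comm (eval X (e i)) b, map_mul _ b, mul_add, mul_assoc]
        abel
    | hadd F H hF hH => simp only [map_add, add_mul, hF, hH, mul_add, eval_add]; abel
    | hC a F hF =>
      rw [P_C, mul_assoc, hF, mul_add, ← mul_assoc, ← map_mul, ← map_mul, eval_mul, eval_C,
        mul_comm a b, map_mul _ b a, mul_assoc, mul_assoc a]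
  have Q_t' : ∀ F b,
      Q F * aeval t b = aeval t b * Q F + aeval t (F.eval X * derivative b) * ξ := by
    intro F b
    induction F using span_induction_C he with
    | h i =>
      induction b using Polynomial.induction_on with
      | C z => simp [Algebra.commutes]
      | add p q hp hq => simp only [map_add, mul_add, hp, hq, add_mul]; abel
      | monomial n z h =>
        rw [pow_succ, ← mul_assoc]
        generalize C z * X ^ n = b at h ⊢
        rw [map_mul, ← mul_assoc, h, aeval_X, add_mul, mul_assoc, Q_t, derivative_mul,
          derivative_X, mul_one, mul_add (eval X (e i)), ← mul_assoc (eval X (e i)), map_add,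
          map_mul _ _ X, aeval_X, mul_comm (eval X (e i)) b, map_mul _ b, mul_add,
          mul_assoc _ ξ, ξ_t, add_mul]
        simp only [mul_assoc]
        abel
    | hadd F H hF hH => simp only [map_add, add_mul, hF, hH, mul_add, eval_add]; abel
    | hC a F hF =>
      rw [Q_C, mul_assoc, hF, mul_add, ← mul_assoc, ← mul_assoc, ← map_mul, ← map_mul, eval_mul,
        eval_C, mul_comm a b, map_mul _ b a, mul_assoc, mul_assoc a]
  have P_ξ' : ∀ F, P F * ξ = ξ * P F + (1 / 2 : ℂ) • (aeval t ((derivative F).eval X) * ξ) := by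
    intro F
    induction F using span_induction_C he with
    | h i => exact P_ξ i
    | hadd F H hF hH => simp only [map_add, add_mul, hF, hH, mul_add, eval_add, smul_add]; abel
    | hC a F hF =>
      rw [P_C, mul_assoc, hF, mul_add, ← mul_assoc, ← mul_assoc, hξ, derivative_C_mul, eval_mul,
        eval_C, map_mul, mul_smul_comm, mul_assoc _ _ ξ]
  have Q_ξ' : ∀ F, Q F * ξ = -(ξ * Q F) - aeval t (F.eval X) := by
    intro F
    induction F using span_induction_C he with
    | h i => exact Q_ξ i
    | hadd F H hF hH => simp only [map_add, add_mul, hF, hH, mul_add, eval_add]; abel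
    | hC a F hF =>
      rw [Q_C, mul_assoc, hF, mul_sub, mul_neg, ← mul_assoc, ← mul_assoc, hξ, eval_mul, eval_C,
        map_mul]
  exact ⟨ξ_t, ξ_ξ, P_C, Q_C, P_t', P_ξ', Q_t', Q_ξ'⟩

theorem brPP_C_mul (F H : ℂ[X][X]) (a : ℂ[X]) :
    brPP F (C a * H) = C a * brPP F H + C (F.eval X * derivative a) * H := by
  rw [brPP, brPP, dCoeff_C_mul, derivative_C_mul, eval_mul, eval_C, C_mul, C_mul]; ring

theorem brPP_swap (F H : ℂ[X][X]) : brPP H F = -brPP F H := by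
  rw [brPP, brPP]; ring

theorem brPP_add (F H H' : ℂ[X][X]) : brPP F (H + H') = brPP F H + brPP F H' := by
  simp only [brPP, map_add, eval_add]; ring

theorem brPQ_C_mul (F H : ℂ[X][X]) (a : ℂ[X]) :
    brPQ F (C a * H) = C a * brPQ F H + C (F.eval X * derivative a) * H := by
  rw [brPQ, brPQ, dCoeff_C_mul, derivative_C_mul, C_mul, mul_left_comm (derivative F) (C a),
    ← mul_smul_comm]
  ring

theorem brPQ_C_mul_left (F H : ℂ[X][X]) (a : ℂ[X]) : brPQ (C a * F) H = C a * brPQ F H := by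
  rw [brPQ, brPQ, derivative_C_mul, eval_mul, eval_C, C_mul, mul_assoc (C a) (derivative F),
    ← mul_smul_comm]
  ring

theorem brPQ_add (F H H' : ℂ[X][X]) : brPQ F (H + H') = brPQ F H + brPQ F H' := by
  simp only [brPQ, map_add, mul_add, smul_add]; abel

theorem brPQ_add_left (F F' H : ℂ[X][X]) : brPQ (F + F') H = brPQ F H + brPQ F' H := by
  simp only [brPQ, map_add, add_mul, smul_add, eval_add]; abel

theorem brQQ_C_mul (F H : ℂ[X][X]) (a : ℂ[X]) :
    brQQ F (C a * H) = C a * brQQ F H + C (F.eval X * derivative a) * H := by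
  rw [brQQ, brQQ, dCoeff_C_mul, eval_mul, eval_C, C_mul, C_mul]; ring

theorem brQQ_swap (F H : ℂ[X][X]) : brQQ H F = brQQ F H := add_comm _ _

theorem brQQ_add (F H H' : ℂ[X][X]) : brQQ F (H + H') = brQQ F H + brQQ F H' := by
  simp only [brQQ, map_add, eval_add]; ring

namespace ActsOnFunctions

variable {t ξ : B} {P Q : ℂ[X][X] →ₗ[ℂ] B} {e : ℕ → ℂ[X][X]}

/-- The bracket of `P F` and `P H` has only to be checked on generators over `ℂ[t]`, because both
sides have the same behaviour when `F` or `H` is multiplied by a function of `t`. -/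
theorem P_P_of_generators (h : ActsOnFunctions t ξ P Q)
    (he : Submodule.span ℂ[X] (Set.range e) = ⊤)
    (P_P : ∀ i j, P (e i) * P (e j) = P (e j) * P (e i) + P (brPP (e i) (e j)))
    (F H : ℂ[X][X]) : P F * P H = P H * P F + P (brPP F H) := by
  have swap : ∀ F H, P F * P H = P H * P F + P (brPP F H) →
      P H * P F = P F * P H + P (brPP H F) := by
    intro F H h
    rw [h, brPP_swap, map_neg, neg_add_cancel_right]
  have hC : ∀ F H a, P F * P H = P H * P F + P (brPP F H) →
      P F * P (C a * H) = P (C a * H) * P F + P (brPP F (C a * H)) := by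
    intro F H a hH
    rw [brPP_C_mul, map_add, h.P_C, h.P_C, h.P_C, ← mul_assoc, h.P_t, add_mul, mul_assoc, hH,
      mul_add, mul_assoc, add_assoc]
  have hadd : ∀ F H H', P F * P H = P H * P F + P (brPP F H) →
      P F * P H' = P H' * P F + P (brPP F H') →
      P F * P (H + H') = P (H + H') * P F + P (brPP F (H + H')) := by
    intro F H H' hH hH'
    rw [map_add, mul_add, hH, hH', add_mul, brPP_add, map_add, add_add_add_comm]
  refine span_induction_C he (p := fun F => P F * P H = P H * P F + P (brPP F H)) (fun i => ?_)
    (fun F G hF hG => swap _ _ (hadd _ _ _ (swap _ _ hF) (swap _ _ hG)))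
    (fun a F hF => swap _ _ (hC _ _ a (swap _ _ hF))) F
  exact span_induction_C he (P_P i) (hadd _) (fun a H => hC _ H a) H

theorem P_Q_of_generators (h : ActsOnFunctions t ξ P Q)
    (he : Submodule.span ℂ[X] (Set.range e) = ⊤)
    (P_Q : ∀ i j, P (e i) * Q (e j) = Q (e j) * P (e i) + Q (brPQ (e i) (e j)) -
      ξ * P (C ((e j).eval X) * dCoeff (e i)))
    (F H : ℂ[X][X]) :
    P F * Q H = Q H * P F + Q (brPQ F H) - ξ * P (C (H.eval X) * dCoeff F) := by
  have hξ := ξ_mul_aeval h.ξ_t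
  have e1 : ∀ u v w u' v' w' : B, u + v - w + (u' + v' - w') = u + u' + (v + v') - (w + w') := by
    intros; abel
  refine span_induction_C he
    (p := fun F => P F * Q H = Q H * P F + Q (brPQ F H) - ξ * P (C (H.eval X) * dCoeff F))
    (fun i => ?_) (fun F G hF hG => ?_) (fun a F hF => ?_) F
  · refine span_induction_C he (p := fun H => P (e i) * Q H = Q H * P (e i) +
        Q (brPQ (e i) H) - ξ * P (C (H.eval X) * dCoeff (e i))) (P_Q i)
        (fun H H' hH hH' => ?_) (fun a H hH => ?_) H
    · rw [map_add, mul_add, hH, hH', add_mul, e1, brPQ_add, map_add, eval_add, C_add, add_mul,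
        map_add, mul_add]
    · rw [brPQ_C_mul, eval_mul, eval_C, C_mul (a := a), mul_assoc (C a) (C _), map_add, h.Q_C,
        h.Q_C, h.Q_C, h.P_C a, ← mul_assoc ξ, hξ, ← mul_assoc, h.P_t, add_mul, mul_assoc, hH,
        mul_sub, mul_add, mul_assoc, mul_assoc]
      abel
  · rw [map_add, add_mul, hF, hG, mul_add, e1, brPQ_add_left, map_add, map_add, mul_add, map_add,
      mul_add]
  · have e2 : C (H.eval X) * dCoeff (C a * F) =
        C (H.eval X * derivative a) * F + C a * (C (H.eval X) * dCoeff F) := by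
      rw [dCoeff_C_mul, C_mul]; ring
    rw [brPQ_C_mul_left, e2, map_add, h.Q_C a, h.P_C, h.P_C, h.P_C a, mul_add ξ, ← mul_assoc ξ,
      ← mul_assoc ξ, hξ, hξ, ← mul_assoc (Q H), h.Q_t, add_mul, mul_assoc, hF, mul_sub, mul_add]
    simp only [mul_assoc]
    abel

theorem Q_Q_of_generators (h : ActsOnFunctions t ξ P Q)
    (he : Submodule.span ℂ[X] (Set.range e) = ⊤)
    (Q_Q : ∀ i j, Q (e i) * Q (e j) = -(Q (e j) * Q (e i)) - (2 : ℂ) • P (e i * e j) +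
      ξ * Q (brQQ (e i) (e j)))
    (F H : ℂ[X][X]) :
    Q F * Q H = -(Q H * Q F) - (2 : ℂ) • P (F * H) + ξ * Q (brQQ F H) := by
  have hξ := ξ_mul_aeval h.ξ_t
  have swap : ∀ F H, Q F * Q H = -(Q H * Q F) - (2 : ℂ) • P (F * H) + ξ * Q (brQQ F H) →
      Q H * Q F = -(Q F * Q H) - (2 : ℂ) • P (H * F) + ξ * Q (brQQ H F) := by
    intro F H h
    rw [h, mul_comm H, brQQ_swap H F]
    abel
  have hC : ∀ F H a, Q F * Q H = -(Q H * Q F) - (2 : ℂ) • P (F * H) + ξ * Q (brQQ F H) →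
      Q F * Q (C a * H) =
        -(Q (C a * H) * Q F) - (2 : ℂ) • P (F * (C a * H)) + ξ * Q (brQQ F (C a * H)) := by
    intro F H a hH
    rw [brQQ_C_mul, map_add, h.Q_C, h.Q_C a, h.Q_C, mul_add ξ, ← mul_assoc ξ, ← mul_assoc ξ, hξ,
      hξ, mul_left_comm F, h.P_C a, ← mul_smul_comm, ← mul_assoc, h.Q_t, add_mul, mul_assoc, hH,
      mul_add, mul_sub, mul_neg]
    simp only [mul_assoc]
    abel
  have hadd : ∀ F G H, Q F * Q G = -(Q G * Q F) - (2 : ℂ) • P (F * G) + ξ * Q (brQQ F G) →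
      Q F * Q H = -(Q H * Q F) - (2 : ℂ) • P (F * H) + ξ * Q (brQQ F H) →
      Q F * Q (G + H) =
        -(Q (G + H) * Q F) - (2 : ℂ) • P (F * (G + H)) + ξ * Q (brQQ F (G + H)) := by
    intro F G H hG hH
    rw [map_add, mul_add, hG, hH, brQQ_add, map_add, mul_add F, map_add, smul_add, add_mul,
      mul_add]
    abel
  refine span_induction_C he
    (p := fun F => Q F * Q H = -(Q H * Q F) - (2 : ℂ) • P (F * H) + ξ * Q (brQQ F H))
    (fun i => ?_) (fun F G hF hG => swap _ _ (hadd _ _ _ (swap _ _ hF) (swap _ _ hG)))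
    (fun a F hF => swap _ _ (hC _ _ a (swap _ _ hF))) F
  exact span_induction_C he (Q_Q i) (hadd _) (fun a H => hC _ H a) H

end ActsOnFunctions

/-! ### Three systems of generators -/

/-- The relations between `t`, `ξ`, `L i = L_{i-1}` and `G i = G_{i-1/2}` in `Ū⁺` and `Ū⁺⁺`.  Where
the subtraction in `i - 1` or `i + j - 1` is truncated, the coefficient in front vanishes. -/
structure NSRelations (t ξ : B) (L G : ℕ → B) : Prop where
  ξ_t : ξ * t = t * ξ
  ξ_ξ : ξ * ξ = 0
  L_t : ∀ i, L i * t = t * L i + t ^ i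
  L_ξ : ∀ i, L i * ξ = ξ * L i + ((i : ℂ) / 2) • (t ^ (i - 1) * ξ)
  G_t : ∀ i, G i * t = t * G i + t ^ i * ξ
  G_ξ : ∀ i, G i * ξ = -(ξ * G i) - t ^ i
  L_L : ∀ i j, L i * L j = L j * L i + ((j : ℂ) - i) • L (i + j - 1)
  L_G : ∀ i j, L i * G j = G j * L i + ((j : ℂ) - i / 2) • G (i + j - 1)
  G_G : ∀ i j, G i * G j = -(G j * G i) - (2 : ℂ) • L (i + j)

/-- The relations between the fields `p k = P ((x - t) ^ k)` and `q k = Q ((x - t) ^ k)`.  The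
factor `0 ^ k`, which is `1` for `k = 0` and `0` otherwise, is the value of `(x - t) ^ k` at
`x = t`. -/
structure CentredRelations (t ξ : B) (p q : ℕ → B) : Prop where
  ξ_t : ξ * t = t * ξ
  ξ_ξ : ξ * ξ = 0
  p_t : ∀ k, p k * t = t * p k + (0 ^ k : ℂ) • 1
  p_zero_ξ : p 0 * ξ = ξ * p 0
  p_succ_ξ : ∀ k, p (k + 1) * ξ = ξ * p (k + 1) + (0 ^ k / 2 : ℂ) • ξ
  q_t : ∀ k, q k * t = t * q k + (0 ^ k : ℂ) • ξ
  q_ξ : ∀ k, q k * ξ = -(ξ * q k) - (0 ^ k : ℂ) • 1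
  p_zero_p : ∀ k, p 0 * p k = p k * p 0
  p_p : ∀ j k, p (j + 1) * p (k + 1) = p (k + 1) * p (j + 1) + ((k : ℂ) - j) • p (j + k + 1)
  p_zero_q : ∀ k, p 0 * q k = q k * p 0
  p_q_zero : ∀ j, p (j + 1) * q 0 = q 0 * p (j + 1) - (((j : ℂ) + 1) / 2) • q j +
    ((j : ℂ) + 1) • (ξ * p j)
  p_q : ∀ j k, p (j + 1) * q (k + 1) = q (k + 1) * p (j + 1) +
    ((k : ℂ) + 1 - (j + 1) / 2) • q (j + k + 1)
  q_zero_q_zero : q 0 * q 0 = -p 0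
  q_zero_q : ∀ k, q 0 * q (k + 1) = -(q (k + 1) * q 0) - (2 : ℂ) • p (k + 1) -
    ((k : ℂ) + 1) • (ξ * q k)
  q_q : ∀ j k, q (j + 1) * q (k + 1) = -(q (k + 1) * q (j + 1)) - (2 : ℂ) • p (j + k + 2)

/-- The relations in `𝒦 ⊗ U(𝔨_{≥ 0})` between `t`, `ξ`, the elements `ℓ (k + 1) = L_k` and
`g (k + 1) = G_{k+1/2}` of `𝔨_{≥ 0}`, and `ℓ 0 = ∂_t` and `g 0 = -(∂_ξ + ξ ∂_t)`.  The elements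
with positive index supercommute with `t`, `ξ`, `ℓ 0` and `g 0`. -/
structure SplitRelations (t ξ : B) (ℓ g : ℕ → B) : Prop where
  ξ_t : ξ * t = t * ξ
  ξ_ξ : ξ * ξ = 0
  ℓ_t : ∀ k, ℓ k * t = t * ℓ k + (0 ^ k : ℂ) • 1
  ℓ_ξ : ∀ k, ℓ k * ξ = ξ * ℓ k
  g_t : ∀ k, g k * t = t * g k - (0 ^ k : ℂ) • ξ
  g_ξ : ∀ k, g k * ξ = -(ξ * g k) - (0 ^ k : ℂ) • 1
  ℓ_zero_ℓ : ∀ k, ℓ 0 * ℓ k = ℓ k * ℓ 0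
  ℓ_ℓ : ∀ j k, ℓ (j + 1) * ℓ (k + 1) = ℓ (k + 1) * ℓ (j + 1) + ((k : ℂ) - j) • ℓ (j + k + 1)
  ℓ_zero_g : ∀ k, ℓ 0 * g k = g k * ℓ 0
  ℓ_g_zero : ∀ k, ℓ k * g 0 = g 0 * ℓ k
  ℓ_g : ∀ j k, ℓ (j + 1) * g (k + 1) = g (k + 1) * ℓ (j + 1) +
    ((k : ℂ) + 1 - (j + 1) / 2) • g (j + k + 1)
  g_zero_g_zero : g 0 * g 0 = ℓ 0
  g_zero_g : ∀ k, g 0 * g (k + 1) = -(g (k + 1) * g 0)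
  g_g : ∀ j k, g (j + 1) * g (k + 1) = -(g (k + 1) * g (j + 1)) - (2 : ℂ) • ℓ (j + k + 2)

/-! ### From the fields `xⁱ` to arbitrary fields -/

theorem span_X_pow : Submodule.span ℂ[X] (Set.range fun i => (X ^ i : ℂ[X][X])) = ⊤ := by
  refine eq_top_iff.2 fun F _ => ?_
  rw [F.as_sum_range_C_mul_X_pow]
  exact sum_mem fun i _ => by
    rw [← smul_eq_C_mul]; exact Submodule.smul_mem _ _ (Submodule.subset_span ⟨i, rfl⟩)

theorem dCoeff_X_pow (i : ℕ) : dCoeff (X ^ i) = 0 := by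
  rw [Derivation.leibniz_pow, dCoeff_X, smul_zero, smul_zero]

theorem smul_eq_C_C_mul (a : ℂ) (F : ℂ[X][X]) : a • F = C (C a) * F :=
  Algebra.smul_def a F

theorem brPP_X_pow (i j : ℕ) : brPP (X ^ i) (X ^ j) = ((j : ℂ) - i) • X ^ (i + j - 1) := by
  rw [brPP, dCoeff_X_pow, dCoeff_X_pow, mul_zero, mul_zero, derivative_X_pow, derivative_X_pow,
    smul_eq_C_C_mul]
  rcases i with - | i <;> rcases j with - | j <;> simp [pow_succ, pow_add, ← add_assoc] <;> ring

theorem brPQ_X_pow (i j : ℕ) : brPQ (X ^ i) (X ^ j) = ((j : ℂ) - i / 2) • X ^ (i + j - 1) := by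
  rw [brPQ, dCoeff_X_pow, mul_zero, derivative_X_pow, derivative_X_pow, smul_eq_C_C_mul,
    smul_eq_C_C_mul]
  rcases i with - | i <;> rcases j with - | j <;>
    simp [pow_succ, pow_add, ← add_assoc, div_eq_mul_inv] <;> ring

/-- The relations of arbitrary fields, from those of the fields `x ^ i`. -/
theorem NSRelations.contactFields {t ξ : B} {L G : ℕ → B} (h : NSRelations t ξ L G) :
    ContactFields t ξ (polySum t L) (polySum t G) := by
  have h0 : ActsOnFunctions t ξ (polySum t L) (polySum t G) := by
    refine .of_generators span_X_pow h.ξ_t h.ξ_ξ (polySum_C_mul t L) (polySum_C_mul t G) ?_ ?_ ?_ ?_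
    all_goals intro i
    · simp [polySum_X_pow, h.L_t]
    · have e : eval X (derivative (X ^ i : ℂ[X][X])) = C (i : ℂ) * X ^ (i - 1) := by
        rw [derivative_X_pow]; simp
      rw [polySum_X_pow, h.L_ξ, e, map_mul, aeval_C, map_pow (aeval t), aeval_X, ← Algebra.smul_def,
        smul_mul_assoc, smul_smul]
      congr 2
      ring
    · simp [polySum_X_pow, h.G_t]
    · simp [polySum_X_pow, h.G_ξ]
  refine ⟨h0, h0.P_P_of_generators span_X_pow fun i j => ?_,
    h0.P_Q_of_generators span_X_pow fun i j => ?_, h0.Q_Q_of_generators span_X_pow fun i j => ?_⟩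
  · rw [brPP_X_pow, map_smul, polySum_X_pow, polySum_X_pow, polySum_X_pow, h.L_L]
  · rw [brPQ_X_pow, map_smul, polySum_X_pow, polySum_X_pow, polySum_X_pow, h.L_G, dCoeff_X_pow,
      mul_zero, map_zero, mul_zero, sub_zero]
  · rw [brQQ, dCoeff_X_pow, dCoeff_X_pow, mul_zero, mul_zero, add_zero, map_zero, mul_zero,
      add_zero, ← pow_add, polySum_X_pow, polySum_X_pow, polySum_X_pow, h.G_G]

/-- The relations of the fields `x ^ i`, recovered from those of arbitrary fields. -/
theorem ContactFields.nsRelations {t ξ : B} {P Q : ℂ[X][X] →ₗ[ℂ] B}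
    (h : ContactFields t ξ P Q) :
    NSRelations t ξ (fun i => P (X ^ i)) (fun i => Q (X ^ i)) where
  ξ_t := h.ξ_t
  ξ_ξ := h.ξ_ξ
  L_t i := by simpa using h.P_t (X ^ i) X
  L_ξ i := by
    have e : eval X (derivative (X ^ i : ℂ[X][X])) = C (i : ℂ) * X ^ (i - 1) := by
      rw [derivative_X_pow]; simp
    rw [h.P_ξ, e, map_mul, aeval_C, map_pow (aeval t), aeval_X, ← Algebra.smul_def,
        smul_mul_assoc, smul_smul]
    congr 2
    ring
  G_t i := by simpa using h.Q_t (X ^ i) X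
  G_ξ i := by simpa using h.Q_ξ (X ^ i)
  L_L i j := by rw [h.P_P, brPP_X_pow, map_smul]
  L_G i j := by
    rw [h.P_Q, brPQ_X_pow, map_smul, dCoeff_X_pow, mul_zero, map_zero, mul_zero, sub_zero]
  G_G i j := by
    rw [h.Q_Q, brQQ, dCoeff_X_pow, dCoeff_X_pow, mul_zero, mul_zero, add_zero, map_zero, mul_zero,
      add_zero, ← pow_add]

/-! ### The fields centred at `x = t` -/

/-- The coordinate `x - t`. -/
def cY : ℂ[X][X] := X - C X

theorem eval_cY_pow (k : ℕ) : (cY ^ k).eval X = C (0 ^ k : ℂ) := by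
  simp [cY]

theorem derivative_cY_pow (k : ℕ) : derivative (cY ^ k) = (k : ℂ) • cY ^ (k - 1) := by
  rw [cY, derivative_X_sub_C_pow, smul_eq_C_C_mul]
  simp

theorem dCoeff_cY : dCoeff cY = -1 := by
  rw [cY, map_sub, dCoeff_C, dCoeff_X, derivative_X, C_1, zero_sub]

theorem dCoeff_cY_pow (k : ℕ) : dCoeff (cY ^ k) = -((k : ℂ) • cY ^ (k - 1)) := by
  rw [Derivation.leibniz_pow, dCoeff_cY, smul_eq_C_C_mul]
  simp
  ring

theorem span_cY_pow : Submodule.span ℂ[X] (Set.range fun k => cY ^ k) = ⊤ := by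
  refine eq_top_iff.2 fun F _ => ?_
  rw [← sum_taylor_eq F X]
  exact sum_mem fun i _ => by
    dsimp only
    rw [← smul_eq_C_mul]; exact Submodule.smul_mem _ _ (Submodule.subset_span ⟨i, rfl⟩)

/-- The field `P 1` translates `t` together with `x`, and so commutes with the fields
`P ((x - t) ^ k)`. -/
theorem brPP_one_cY_pow (k : ℕ) : brPP (cY ^ 0) (cY ^ k) = 0 := by
  rw [brPP, dCoeff_cY_pow, derivative_cY_pow]
  simp

theorem brPP_cY_pow (j k : ℕ) :
    brPP (cY ^ (j + 1)) (cY ^ (k + 1)) = ((k : ℂ) - j) • cY ^ (j + k + 1) := by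
  simp only [brPP, dCoeff_cY_pow, derivative_cY_pow, eval_cY_pow, smul_eq_C_C_mul]
  simp
  ring

theorem brPQ_one_cY_pow (k : ℕ) : brPQ (cY ^ 0) (cY ^ k) = 0 := by
  rw [brPQ, dCoeff_cY_pow, derivative_cY_pow]
  simp

theorem brPQ_cY_pow (j k : ℕ) :
    brPQ (cY ^ (j + 1)) (cY ^ k) = ((k : ℂ) - (j + 1) / 2) • cY ^ (j + k) := by
  simp only [brPQ, dCoeff_cY_pow, derivative_cY_pow, eval_cY_pow, smul_eq_C_C_mul]
  rcases k with - | k <;> simp [div_eq_mul_inv] <;> ring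

/-- The relations of the fields `(x - t) ^ k`, from those of arbitrary fields. -/
theorem ContactFields.centredRelations {t ξ : B} {P Q : ℂ[X][X] →ₗ[ℂ] B}
    (h : ContactFields t ξ P Q) :
    CentredRelations t ξ (fun k => P (cY ^ k)) (fun k => Q (cY ^ k)) where
  ξ_t := h.ξ_t
  ξ_ξ := h.ξ_ξ
  p_t k := by
    simpa only [aeval_X, eval_cY_pow, derivative_X, mul_one, aeval_C,
      Algebra.algebraMap_eq_smul_one] using h.P_t (cY ^ k) X
  p_zero_ξ := by
    rw [h.P_ξ, derivative_cY_pow]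
    simp
  p_succ_ξ k := by
    rw [h.P_ξ, derivative_cY_pow, add_tsub_cancel_right, smul_eq_C_C_mul, eval_mul, eval_C,
      eval_cY_pow, ← C_mul, aeval_C, ← Algebra.smul_def, smul_smul]
    congr 2
    rcases k with - | k <;> simp
  q_t k := by
    have := h.Q_t (cY ^ k) X
    rwa [aeval_X, eval_cY_pow, derivative_X, mul_one, aeval_C, ← Algebra.smul_def] at this
  q_ξ k := by
    have := h.Q_ξ (cY ^ k)
    rwa [eval_cY_pow, aeval_C, Algebra.algebraMap_eq_smul_one] at this
  p_zero_p k := by rw [h.P_P, brPP_one_cY_pow, map_zero, add_zero]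
  p_p j k := by rw [h.P_P, brPP_cY_pow, map_smul]
  p_zero_q k := by
    rw [h.P_Q, brPQ_one_cY_pow, dCoeff_cY_pow]; simp
  p_q_zero j := by
    rw [h.P_Q, brPQ_cY_pow, dCoeff_cY_pow, eval_cY_pow, map_smul]
    simp only [pow_zero, C_1, one_mul, map_neg, map_smul, mul_neg, mul_smul_comm,
      add_tsub_cancel_right, add_zero]
    push_cast
    module
  p_q j k := by
    rw [h.P_Q, brPQ_cY_pow, eval_cY_pow, map_smul]
    simp [add_assoc]
  q_zero_q_zero := by
    have := h.Q_Q (cY ^ 0) (cY ^ 0)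
    rw [brQQ, dCoeff_cY_pow] at this
    simp only [CharP.cast_eq_zero, zero_smul, neg_zero, mul_zero, add_zero, map_zero,
      pow_zero, mul_one] at this ⊢
    -- the bracket of `Q 1` with itself is twice its square
    have h2 : (2 : ℂ) • (Q 1 * Q 1) = (2 : ℂ) • -P 1 := by
      calc (2 : ℂ) • (Q 1 * Q 1) = Q 1 * Q 1 + Q 1 * Q 1 := two_smul _ _
        _ = Q 1 * Q 1 + (-(Q 1 * Q 1) - (2 : ℂ) • P 1) := by nth_rw 2 [this]
        _ = (2 : ℂ) • -P 1 := by rw [smul_neg]; abel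
    exact smul_right_injective B (two_ne_zero' ℂ) h2
  q_zero_q k := by
    rw [h.Q_Q, brQQ, dCoeff_cY_pow, dCoeff_cY_pow, eval_cY_pow, eval_cY_pow]
    simp only [pow_zero, C_1, one_mul, map_neg, map_smul, mul_neg, mul_smul_comm,
      add_tsub_cancel_right, zero_pow (Nat.succ_ne_zero k), map_zero, zero_mul, add_zero]
    push_cast
    abel
  q_q j k := by
    rw [h.Q_Q, brQQ, eval_cY_pow, eval_cY_pow, ← pow_add, show j + 1 + (k + 1) = j + k + 2 by ring]
    simp

/-- The sum `∑ aₖ(t) pₖ` attached to the polynomial `∑ aₖ (x - t) ^ k`. -/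
def centredSum (t : B) (p : ℕ → B) : ℂ[X][X] →ₗ[ℂ] B :=
  polySum t p ∘ₗ (taylor (X : ℂ[X])).restrictScalars ℂ

theorem centredSum_C_mul (t : B) (p : ℕ → B) (a : ℂ[X]) (F : ℂ[X][X]) :
    centredSum t p (C a * F) = aeval t a * centredSum t p F := by
  rw [centredSum, LinearMap.comp_apply, LinearMap.restrictScalars_apply, taylor_mul, taylor_C,
    polySum_C_mul]
  rfl

theorem centredSum_cY_pow (t : B) (p : ℕ → B) (k : ℕ) : centredSum t p (cY ^ k) = p k := by
  rw [centredSum, LinearMap.comp_apply, LinearMap.restrictScalars_apply, taylor_pow, cY, map_sub,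
    taylor_X, taylor_C, add_sub_cancel_right, polySum_X_pow]

/-- The relations of arbitrary fields, from those of the fields `(x - t) ^ k`. -/
theorem CentredRelations.contactFields {t ξ : B} {p q : ℕ → B} (h : CentredRelations t ξ p q) :
    ContactFields t ξ (centredSum t p) (centredSum t q) := by
  have h0 : ActsOnFunctions t ξ (centredSum t p) (centredSum t q) := by
    refine .of_generators span_cY_pow h.ξ_t h.ξ_ξ (centredSum_C_mul t p) (centredSum_C_mul t q)
      ?_ ?_ ?_ ?_
    all_goals intro k
    · rw [centredSum_cY_pow, h.p_t, eval_cY_pow, aeval_C, Algebra.algebraMap_eq_smul_one]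
    · rw [centredSum_cY_pow, derivative_cY_pow, smul_eq_C_C_mul, eval_mul, eval_C, eval_cY_pow,
        ← C_mul, aeval_C, ← Algebra.smul_def, smul_smul]
      rcases k with - | k
      · rw [h.p_zero_ξ]; simp
      · rw [h.p_succ_ξ]
        congr 2
        rcases k with - | k <;> simp
    · rw [centredSum_cY_pow, h.q_t, eval_cY_pow, aeval_C, ← Algebra.smul_def]
    · rw [centredSum_cY_pow, h.q_ξ, eval_cY_pow, aeval_C, Algebra.algebraMap_eq_smul_one]
  refine ⟨h0, h0.P_P_of_generators span_cY_pow fun j k => ?_,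
    h0.P_Q_of_generators span_cY_pow fun j k => ?_, h0.Q_Q_of_generators span_cY_pow fun j k => ?_⟩
  · rcases j with - | j
    · rw [brPP_one_cY_pow, map_zero, add_zero, centredSum_cY_pow, centredSum_cY_pow, h.p_zero_p]
    rcases k with - | k
    · rw [brPP_swap, brPP_one_cY_pow, neg_zero, map_zero, add_zero, centredSum_cY_pow,
        centredSum_cY_pow, h.p_zero_p]
    · rw [brPP_cY_pow, map_smul, centredSum_cY_pow, centredSum_cY_pow, centredSum_cY_pow, h.p_p]
  · rcases j with - | j
    · rw [brPQ_one_cY_pow, dCoeff_cY_pow, Nat.cast_zero, zero_smul, neg_zero, mul_zero, map_zero,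
        map_zero, add_zero, mul_zero, sub_zero, centredSum_cY_pow, centredSum_cY_pow, h.p_zero_q]
    rw [brPQ_cY_pow, map_smul, eval_cY_pow, dCoeff_cY_pow, ← smul_eq_C_C_mul, map_smul, map_neg,
      map_smul]
    simp only [centredSum_cY_pow]
    rcases k with - | k
    · rw [h.p_q_zero]
      simp only [pow_zero, one_smul, mul_neg, mul_smul_comm, add_tsub_cancel_right, add_zero]
      push_cast
      module
    · rw [h.p_q, zero_pow (Nat.succ_ne_zero k), zero_smul, mul_zero, sub_zero,
        ← add_assoc]
      push_cast
      rfl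
  · rw [brQQ, eval_cY_pow, eval_cY_pow, dCoeff_cY_pow, dCoeff_cY_pow, ← pow_add,
      ← smul_eq_C_C_mul, ← smul_eq_C_C_mul, map_add, map_smul, map_smul, map_neg, map_neg,
      map_smul, map_smul]
    simp only [centredSum_cY_pow]
    rcases j with - | j <;> rcases k with - | k
    · have e := h.q_zero_q_zero
      simp only [e, CharP.cast_eq_zero, zero_smul, neg_zero, smul_zero, add_zero, mul_zero]
      module
    · rw [h.q_zero_q]
      simp
      abel
    · rw [show q (j + 1) * q 0 = -(q 0 * q (j + 1)) - (2 : ℂ) • p (j + 1) -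
        ((j : ℂ) + 1) • (ξ * q j) by rw [h.q_zero_q]; abel]
      simp
      abel
    · rw [h.q_q, show j + 1 + (k + 1) = j + k + 2 by ring]
      simp

/-! ### Splitting off the Weyl superalgebra -/

section Split

variable {t ξ : B} {p q ℓ g : ℕ → B}

/-- Correcting the centred fields by multiples of `ξ` makes them supercommute with `ξ` and with
`g 0`, except for those with index `0`.  Each relation is a combination of centred relations,
multiplied by `1` or `ξ`. -/
theorem CentredRelations.splitRelations (h : CentredRelations t ξ p q)
    (h0 : ℓ 0 = p 0) (hℓ : ∀ k, ℓ (k + 1) = p (k + 1) + (((k : ℂ) + 1) / 2) • (ξ * q k))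
    (hg : ∀ k, g k = q k - (2 : ℂ) • (ξ * p k)) : SplitRelations t ξ ℓ g := by
  have ξ_t : ∀ x, ξ * (t * x) = t * (ξ * x) := fun x => by
    rw [← mul_assoc, h.ξ_t, mul_assoc]
  have ξ_ξ : ∀ x, ξ * (ξ * x) = 0 := fun x => by rw [← mul_assoc, h.ξ_ξ, zero_mul]
  have p_zero_ξ : ∀ x, p 0 * (ξ * x) = ξ * (p 0 * x) := fun x => by
    rw [← mul_assoc, h.p_zero_ξ, mul_assoc]
  have p_ξ : ∀ k x, p (k + 1) * (ξ * x) = ξ * (p (k + 1) * x) + (0 ^ k / 2 : ℂ) • (ξ * x) :=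
    fun k x => by rw [← mul_assoc, h.p_succ_ξ, add_mul, mul_assoc, smul_mul_assoc]
  have q_ξ : ∀ k x, q k * (ξ * x) = -(ξ * (q k * x)) - (0 ^ k : ℂ) • x := fun k x => by
    rw [← mul_assoc, h.q_ξ, sub_mul, neg_mul, mul_assoc, smul_mul_assoc, one_mul]
  have ξ_q_q : ∀ j k, ξ * (q j * q k) = -(ξ * (q k * q j)) - (2 : ℂ) • (ξ * p (j + k)) := by
    intro j k
    rcases j with - | j <;> rcases k with - | k
    · rw [h.q_zero_q_zero, mul_neg]; module
    · rw [h.q_zero_q]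
      simp only [mul_sub, mul_smul_comm, ξ_ξ, mul_neg, smul_zero, sub_zero, zero_add]
    · rw [h.q_zero_q]
      simp only [mul_sub, mul_smul_comm, ξ_ξ, mul_neg, smul_zero, sub_zero, add_zero]
      abel
    · rw [h.q_q]
      simp only [mul_sub, mul_smul_comm, mul_neg]
      congr 4
      ring
  have ξ_p_q : ∀ j k, ξ * (p (j + 1) * q k) = ξ * (q k * p (j + 1)) +
      ((k : ℂ) - (j + 1) / 2) • (ξ * q (j + k)) := by
    intro j k
    rcases k with - | k
    · rw [h.p_q_zero]
      simp only [mul_sub, mul_add, mul_smul_comm, ξ_ξ, add_zero]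
      push_cast
      module
    · rw [h.p_q]
      simp only [mul_add, mul_smul_comm, add_assoc]
      push_cast
      rfl
  constructor
  case ξ_t => exact h.ξ_t
  case ξ_ξ => exact h.ξ_ξ
  case ℓ_t =>
    rintro (- | k)
    · rw [h0, h.p_t]
    · rw [hℓ]
      simp only [mul_add, add_mul, mul_assoc, smul_mul_assoc, mul_smul_comm, h.p_t, h.q_t, h.ξ_ξ,
        ξ_t, smul_zero, add_zero]
      abel
  case ℓ_ξ =>
    rintro (- | k)
    · rw [h0, h.p_zero_ξ]
    · rw [hℓ]
      simp only [mul_add, add_mul, mul_assoc, smul_mul_assoc, mul_smul_comm, h.p_succ_ξ, h.q_ξ,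
        mul_sub, mul_neg, ξ_ξ, mul_one]
      rcases k with - | k
      · simp only [pow_zero, CharP.cast_eq_zero]
        module
      · simp
  case g_t =>
    intro k
    rw [hg]
    simp only [mul_sub, sub_mul, mul_add, mul_assoc, smul_mul_assoc, mul_smul_comm, h.p_t, h.q_t,
      ξ_t, mul_one]
    module
  case g_ξ =>
    rintro (- | k)
    · rw [hg]
      simp only [mul_sub, sub_mul, mul_assoc, smul_mul_assoc, mul_smul_comm, h.p_zero_ξ,
        h.q_ξ, ξ_ξ]
      module
    · rw [hg]
      simp only [mul_sub, sub_mul, mul_add, mul_assoc, smul_mul_assoc, mul_smul_comm, h.p_succ_ξ,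
        h.q_ξ, ξ_ξ, h.ξ_ξ]
      module
  case ℓ_zero_ℓ =>
    rintro (- | k)
    · rfl
    · rw [h0, hℓ]
      simp only [mul_add, add_mul, mul_assoc, smul_mul_assoc, mul_smul_comm, p_zero_ξ, h.p_zero_p,
        h.p_zero_q]
  case ℓ_ℓ =>
    intro j k
    rw [hℓ, hℓ, hℓ]
    linear_combination (norm := skip) h.p_p j k
      + (((k : ℂ) + 1) / 2) • ξ_p_q j k - (((j : ℂ) + 1) / 2) • ξ_p_q k j
    simp only [mul_add, add_mul, mul_assoc, smul_mul_assoc, mul_smul_comm, p_ξ, q_ξ, ξ_ξ, mul_sub,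
      mul_neg, smul_add, smul_sub, add_comm k j]
    rcases j with - | j <;> rcases k with - | k <;>
      simp only [pow_zero, zero_pow (Nat.succ_ne_zero _)] <;> push_cast <;> module
  case ℓ_zero_g =>
    intro k
    rw [h0, hg]
    simp only [mul_sub, sub_mul, mul_assoc, smul_mul_assoc, mul_smul_comm, p_zero_ξ, h.p_zero_p,
      h.p_zero_q]
  case ℓ_g_zero =>
    rintro (- | k)
    · rw [h0, hg]
      simp only [mul_sub, sub_mul, mul_assoc, smul_mul_assoc, mul_smul_comm, p_zero_ξ, h.p_zero_p,
        h.p_zero_q]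
    · rw [hℓ, hg]
      linear_combination (norm := skip) h.p_q_zero k + (((k : ℂ) + 1) / 2) • ξ_q_q k 0
        + (2 : ℂ) • congrArg (ξ * ·) (h.p_zero_p (k + 1))
      simp only [mul_sub, sub_mul, mul_add, add_mul, mul_assoc, smul_mul_assoc, mul_smul_comm, p_ξ,
        p_zero_ξ, q_ξ, ξ_ξ, mul_neg, smul_add, smul_sub, add_zero, pow_zero]
      rcases k with - | k <;>
        simp only [pow_zero, zero_pow (Nat.succ_ne_zero _)] <;> push_cast <;> module
  case ℓ_g =>
    intro j k
    rw [hℓ, hg, hg]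
    linear_combination (norm := skip) h.p_q j k + (((j : ℂ) + 1) / 2) • ξ_q_q j (k + 1)
      - (2 : ℂ) • congrArg (ξ * ·) (h.p_p j k)
    simp only [mul_sub, sub_mul, mul_add, add_mul, mul_assoc, smul_mul_assoc, mul_smul_comm, p_ξ,
      q_ξ, ξ_ξ, mul_neg, smul_add, smul_sub, ← add_assoc]
    rcases j with - | j <;> rcases k with - | k <;>
      simp only [pow_zero, zero_pow (Nat.succ_ne_zero _)] <;> push_cast <;> module
  case g_zero_g_zero =>
    rw [hg, h0]
    simp only [mul_sub, sub_mul, mul_assoc, smul_mul_assoc, mul_smul_comm,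
      p_zero_ξ, q_ξ, ξ_ξ, smul_sub, h.q_zero_q_zero, h.p_zero_q]
    module
  case g_zero_g =>
    intro k
    rw [hg, hg]
    linear_combination (norm := skip) h.q_zero_q k - (2 : ℂ) • ξ_p_q k 0
      - (2 : ℂ) • congrArg (ξ * ·) (h.p_zero_q (k + 1))
    simp only [mul_sub, sub_mul, mul_add, mul_assoc, smul_mul_assoc, mul_smul_comm,
      p_zero_ξ, p_ξ, q_ξ, ξ_ξ, smul_add, smul_sub]
    rcases k with - | k <;>
      simp only [pow_zero, zero_pow (Nat.succ_ne_zero _)] <;> push_cast <;> module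
  case g_g =>
    intro j k
    rw [hg, hg, hℓ]
    linear_combination (norm := skip) h.q_q j k - (2 : ℂ) • ξ_p_q j (k + 1)
      - (2 : ℂ) • ξ_p_q k (j + 1)
    simp only [mul_sub, sub_mul, mul_add, mul_assoc, smul_mul_assoc, mul_smul_comm,
      p_ξ, q_ξ, ξ_ξ, smul_add, smul_sub, ← add_assoc, add_comm k j]
    rcases j with - | j <;> rcases k with - | k <;>
      simp only [pow_zero, zero_pow (Nat.succ_ne_zero _)] <;> push_cast <;> module

/-- The correction by multiples of `ξ` can be undone. -/
theorem SplitRelations.centredRelations (h : SplitRelations t ξ ℓ g)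
    (h0 : p 0 = ℓ 0) (hp : ∀ k, p (k + 1) = ℓ (k + 1) - (((k : ℂ) + 1) / 2) • (ξ * g k))
    (hq : ∀ k, q k = g k + (2 : ℂ) • (ξ * ℓ k)) : CentredRelations t ξ p q := by
  have ξ_t : ∀ x, ξ * (t * x) = t * (ξ * x) := fun x => by
    rw [← mul_assoc, h.ξ_t, mul_assoc]
  have ξ_ξ : ∀ x, ξ * (ξ * x) = 0 := fun x => by rw [← mul_assoc, h.ξ_ξ, zero_mul]
  have ℓ_ξ : ∀ k x, ℓ k * (ξ * x) = ξ * (ℓ k * x) := fun k x => by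
    rw [← mul_assoc, h.ℓ_ξ, mul_assoc]
  have g_ξ : ∀ k x, g k * (ξ * x) = -(ξ * (g k * x)) - (0 ^ k : ℂ) • x := fun k x => by
    rw [← mul_assoc, h.g_ξ, sub_mul, neg_mul, mul_assoc, smul_mul_assoc, one_mul]
  constructor
  case ξ_t => exact h.ξ_t
  case ξ_ξ => exact h.ξ_ξ
  case p_t =>
    rintro (- | k)
    · rw [h0, h.ℓ_t]
    · rw [hp]
      simp only [mul_sub, sub_mul, mul_assoc, smul_mul_assoc, mul_smul_comm, h.ℓ_t, h.g_t,
        h.ξ_ξ, ξ_t, smul_zero, sub_zero]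
      abel
  case p_zero_ξ =>
    rw [h0, h.ℓ_ξ]
  case p_succ_ξ =>
    intro k
    rw [hp]
    simp only [mul_sub, sub_mul, mul_assoc, smul_mul_assoc, mul_smul_comm, h.ℓ_ξ, h.g_ξ,
      mul_neg, ξ_ξ, mul_one]
    rcases k with - | k <;>
      simp only [pow_zero, zero_pow (Nat.succ_ne_zero _)] <;> push_cast <;> module
  case q_t =>
    intro k
    rw [hq]
    simp only [add_mul, mul_add, mul_assoc, smul_mul_assoc, mul_smul_comm, h.ℓ_t, h.g_t, ξ_t,
      mul_one]
    module
  case q_ξ =>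
    intro k
    rw [hq]
    simp only [add_mul, mul_add, mul_assoc, smul_mul_assoc, mul_smul_comm, h.ℓ_ξ, h.g_ξ, ξ_ξ]
    module
  case p_zero_p =>
    rintro (- | k)
    · rfl
    · rw [h0, hp]
      simp only [mul_sub, sub_mul, mul_assoc, smul_mul_assoc, mul_smul_comm, ℓ_ξ, h.ℓ_zero_ℓ,
        h.ℓ_zero_g]
  case p_p =>
    intro j k
    rw [hp, hp, hp]
    rcases j with - | j <;> rcases k with - | k
    · push_cast; module
    · linear_combination (norm := skip) h.ℓ_ℓ 0 (k + 1)
        - ((((k : ℂ) + 1) + 1) / 2) • congrArg (ξ * ·) (h.ℓ_g 0 k)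
        + (((0 : ℂ) + 1) / 2) • congrArg (ξ * ·) (h.ℓ_g_zero (k + 2))
      simp only [mul_sub, sub_mul, mul_add, mul_assoc, smul_mul_assoc, mul_smul_comm, ℓ_ξ,
        g_ξ, ξ_ξ, mul_neg, smul_add, smul_sub, zero_add, pow_zero, zero_pow (Nat.succ_ne_zero _)]
      push_cast
      module
    · linear_combination (norm := skip) h.ℓ_ℓ (j + 1) 0
        + ((((j : ℂ) + 1) + 1) / 2) • congrArg (ξ * ·) (h.ℓ_g 0 j)
        - (((0 : ℂ) + 1) / 2) • congrArg (ξ * ·) (h.ℓ_g_zero (j + 2))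
      simp only [mul_sub, sub_mul, mul_add, mul_assoc, smul_mul_assoc, mul_smul_comm, ℓ_ξ,
        g_ξ, ξ_ξ, mul_neg, smul_add, smul_sub, zero_add, add_zero, pow_zero,
        zero_pow (Nat.succ_ne_zero _)]
      push_cast
      module
    · linear_combination (norm := skip) h.ℓ_ℓ (j + 1) (k + 1)
        - ((((k : ℂ) + 1) + 1) / 2) • congrArg (ξ * ·) (h.ℓ_g (j + 1) k)
        + ((((j : ℂ) + 1) + 1) / 2) • congrArg (ξ * ·) (h.ℓ_g (k + 1) j)
      simp only [mul_sub, sub_mul, mul_add, mul_assoc, smul_mul_assoc, mul_smul_comm, ℓ_ξ,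
        g_ξ, ξ_ξ, mul_neg, smul_add, smul_sub, zero_pow (Nat.succ_ne_zero _),
        show k + 1 + j + 1 = j + 1 + k + 1 by ring, ← add_assoc]
      push_cast
      module
  case p_zero_q =>
    intro k
    rw [h0, hq]
    simp only [mul_add, add_mul, mul_assoc, smul_mul_assoc, mul_smul_comm, ℓ_ξ, h.ℓ_zero_ℓ,
      h.ℓ_zero_g]
  case p_q_zero =>
    rintro (- | j)
    · rw [hp, hq, h0]
      linear_combination (norm := skip) h.ℓ_g_zero 1 - (2 : ℂ) • congrArg (ξ * ·) (h.ℓ_zero_ℓ 1)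
        - congrArg (ξ * ·) h.g_zero_g_zero
      simp only [mul_sub, sub_mul, mul_add, add_mul, mul_assoc, smul_mul_assoc, mul_smul_comm, ℓ_ξ,
        g_ξ, ξ_ξ, mul_neg, smul_add, smul_sub, zero_add, pow_zero]
      push_cast
      module
    · rw [hp, hq, hq, hp]
      linear_combination (norm := skip) h.ℓ_g_zero (j + 2)
        - (2 : ℂ) • congrArg (ξ * ·) (h.ℓ_zero_ℓ (j + 2))
        - ((((j : ℂ) + 1) + 1) / 2) • congrArg (ξ * ·) (h.g_zero_g j)
      simp only [mul_sub, sub_mul, mul_add, add_mul, mul_assoc, smul_mul_assoc, mul_smul_comm, ℓ_ξ,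
        g_ξ, ξ_ξ, mul_neg, smul_add, smul_sub, zero_pow (Nat.succ_ne_zero _), pow_zero]
      push_cast
      module
  case p_q =>
    rintro (- | j) k
    · rw [hp, hq, hq]
      linear_combination (norm := skip) h.ℓ_g 0 k + (2 : ℂ) • congrArg (ξ * ·) (h.ℓ_ℓ 0 k)
        - (((0 : ℂ) + 1) / 2) • congrArg (ξ * ·) (h.g_zero_g k)
      simp only [mul_sub, sub_mul, mul_add, add_mul, mul_assoc, smul_mul_assoc, mul_smul_comm, ℓ_ξ,
        g_ξ, ξ_ξ, mul_neg, smul_add, smul_sub, zero_pow (Nat.succ_ne_zero _), pow_zero, zero_add]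
      push_cast
      module
    · rw [hp, hq, hq]
      linear_combination (norm := skip) h.ℓ_g (j + 1) k
        + (2 : ℂ) • congrArg (ξ * ·) (h.ℓ_ℓ (j + 1) k)
        - ((((j : ℂ) + 1) + 1) / 2) • congrArg (ξ * ·) (h.g_g j k)
      simp only [mul_sub, sub_mul, mul_add, add_mul, mul_assoc, smul_mul_assoc, mul_smul_comm, ℓ_ξ,
        g_ξ, ξ_ξ, mul_neg, smul_add, smul_sub, zero_pow (Nat.succ_ne_zero _),
        show j + k + 2 = j + 1 + k + 1 by ring]
      push_cast
      module
  case q_zero_q_zero =>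
    rw [hq, h0]
    simp only [mul_add, add_mul, mul_assoc, smul_mul_assoc, mul_smul_comm, ℓ_ξ,
      g_ξ, ξ_ξ, h.g_zero_g_zero, h.ℓ_zero_g, smul_add, smul_sub]
    module
  case q_zero_q =>
    intro k
    rw [hq, hq, hq, hp]
    linear_combination (norm := skip) h.g_zero_g k
      + (2 : ℂ) • congrArg (ξ * ·) (h.ℓ_g_zero (k + 1))
      + (2 : ℂ) • congrArg (ξ * ·) (h.ℓ_zero_g (k + 1))
    simp only [mul_add, add_mul, mul_assoc, smul_mul_assoc, mul_smul_comm, ℓ_ξ,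
      g_ξ, ξ_ξ, smul_add, smul_sub, zero_pow (Nat.succ_ne_zero _), pow_zero]
    module
  case q_q =>
    intro j k
    rw [hq, hq, hp]
    linear_combination (norm := skip) h.g_g j k
      + (2 : ℂ) • congrArg (ξ * ·) (h.ℓ_g j k)
      + (2 : ℂ) • congrArg (ξ * ·) (h.ℓ_g k j)
    simp only [mul_add, add_mul, mul_assoc, smul_mul_assoc, mul_smul_comm, ℓ_ξ,
      g_ξ, ξ_ξ, smul_add, smul_sub, zero_pow (Nat.succ_ne_zero _),
      add_comm k j]
    push_cast
    module

end Split

/-! ### Homomorphisms out of the enveloping algebras -/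

section Supported

variable {S : Set Ix} (hS : kTilde.IsSubalgebra (Finsupp.supported ℂ ℂ S))

/-- A basis element `b ∈ S`, as an element of the subalgebra with basis `S`. -/
def suppOf (b : Ix) (hb : b ∈ S) : hS.toLieSuperalgebra :=
  hS.of ⟨Finsupp.single b 1, Ix.single_mem hb 1⟩

/-- The linear map on the span of `S` with prescribed values on `S`. -/
def suppMap {M : Type*} [AddCommGroup M] [Module ℂ M] (f : Ix → M) :
    hS.toLieSuperalgebra →ₗ[ℂ] M :=
  Finsupp.linearCombination ℂ f ∘ₗ (Finsupp.supported ℂ ℂ S).subtype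

theorem suppMap_suppOf {M : Type*} [AddCommGroup M] [Module ℂ M] (f : Ix → M) (b : Ix)
    (hb : b ∈ S) : suppMap hS f (suppOf hS b hb) = f b :=
  (Finsupp.linearCombination_single ℂ (1 : ℂ) b).trans (one_smul _ _)

theorem span_single (S : Set Ix) : Submodule.span ℂ (Set.range fun b : S =>
    (⟨Finsupp.single b.1 1, Ix.single_mem b.2 1⟩ : Finsupp.supported ℂ ℂ S)) = ⊤ := by
  refine eq_top_iff.2 fun x _ => ?_
  have hsum : x = ∑ b ∈ x.1.support.attach, x.1 b.1 •
      (⟨Finsupp.single b.1 1, Ix.single_mem (x.2 b.2) 1⟩ : Finsupp.supported ℂ ℂ S) := by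
    apply Subtype.ext
    rw [Submodule.coe_sum]
    simp only [Submodule.coe_smul, Finsupp.smul_single, smul_eq_mul, mul_one]
    rw [Finset.sum_attach x.1.support (fun b => Finsupp.single b (x.1 b))]
    exact (Finsupp.sum_single x.1).symm
  rw [hsum]
  exact sum_mem fun b _ => Submodule.smul_mem _ _ (Submodule.subset_span ⟨⟨b.1, x.2 b.2⟩, rfl⟩)

theorem span_suppOf : Submodule.span ℂ (Set.range fun b : S => suppOf hS b.1 b.2) = ⊤ := by
  refine eq_top_iff.2 fun x _ => ?_
  let x' : (Finsupp.supported ℂ ℂ S : Submodule ℂ (Ix →₀ ℂ)) := x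
  have hx : x' ∈ Submodule.span ℂ (Set.range fun b : S =>
    (⟨Finsupp.single b.1 1, Ix.single_mem b.2 1⟩ : Finsupp.supported ℂ ℂ S)) := by
    rw [span_single]; trivial
  refine Submodule.span_induction
    (p := fun (y : (Finsupp.supported ℂ ℂ S : Submodule ℂ (Ix →₀ ℂ))) _ =>
      (show hS.toLieSuperalgebra from y) ∈
        Submodule.span ℂ (Set.range fun b : S => suppOf hS b.1 b.2)) ?_ ?_ ?_ ?_ hx
  · rintro _ ⟨b, rfl⟩
    exact Submodule.subset_span ⟨b, rfl⟩
  · exact zero_mem _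
  · exact fun _ _ _ _ h h' => add_mem h h'
  · exact fun c _ _ h => Submodule.smul_mem _ c h

theorem supp_linearMap_ext {M : Type*} [AddCommGroup M] [Module ℂ M]
    {f g : hS.toLieSuperalgebra →ₗ[ℂ] M}
    (h : ∀ b hb, f (suppOf hS b hb) = g (suppOf hS b hb)) : f = g := by
  refine LinearMap.ext_on_range (span_suppOf hS) fun b => h b.1 b.2

/-- The relations of the enveloping algebra have only to be checked on the basis. -/
theorem suppMap_mul (f : Ix → B)
    (hf : ∀ a ∈ S, ∀ b ∈ S, f a * f b =
      ((-1 : ℤˣ) ^ (a.par * b.par)) • (f b * f a) + Finsupp.linearCombination ℂ f (Ix.br a b))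
    {i j : ZMod 2} {x y : hS.toLieSuperalgebra} (hx : x ∈ hS.toLieSuperalgebra.parity i)
    (hy : y ∈ hS.toLieSuperalgebra.parity j) :
    suppMap hS f x * suppMap hS f y =
      ((-1 : ℤˣ) ^ (i * j)) • (suppMap hS f y * suppMap hS f x) +
        suppMap hS f (hS.toLieSuperalgebra.bracket x y) := by
  have hx' : (x.1 : Ix →₀ ℂ) ∈ Finsupp.supported ℂ ℂ (S ∩ {b | b.par = i}) := by
    rw [Finsupp.supported_inter]; exact ⟨x.2, hx⟩
  have hy' : (y.1 : Ix →₀ ℂ) ∈ Finsupp.supported ℂ ℂ (S ∩ {b | b.par = j}) := by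
    rw [Finsupp.supported_inter]; exact ⟨y.2, hy⟩
  let F := Finsupp.linearCombination ℂ f
  have key : ∀ x ∈ Finsupp.supported ℂ ℂ (S ∩ {b | b.par = i}),
      ∀ y ∈ Finsupp.supported ℂ ℂ (S ∩ {b | b.par = j}),
      F x * F y = ((-1 : ℤˣ) ^ (i * j)) • (F y * F x) + F (Ix.bracket x y) := by
    intro x hx y hy
    refine Ix.supported_induction (P := fun x => F x * F y =
      ((-1 : ℤˣ) ^ (i * j)) • (F y * F x) + F (Ix.bracket x y)) ?_ ?_ ?_ hx
    · simp
    · intro x x' h h'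
      rw [map_add, add_mul, h, h', mul_add, smul_add, map_add, LinearMap.add_apply, map_add]
      abel
    · rintro a ⟨ha, rfl⟩ c
      refine Ix.supported_induction (P := fun y => F (Finsupp.single a c) * F y =
        ((-1 : ℤˣ) ^ (a.par * j)) • (F y * F (Finsupp.single a c)) +
          F (Ix.bracket (Finsupp.single a c) y)) ?_ ?_ ?_ hy
      · simp
      · intro y y' h h'
        rw [map_add, mul_add, h, h', add_mul, smul_add, map_add, map_add]
        abel
      · rintro b ⟨hb, rfl⟩ d
        rw [Ix.bracket_single, map_smul, Finsupp.linearCombination_single,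
          Finsupp.linearCombination_single, smul_mul_smul_comm, hf a ha b hb, smul_add,
          smul_mul_smul_comm, mul_comm d, smul_comm]
  exact key _ hx' _ hy'

end Supported

/-! ### The algebras `Ū⁺` and `Ū⁺⁺` by generators and relations -/

namespace Ubar

theorem isSubalgebra_ix (r : Fun) : kTilde.IsSubalgebra (Finsupp.supported ℂ ℂ r.ix) :=
  isSubalgebra_supported fun _ ha _ hb => br_mem_supported_ix r ha hb

section Lift

variable (r : Fun) (f : Ix → B)
  (hf : ∀ a ∈ r.ix, ∀ b ∈ r.ix, f a * f b =
    ((-1 : ℤˣ) ^ (a.par * b.par)) • (f b * f a) + Finsupp.linearCombination ℂ f (Ix.br a b))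
  (h_mul : ∀ i j, i ∈ r.exps → j ∈ r.exps → f (.t i) * f (.t j) = f (.t (i + j)))
  (h_one : f (.t 0) = 1) (h_mul_ξ : ∀ i, i ∈ r.exps → f (.t i) * f (.θ 0) = f (.θ i))
  (h_ξ_ξ : f (.θ 0) * f (.θ 0) = 0)

/-- The homomorphism on `U(𝔨⁺ ⋉ A)` with prescribed values on the basis. -/
def ueaLift : UEA (kPlus r) →ₐ[ℂ] B :=
  UEA.lift (L := kPlus r) (suppMap (isSubalgebra_ix r) f)
    (fun hx hy => suppMap_mul (isSubalgebra_ix r) f hf hx hy)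

theorem ueaLift_ugen (b : Ix) (hb : b ∈ r.ix) : ueaLift r f hf (ugen r b hb) = f b :=
  (UEA.lift_ι (L := kPlus r) (suppMap (isSubalgebra_ix r) f)
    (fun hx hy => suppMap_mul (isSubalgebra_ix r) f hf hx hy) _).trans
    (suppMap_suppOf (isSubalgebra_ix r) f b hb)

include h_mul h_one h_mul_ξ h_ξ_ξ in
theorem ueaLift_eq_zero {x : UEA (kPlus r)} (hx : x ∈ leftIdeal r) : ueaLift r f hf x = 0 := by
  induction hx using Submodule.span_induction with
  | mem x hx =>
    cases hx with
    | mul i j hi hj => simp only [map_sub, map_mul, ueaLift_ugen, h_mul i j hi hj, sub_self]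
    | one => simp only [map_sub, map_one, ueaLift_ugen, h_one, sub_self]
    | mul_xi i hi => simp only [map_sub, map_mul, ueaLift_ugen, h_mul_ξ i hi, sub_self]
    | xi_xi => simp only [map_mul, ueaLift_ugen, h_ξ_ξ]
  | zero => exact map_zero _
  | add x y _ _ hx hy => rw [map_add, hx, hy, add_zero]
  | smul a x _ hx => rw [smul_eq_mul, map_mul, hx, mul_zero]

/-- The homomorphism on `Ū⁺` or `Ū⁺⁺` with prescribed values on the basis of `𝔨⁺ ⋉ A`. -/
def lift : Ubar r →ₐ[ℂ] B :=
  Ideal.Quotient.liftₐ (leftIdeal r) (ueaLift r f hf) fun _ hx =>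
    ueaLift_eq_zero r f hf h_mul h_one h_mul_ξ h_ξ_ξ hx

theorem lift_gen (b : Ix) (hb : b ∈ r.ix) :
    lift r f hf h_mul h_one h_mul_ξ h_ξ_ξ (gen r b hb) = f b :=
  ueaLift_ugen r f hf b hb

end Lift

variable {r : Fun}

theorem hom_ext {f g : Ubar r →ₐ[ℂ] B} (h : ∀ b hb, f (gen r b hb) = g (gen r b hb)) : f = g := by
  have h1 : f.comp (mk r) = g.comp (mk r) := by
    refine UEA.hom_ext fun x => ?_
    have : (f.comp (mk r)).toLinearMap ∘ₗ UEA.ι (kPlus r) =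
        (g.comp (mk r)).toLinearMap ∘ₗ UEA.ι (kPlus r) :=
      supp_linearMap_ext (isSubalgebra_ix r) h
    exact DFunLike.congr_fun this x
  ext x
  obtain ⟨x, rfl⟩ := mk_surjective r x
  exact DFunLike.congr_fun h1 x

/-- A subalgebra which contains the generators is everything. -/
theorem eq_top_of_gen_mem {A : Subalgebra ℂ (Ubar r)} (h : ∀ b hb, gen r b hb ∈ A) : A = ⊤ := by
  have h1 : Submodule.span ℂ (Set.range fun b : r.ix => suppOf (isSubalgebra_ix r) b.1 b.2) ≤
      (Subalgebra.toSubmodule A).comap ((mk r).toLinearMap ∘ₗ UEA.ι (kPlus r)) := by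
    refine Submodule.span_le.2 ?_
    rintro _ ⟨b, rfl⟩
    exact h b.1 b.2
  have h2 : A.comap (mk r) = ⊤ := by
    rw [eq_top_iff, ← UEA.adjoin_ι, Algebra.adjoin_le_iff]
    rintro _ ⟨x, rfl⟩
    exact h1 (by rw [span_suppOf]; trivial)
  refine Algebra.eq_top_iff.2 fun x => ?_
  obtain ⟨x, rfl⟩ := mk_surjective r x
  exact (show x ∈ A.comap (mk r) by rw [h2]; trivial)

variable (r) in
/-- The image of a basis element of `𝔨⁺ ⋉ A`, extended by zero. -/
def egen (b : Ix) : Ubar r := mk r (ContactSuper.egen r b)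

theorem egen_eq {b : Ix} (hb : b ∈ r.ix) : egen r b = gen r b hb :=
  congrArg (mk r) (ContactSuper.egen_eq hb)

theorem mk_ι (x : Finsupp.supported ℂ ℂ r.ix) :
    mk r (UEA.ι (kPlus r) (kPlusOf r x)) = Finsupp.linearCombination ℂ (egen r) x := by
  have : (mk r).toLinearMap ∘ₗ UEA.ι (kPlus r) = suppMap (isSubalgebra_ix r) (egen r) := by
    refine supp_linearMap_ext (isSubalgebra_ix r) fun b hb => ?_
    rw [suppMap_suppOf, egen_eq hb]
    rfl
  exact DFunLike.congr_fun this (kPlusOf r x)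

theorem egen_mul_egen {a b : Ix} (ha : a ∈ r.ix) (hb : b ∈ r.ix) : egen r a * egen r b =
    ((-1 : ℤˣ) ^ (a.par * b.par)) • (egen r b * egen r a) +
      Finsupp.linearCombination ℂ (egen r) (Ix.br a b) := by
  rw [egen, egen, ← map_mul, egen_mul ha hb, map_add, Units.smul_def, map_zsmul, map_mul, mk_ι]
  rfl

theorem egen_t_mul_t {i j : ℤ} (hi : i ∈ r.exps) (hj : j ∈ r.exps) :
    egen r (.t i) * egen r (.t j) = egen r (.t (i + j)) := by
  rw [egen_eq (r.t_mem hi), egen_eq (r.t_mem hj), egen_eq (r.t_mem (r.add_mem hi hj)),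
    ← sub_eq_zero, gen, gen, gen, ← map_mul, ← map_sub, mk_eq_zero]
  exact Ideal.subset_span (.mul i j hi hj)

theorem egen_t_zero : egen r (.t 0) = 1 := by
  have h0 : (0 : ℤ) ∈ r.exps := r.natCast_mem 0
  rw [egen_eq (r.t_mem h0), ← sub_eq_zero, gen, ← map_one (mk r), ← map_sub,
    mk_eq_zero]
  exact Ideal.subset_span .one

theorem egen_t_mul_ξ {i : ℤ} (hi : i ∈ r.exps) :
    egen r (.t i) * egen r (.θ 0) = egen r (.θ i) := by
  have h0 : (0 : ℤ) ∈ r.exps := r.natCast_mem 0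
  rw [egen_eq (r.t_mem hi), egen_eq (r.θ_mem hi), egen_eq (r.θ_mem h0),
    ← sub_eq_zero, gen, gen, gen, ← map_mul, ← map_sub, mk_eq_zero]
  exact Ideal.subset_span (.mul_xi i hi)

theorem egen_ξ_mul_ξ : egen r (.θ 0) * egen r (.θ 0) = 0 := by
  have h0 : (0 : ℤ) ∈ r.exps := r.natCast_mem 0
  rw [egen_eq (r.θ_mem h0), gen, ← map_mul, mk_eq_zero]
  exact Ideal.subset_span .xi_xi

variable (r)

theorem t_eq (k : ℕ) : t r k = egen r (.t k) := (egen_eq _).symm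

theorem θ_eq (k : ℕ) : θ r k = egen r (.θ k) := (egen_eq _).symm

theorem L_eq (k : ℕ) : L r k = egen r (.L ((k : ℤ) - 1)) := (egen_eq _).symm

theorem G_eq (k : ℕ) : G r k = egen r (.G k) := (egen_eq _).symm

theorem t_eq_pow (k : ℕ) : t r k = t r 1 ^ k := by
  induction k with
  | zero => rw [t_eq, pow_zero]; exact egen_t_zero
  | succ k ih =>
    rw [pow_succ, ← ih, t_eq, t_eq, t_eq, egen_t_mul_t (r.natCast_mem k) (r.natCast_mem 1)]
    congr 1

theorem θ_eq_mul (k : ℕ) : θ r k = t r 1 ^ k * θ r 0 := by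
  rw [← t_eq_pow, θ_eq, θ_eq, t_eq]
  exact (egen_t_mul_ξ (r.natCast_mem k)).symm

theorem nsRelations : NSRelations (t r 1) (θ r 0) (L r) (G r) := by
  have hL : ∀ k : ℕ, Ix.L ((k : ℤ) - 1) ∈ r.ix := fun k => r.L_mem (by omega)
  have hG : ∀ k : ℕ, Ix.G k ∈ r.ix := fun k => r.G_mem (Int.natCast_nonneg k)
  have ht : ∀ k : ℕ, Ix.t k ∈ r.ix := fun k => r.t_mem (r.natCast_mem k)
  have hθ : ∀ k : ℕ, Ix.θ k ∈ r.ix := fun k => r.θ_mem (r.natCast_mem k)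
  -- exponents which differ by truncation only occur with the coefficient zero
  have sub : ∀ {M : Type} [AddCommGroup M] [Module ℂ M] (c : ℂ) (x y : M), (c ≠ 0 → x = y) →
      c • x = c • y := by
    intro M _ _ c x y h
    by_cases hc : c = 0
    · rw [hc, zero_smul, zero_smul]
    · rw [h hc]
  constructor
  · rw [θ_eq, t_eq, egen_mul_egen (hθ 0) (ht 1)]
    simp [Ix.par, Ix.br]
  · rw [θ_eq]; exact egen_ξ_mul_ξ
  · intro i
    rw [← t_eq_pow, t_eq, t_eq, L_eq, egen_mul_egen (hL i) (ht 1)]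
    simp [Ix.par, Ix.br]
  · intro i
    rw [← t_eq_pow, L_eq, θ_eq, egen_mul_egen (hL i) (hθ 0)]
    simp only [Ix.par, Ix.br, zero_mul, uzpow_zero, one_smul, Finsupp.linearCombination_single]
    congr 1
    rcases i with - | i
    · simp
    · have := egen_t_mul_ξ (r.natCast_mem i)
      simp [t_eq, this]
  · intro i
    rw [← θ_eq_mul, t_eq, G_eq, θ_eq, egen_mul_egen (hG i) (ht 1)]
    simp [Ix.par, Ix.br]
  · intro i
    rw [← t_eq_pow, G_eq, θ_eq, t_eq, egen_mul_egen (hG i) (hθ 0)]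
    simp [Ix.par, Ix.br, Units.smul_def, sub_eq_add_neg]
  · intro i j
    rw [L_eq, L_eq, L_eq, egen_mul_egen (hL i) (hL j)]
    simp only [Ix.par, Ix.br, zero_mul, uzpow_zero, one_smul, Finsupp.linearCombination_single]
    congr 1
    push_cast
    rw [sub_sub_sub_cancel_right]
    refine sub _ _ _ fun h => ?_
    have : ¬ (i = 0 ∧ j = 0) := by rintro ⟨rfl, rfl⟩; simp at h
    congr 2
    omega
  · intro i j
    rw [L_eq, G_eq, G_eq, egen_mul_egen (hL i) (hG j)]
    simp only [Ix.par, Ix.br, zero_mul, uzpow_zero, one_smul, Finsupp.linearCombination_single]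
    congr 1
    push_cast
    rw [show (j : ℂ) - 1 / 2 - ((i : ℂ) - 1) / 2 = (j : ℂ) - i / 2 by ring]
    refine sub _ _ _ fun h => ?_
    have : ¬ (i = 0 ∧ j = 0) := by rintro ⟨rfl, rfl⟩; simp at h
    congr 2
    omega
  · intro i j
    rw [L_eq, G_eq, G_eq, egen_mul_egen (hG i) (hG j)]
    simp [Ix.par, Ix.br, Units.smul_def, sub_eq_add_neg]

end Ubar

/-! ### Homomorphisms from the fields -/

/-- Leibniz' rule for the derivation `[x, ·]` and the integral powers of a unit. -/
theorem mul_zpow_of_commute {x c : B} {u : Bˣ} (h : x * u = u * x + c) (hc : c * u = u * c)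
    (k : ℤ) : x * ↑(u ^ k) = ↑(u ^ k) * x + (k : ℂ) • (↑(u ^ (k - 1)) * c) := by
  have hc' : c * ↑u⁻¹ = ↑u⁻¹ * c := ((show Commute c u from hc).units_inv_right).eq
  have h' : x * ↑u⁻¹ = ↑u⁻¹ * x - ↑u⁻¹ * (↑u⁻¹ * c) := by
    have h1 : x = u * (x * ↑u⁻¹) + ↑u⁻¹ * c := by
      have := congrArg (· * (↑u⁻¹ : B)) h
      simpa only [add_mul, mul_assoc, Units.mul_inv, mul_one, hc'] using this
    calc x * ↑u⁻¹ = ↑u⁻¹ * (u * (x * ↑u⁻¹) + ↑u⁻¹ * c) - ↑u⁻¹ * (↑u⁻¹ * c) := by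
          rw [mul_add, add_sub_cancel_right, Units.inv_mul_cancel_left]
      _ = _ := by rw [← h1]
  induction k using Int.induction_on with
  | zero => simp
  | succ k ih =>
    have e : (↑(u ^ (k : ℤ)) : B) = ↑(u ^ ((k : ℤ) - 1)) * u := by
      rw [← Units.val_mul, ← zpow_add_one, sub_add_cancel]
    rw [zpow_add_one, Units.val_mul, ← mul_assoc, ih, add_sub_cancel_right, e]
    simp only [add_mul, mul_add, mul_assoc, h, smul_mul_assoc, hc]
    push_cast
    module
  | pred k ih =>
    rw [zpow_sub_one u (-(k : ℤ) - 1), zpow_sub_one] at *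
    simp only [Units.val_mul, mul_assoc] at *
    rw [← mul_assoc x, ih]
    simp only [add_mul, mul_sub, mul_assoc, h', smul_mul_assoc, hc']
    push_cast
    module

/-- The images of the basis of `𝔨⁺ ⋉ A` under the homomorphism with the values `u`, `ξ`, `L`, `G`
on `t`, `ξ`, `L_{i-1}` and `G_{i-1/2}`. -/
def nsMap (u : Bˣ) (ξ : B) (L G : ℕ → B) : Ix → B
  | .L n => L (n + 1).toNat
  | .G n => G n.toNat
  | .t k => ↑(u ^ k)
  | .θ k => ↑(u ^ k) * ξ

/-- The supercommutation relation of `b` and `a` follows from that of `a` and `b`. -/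
theorem super_relation_symm {f : Ix → B} {a b : Ix} (h : f a * f b =
      ((-1 : ℤˣ) ^ (a.par * b.par)) • (f b * f a) + Finsupp.linearCombination ℂ f (Ix.br a b)) :
    f b * f a =
      ((-1 : ℤˣ) ^ (b.par * a.par)) • (f a * f b) + Finsupp.linearCombination ℂ f (Ix.br b a) := by
  rw [h, Ix.br_skew b a, map_neg, smul_add, smul_smul, mul_comm b.par, Int.units_mul_self,
    one_smul, Units.smul_def, Units.smul_def, map_zsmul, add_neg_cancel_right]

/-- The relations between `t`, `ξ`, `L_{i-1}` and `G_{i-1/2}` imply all relations of `𝔨⁺ ⋉ A`. -/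
theorem NSRelations.nsMap_mul {u : Bˣ} {ξ : B} {L G : ℕ → B} (h : NSRelations (u : B) ξ L G) :
    ∀ a ∈ Fun.laurent.ix, ∀ b ∈ Fun.laurent.ix,
    nsMap u ξ L G a * nsMap u ξ L G b =
      ((-1 : ℤˣ) ^ (a.par * b.par)) • (nsMap u ξ L G b * nsMap u ξ L G a) +
      Finsupp.linearCombination ℂ (nsMap u ξ L G) (Ix.br a b) := by
  have ξ_u : ∀ k : ℤ, ξ * ↑(u ^ k) = ↑(u ^ k) * ξ := fun k =>
    ((show Commute ξ u from h.ξ_t).units_zpow_right k).eq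
  have L_u : ∀ i (k : ℤ), L i * ↑(u ^ k) = ↑(u ^ k) * L i + (k : ℂ) • ↑(u ^ (i + k - 1)) := by
    intro i k
    rw [mul_zpow_of_commute (h.L_t i) (pow_mul_comm' _ _), ← Units.val_pow_eq_pow_val,
      ← Units.val_mul, ← zpow_natCast, ← zpow_add,
      show k - 1 + (i : ℤ) = i + k - 1 by ring]
  have G_u : ∀ i (k : ℤ), G i * ↑(u ^ k) = ↑(u ^ k) * G i + (k : ℂ) • (↑(u ^ (i + k - 1)) * ξ) := by
    intro i k
    rw [mul_zpow_of_commute (h.G_t i) (by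
        rw [mul_assoc, h.ξ_t, ← mul_assoc, pow_mul_comm', mul_assoc]),
      ← Units.val_pow_eq_pow_val, ← mul_assoc,
      ← Units.val_mul, ← zpow_natCast, ← zpow_add,
      show k - 1 + (i : ℤ) = i + k - 1 by ring]
  have hu : ∀ j k : ℤ, (↑(u ^ j) * ↑(u ^ k) : B) = ↑(u ^ (j + k)) := fun j k => by
    rw [← Units.val_mul, ← zpow_add]
  have hu' : ∀ (j k : ℤ) (x : B), (↑(u ^ j) * (↑(u ^ k) * x) : B) = ↑(u ^ (j + k)) * x :=
    fun j k x => by rw [← mul_assoc, hu]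
  -- exponents which differ by truncation only occur with the coefficient zero
  have sub : ∀ (c : ℂ) (x y : B), (c ≠ 0 → x = y) → c • x = c • y := by
    intro c x y h
    by_cases hc : c = 0
    · rw [hc, zero_smul, zero_smul]
    · rw [h hc]
  have LL : ∀ m n : ℤ, -1 ≤ m → -1 ≤ n → L (m + 1).toNat * L (n + 1).toNat =
      L (n + 1).toNat * L (m + 1).toNat + ((n : ℂ) - m) • L (m + n + 1).toNat := by
    intro m n hm hn
    obtain ⟨i, hi⟩ := Int.eq_ofNat_of_zero_le (show 0 ≤ m + 1 by omega)
    obtain ⟨j, hj⟩ := Int.eq_ofNat_of_zero_le (show 0 ≤ n + 1 by omega)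
    obtain rfl : m = i - 1 := by omega
    obtain rfl : n = j - 1 := by omega
    simp only [sub_add_cancel, Int.toNat_natCast]
    rw [h.L_L]
    push_cast
    rw [sub_sub_sub_cancel_right]
    congr 1
    refine sub _ _ _ fun hne => ?_
    have : ¬ (i = 0 ∧ j = 0) := by rintro ⟨rfl, rfl⟩; simp at hne
    congr 1
    omega
  have LG : ∀ m n : ℤ, -1 ≤ m → 0 ≤ n → L (m + 1).toNat * G n.toNat =
      G n.toNat * L (m + 1).toNat + ((n : ℂ) - 1 / 2 - m / 2) • G (m + n).toNat := by
    intro m n hm hn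
    obtain ⟨i, hi⟩ := Int.eq_ofNat_of_zero_le (show 0 ≤ m + 1 by omega)
    obtain ⟨j, rfl⟩ := Int.eq_ofNat_of_zero_le hn
    obtain rfl : m = i - 1 := by omega
    simp only [sub_add_cancel, Int.toNat_natCast]
    rw [h.L_G]
    push_cast
    rw [show (j : ℂ) - 1 / 2 - ((i : ℂ) - 1) / 2 = (j : ℂ) - i / 2 by ring]
    congr 1
    refine sub _ _ _ fun hne => ?_
    have : ¬ (i = 0 ∧ j = 0) := by rintro ⟨rfl, rfl⟩; simp at hne
    congr 1
    omega
  have half : ∀ a b, a ∈ Fun.laurent.ix → b ∈ Fun.laurent.ix → (match a, b with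
      | .G _, .L _ => False
      | .t _, .L _ => False
      | .t _, .G _ => False
      | .θ _, .L _ => False
      | .θ _, .G _ => False
      | _, _ => True) → nsMap u ξ L G a * nsMap u ξ L G b =
      ((-1 : ℤˣ) ^ (a.par * b.par)) • (nsMap u ξ L G b * nsMap u ξ L G a) +
      Finsupp.linearCombination ℂ (nsMap u ξ L G) (Ix.br a b) := by
    intro a b ha hb hab
    cases a with
    | L m =>
      have hm : -1 ≤ m := ha
      cases b with
      | L n =>
        simp only [Ix.par, Ix.br, nsMap, Finsupp.linearCombination_single, mul_zero, uzpow_zero,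
          one_smul]
        exact LL m n hm hb
      | G n =>
        simp only [Ix.par, Ix.br, nsMap, Finsupp.linearCombination_single, zero_mul, uzpow_zero,
          one_smul]
        exact LG m n hm hb
      | t k =>
        simp only [Ix.par, Ix.br, nsMap, Finsupp.linearCombination_single, L_u, mul_zero,
          uzpow_zero, one_smul, Int.toNat_of_nonneg (show 0 ≤ m + 1 by omega)]
        congr 4
        ring
      | θ k =>
        obtain ⟨i, hi⟩ := Int.eq_ofNat_of_zero_le (show 0 ≤ m + 1 by omega)
        obtain rfl : m = i - 1 := by omega
        simp only [Ix.par, Ix.br, nsMap, Finsupp.linearCombination_single, zero_mul,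
          uzpow_zero, one_smul, sub_add_cancel, Int.toNat_natCast]
        have e : (↑(u ^ k) : B) * ((i : ℂ) / 2) • ((u : B) ^ (i - 1) * ξ) =
            ((i : ℂ) / 2) • (↑(u ^ ((i : ℤ) + k - 1)) * ξ) := by
          rcases i with - | i
          · simp
          · rw [add_tsub_cancel_right, mul_smul_comm, ← mul_assoc, ← Units.val_pow_eq_pow_val,
              ← zpow_natCast, hu, show ((i + 1 : ℕ) : ℤ) + k - 1 = k + i by push_cast; ring]
        rw [← mul_assoc, L_u, add_mul, mul_assoc, h.L_ξ, mul_add, smul_mul_assoc, e, add_assoc,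
          ← add_smul, mul_assoc, show (i : ℤ) - 1 + k = i + k - 1 by ring]
        congr 2
        push_cast
        ring
    | G m =>
      have hm : 0 ≤ m := ha
      cases b with
      | L n => exact hab.elim
      | G n =>
        obtain ⟨i, rfl⟩ := Int.eq_ofNat_of_zero_le hm
        obtain ⟨j, rfl⟩ := Int.eq_ofNat_of_zero_le (show 0 ≤ n from hb)
        simp only [Ix.par, Ix.br, nsMap, Finsupp.linearCombination_single, mul_one,
          uzpow_one, Units.smul_def, Units.val_neg, Units.val_one, neg_smul, one_smul, 
          Int.toNat_natCast, h.G_G i j, sub_add_cancel]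
        rw [sub_eq_add_neg]
        norm_cast
      | t k =>
        simp only [Ix.par, Ix.br, nsMap, Finsupp.linearCombination_single, G_u, mul_zero,
          uzpow_zero, one_smul, Int.toNat_of_nonneg hm]
      | θ k =>
        obtain ⟨i, rfl⟩ := Int.eq_ofNat_of_zero_le hm
        simp only [Ix.par, Ix.br, nsMap, Finsupp.linearCombination_single, mul_one,
          uzpow_one, Units.smul_def, Units.val_neg, Units.val_one, neg_smul, one_smul, 
          Int.toNat_natCast]
        rw [← mul_assoc, G_u, add_mul, mul_assoc, h.G_ξ, smul_mul_assoc, mul_assoc, h.ξ_ξ, mul_zero,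
          smul_zero, add_zero, mul_sub, mul_neg, mul_assoc, ← Units.val_pow_eq_pow_val,
          ← zpow_natCast, hu, add_comm k, sub_eq_add_neg]
    | t j =>
      cases b with
      | L n => exact hab.elim
      | G n => exact hab.elim
      | t k => simp [Ix.par, Ix.br, nsMap, hu, add_comm]
      | θ k => simp [Ix.par, Ix.br, nsMap, hu', mul_assoc, ξ_u, add_comm]
    | θ j =>
      cases b with
      | L n => exact hab.elim
      | G n => exact hab.elim
      | t k => simp [Ix.par, Ix.br, nsMap, hu', mul_assoc, ξ_u, add_comm]
      | θ k =>
        have e : ∀ x : ℤ, ξ * (↑(u ^ x) * ξ) = 0 := fun x => by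
          rw [← mul_assoc, ξ_u, mul_assoc, h.ξ_ξ, mul_zero]
        simp [Ix.par, Ix.br, nsMap, mul_assoc, e]
  intro a ha b hb
  cases a <;> cases b <;> first
    | exact half _ _ ha hb trivial
    | exact super_relation_symm (half _ _ hb ha trivial)

/-! ### The Weyl superalgebra by generators and relations -/

namespace Weyl

/-- The defining relations of the Weyl superalgebra, for elements of an algebra. -/
structure Relations (t ξ dt dξ : B) : Prop where
  ξ_t : ξ * t = t * ξ
  ξ_ξ : ξ * ξ = 0
  dt_t : dt * t = t * dt + 1
  dt_ξ : dt * ξ = ξ * dt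
  dξ_t : dξ * t = t * dξ
  dξ_ξ : dξ * ξ = -(ξ * dξ) + 1
  dt_dξ : dt * dξ = dξ * dt
  dξ_dξ : dξ * dξ = 0

/-- The values of a homomorphism on the generators of the Weyl superalgebra. -/
def genVal (u : Bˣ) (ξ dt dξ : B) : WeylGen → B
  | .t => u
  | .tinv => ↑u⁻¹
  | .ξ => ξ
  | .dt => dt
  | .dξ => dξ

theorem Relations.lift_rel {u : Bˣ} {ξ dt dξ : B} (h : Relations (u : B) ξ dt dξ)
    ⦃a b : FreeAlgebra ℂ WeylGen⦄ (hab : Rel a b) :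
    FreeAlgebra.lift ℂ (genVal u ξ dt dξ) a = FreeAlgebra.lift ℂ (genVal u ξ dt dξ) b := by
  obtain ⟨h1, h2, h3, h4, h5, h6, h7, h8⟩ := h
  cases hab <;> simp [genVal, *]

/-- The homomorphism on the Weyl superalgebra with prescribed values on the generators. -/
def lift {u : Bˣ} {ξ dt dξ : B} (h : Relations (u : B) ξ dt dξ) : Weyl →ₐ[ℂ] B :=
  RingQuot.liftAlgHom ℂ ⟨FreeAlgebra.lift ℂ (genVal u ξ dt dξ), h.lift_rel⟩

theorem lift_gen {u : Bˣ} {ξ dt dξ : B} (h : Relations (u : B) ξ dt dξ) (x : WeylGen) :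
    lift h (gen x) = genVal u ξ dt dξ x :=
  (RingQuot.liftAlgHom_mkAlgHom_apply ℂ (FreeAlgebra.lift ℂ (genVal u ξ dt dξ)) h.lift_rel _).trans
    (FreeAlgebra.lift_ι_apply _ _)

theorem t_tinv : gen .t * gen .tinv = 1 := by
  simpa only [gen, map_mul, map_one] using mk_rel .t_tinv

theorem tinv_t : gen .tinv * gen .t = 1 := by
  simpa only [gen, map_mul, map_one] using mk_rel .tinv_t

theorem ξ_t : gen .ξ * gen .t = gen .t * gen .ξ := by
  simpa only [gen, map_mul] using mk_rel .ξ_t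

theorem ξ_ξ : gen .ξ * gen .ξ = 0 := by
  simpa only [gen, map_mul, map_zero] using mk_rel .ξ_ξ

theorem dt_t : gen .dt * gen .t = gen .t * gen .dt + 1 := by
  simpa only [gen, map_mul, map_add, map_one] using mk_rel .dt_t

theorem dt_ξ : gen .dt * gen .ξ = gen .ξ * gen .dt := by
  simpa only [gen, map_mul] using mk_rel .dt_ξ

theorem dξ_t : gen .dξ * gen .t = gen .t * gen .dξ := by
  simpa only [gen, map_mul] using mk_rel .dξ_t

theorem dξ_ξ : gen .dξ * gen .ξ = -(gen .ξ * gen .dξ) + 1 := by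
  simpa only [gen, map_mul, map_add, map_neg, map_one] using mk_rel .dξ_ξ

theorem dt_dξ : gen .dt * gen .dξ = gen .dξ * gen .dt := by
  simpa only [gen, map_mul] using mk_rel .dt_dξ

theorem dξ_dξ : gen .dξ * gen .dξ = 0 := by
  simpa only [gen, map_mul, map_zero] using mk_rel .dξ_dξ

/-- The element `t` of the Weyl superalgebra, as a unit. -/
def tUnit : Weylˣ := ⟨gen .t, gen .tinv, t_tinv, tinv_t⟩

theorem gen_mem (x : WeylGen) : gen x ∈ parity (genPar x) := sigma_gen x

end Weyl

/-! ### The enveloping algebra of a subalgebra spanned by basis elements -/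

section Supported

variable {S : Set Ix} (hS : kTilde.IsSubalgebra (Finsupp.supported ℂ ℂ S))

/-- The image in the enveloping algebra of a basis element `b ∈ S`, extended by zero. -/
def suppGen (b : Ix) : UEA hS.toLieSuperalgebra := by
  classical exact if h : b ∈ S then UEA.ι hS.toLieSuperalgebra (suppOf hS b h) else 0

theorem suppGen_eq {b : Ix} (hb : b ∈ S) :
    suppGen hS b = UEA.ι hS.toLieSuperalgebra (suppOf hS b hb) := by
  rw [suppGen, dif_pos hb]

theorem ι_eq_suppMap : UEA.ι hS.toLieSuperalgebra = suppMap hS (suppGen hS) := by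
  refine supp_linearMap_ext hS fun b hb => ?_
  rw [suppMap_suppOf, suppGen_eq]

theorem suppOf_mem {b : Ix} (hb : b ∈ S) : suppOf hS b hb ∈ hS.toLieSuperalgebra.parity b.par :=
  Finsupp.single_mem_supported ℂ (s := {a : Ix | a.par = b.par}) (1 : ℂ) rfl

theorem suppMap_bracket {M : Type*} [AddCommGroup M] [Module ℂ M] (f : Ix → M) {a b : Ix}
    (ha : a ∈ S) (hb : b ∈ S) :
    suppMap hS f (hS.toLieSuperalgebra.bracket (suppOf hS a ha) (suppOf hS b hb)) =
      Finsupp.linearCombination ℂ f (Ix.br a b) := by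
  have : Ix.bracket (Finsupp.single a 1) (Finsupp.single b 1) = Ix.br a b := by
    rw [Ix.bracket_single, mul_one, one_smul]
  exact congrArg (Finsupp.linearCombination ℂ f) this

theorem UEA.ι_mem_parity {L : LieSuperalgebra} {i : ZMod 2} {x : L} (hx : x ∈ L.parity i) :
    UEA.ι L x ∈ UEA.parity L i := by
  show UEA.sigma L (UEA.ι L x) = _
  rw [UEA.sigma_ι, L.sigma_of_mem hx, Units.smul_def, Units.smul_def, map_zsmul]

theorem suppGen_mem {b : Ix} (hb : b ∈ S) :
    suppGen hS b ∈ UEA.parity hS.toLieSuperalgebra b.par := by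
  rw [suppGen_eq hS hb]
  exact UEA.ι_mem_parity (suppOf_mem hS hb)

theorem suppGen_mul {a b : Ix} (ha : a ∈ S) (hb : b ∈ S) : suppGen hS a * suppGen hS b =
    ((-1 : ℤˣ) ^ (a.par * b.par)) • (suppGen hS b * suppGen hS a) +
      Finsupp.linearCombination ℂ (suppGen hS) (Ix.br a b) := by
  rw [← suppMap_bracket hS _ ha hb, ← ι_eq_suppMap, suppGen_eq hS ha, suppGen_eq hS hb]
  exact UEA.ι_mul_ι (suppOf_mem hS ha) (suppOf_mem hS hb)

theorem map_suppGen_mul (F : UEA hS.toLieSuperalgebra →ₐ[ℂ] B) {a b : Ix} (ha : a ∈ S)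
    (hb : b ∈ S) : F (suppGen hS a) * F (suppGen hS b) =
    ((-1 : ℤˣ) ^ (a.par * b.par)) • (F (suppGen hS b) * F (suppGen hS a)) +
      Finsupp.linearCombination ℂ (fun c => F (suppGen hS c)) (Ix.br a b) := by
  rw [← map_mul, suppGen_mul hS ha hb, map_add, Units.smul_def, map_zsmul, map_mul,
    Units.smul_def]
  congr 1
  exact Finsupp.apply_linearCombination ℂ F.toLinearMap _ _

end Supported

/-! ### The homomorphism `Ū⁺ → 𝒦 ⊗ U(𝔨_{≥ 0})` -/

/-- The sequence `∂_t, L_0, L_1, …` -/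
def seqℓ (dt : B) (n : Ix → B) : ℕ → B
  | 0 => dt
  | k + 1 => n (.L k)

/-- The sequence `-(∂_ξ + ξ ∂_t), G_{1/2}, G_{3/2}, …` -/
def seqg (ξ dt dξ : B) (n : Ix → B) : ℕ → B
  | 0 => -(dξ + ξ * dt)
  | k + 1 => n (.G ((k : ℤ) + 1))

/-- Supercommuting homomorphisms on `𝒦` and on `𝔨_{≥ 0}` give a solution of the split relations. -/
theorem splitRelations_of_supercommute (κ : Weyl →ₐ[ℂ] B) (n : Ix → B)
    (hn : ∀ a ∈ Ix.geZero, ∀ b ∈ Ix.geZero, n a * n b =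
      ((-1 : ℤˣ) ^ (a.par * b.par)) • (n b * n a) + Finsupp.linearCombination ℂ n (Ix.br a b))
    (hc : ∀ x, ∀ b ∈ Ix.geZero, n b * κ (.gen x) =
      ((-1 : ℤˣ) ^ (b.par * Weyl.genPar x)) • (κ (.gen x) * n b)) :
    SplitRelations (κ (.gen .t)) (κ (.gen .ξ)) (seqℓ (κ (.gen .dt)) n)
      (seqg (κ (.gen .ξ)) (κ (.gen .dt)) (κ (.gen .dξ)) n) := by
  have ξ_t := congrArg κ Weyl.ξ_t
  have ξ_ξ := congrArg κ Weyl.ξ_ξ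
  have dt_t := congrArg κ Weyl.dt_t
  have dt_ξ := congrArg κ Weyl.dt_ξ
  have dξ_t := congrArg κ Weyl.dξ_t
  have dξ_ξ := congrArg κ Weyl.dξ_ξ
  have dt_dξ := congrArg κ Weyl.dt_dξ
  have dξ_dξ := congrArg κ Weyl.dξ_dξ
  simp only [map_mul, map_add, map_neg, map_one, map_zero] at *
  have hL : ∀ k : ℕ, Ix.L k ∈ Ix.geZero := fun k => Int.natCast_nonneg k
  have hG : ∀ k : ℕ, Ix.G ((k : ℤ) + 1) ∈ Ix.geZero := fun k => by
    show (1 : ℤ) ≤ k + 1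
    omega
  have L_e : ∀ (k : ℕ) x, Weyl.genPar x = 0 → n (.L k) * κ (.gen x) = κ (.gen x) * n (.L k) := by
    intro k x hx
    rw [hc x _ (hL k), hx, mul_zero, uzpow_zero, one_smul]
  have L_o : ∀ (k : ℕ) x, n (.L k) * κ (.gen x) = κ (.gen x) * n (.L k) := by
    intro k x
    rw [hc x _ (hL k), Ix.par, zero_mul, uzpow_zero, one_smul]
  have G_e : ∀ (k : ℕ) x, Weyl.genPar x = 0 →
      n (.G ((k : ℤ) + 1)) * κ (.gen x) = κ (.gen x) * n (.G ((k : ℤ) + 1)) := by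
    intro k x hx
    rw [hc x _ (hG k), hx, mul_zero, uzpow_zero, one_smul]
  have G_o : ∀ (k : ℕ) x, Weyl.genPar x = 1 →
      n (.G ((k : ℤ) + 1)) * κ (.gen x) = -(κ (.gen x) * n (.G ((k : ℤ) + 1))) := by
    intro k x hx
    rw [hc x _ (hG k), hx, Ix.par, mul_one, uzpow_one, Units.smul_def, Units.val_neg, Units.val_one,
      neg_smul, one_smul]
  have X_X : ∀ x, κ (.gen .ξ) * (κ (.gen .ξ) * x) = 0 := fun x => by
    rw [← mul_assoc, ξ_ξ, zero_mul]
  have D_X : ∀ x, κ (.gen .dt) * (κ (.gen .ξ) * x) = κ (.gen .ξ) * (κ (.gen .dt) * x) := fun x => by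
    rw [← mul_assoc, dt_ξ, mul_assoc]
  have E_X : ∀ x, κ (.gen .dξ) * (κ (.gen .ξ) * x) =
      -(κ (.gen .ξ) * (κ (.gen .dξ) * x)) + x := fun x => by
    rw [← mul_assoc, dξ_ξ, add_mul, neg_mul, mul_assoc, one_mul]
  have X_T : ∀ x, κ (.gen .ξ) * (κ (.gen .t) * x) = κ (.gen .t) * (κ (.gen .ξ) * x) := fun x => by
    rw [← mul_assoc, ξ_t, mul_assoc]
  refine
    { ξ_t := ξ_t, ξ_ξ := ξ_ξ, ℓ_t := ?_, ℓ_ξ := ?_, g_t := ?_, g_ξ := ?_, ℓ_zero_ℓ := ?_, ℓ_ℓ := ?_,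
      ℓ_zero_g := ?_, ℓ_g_zero := ?_, ℓ_g := ?_, g_zero_g_zero := ?_, g_zero_g := ?_, g_g := ?_ }
  · rintro (- | k)
    · simp [seqℓ, dt_t]
    · simp [seqℓ, L_o]
  · rintro (- | k)
    · exact dt_ξ
    · exact L_o k _
  · rintro (- | k)
    · simp only [seqg, pow_zero, one_smul, neg_mul, add_mul, mul_assoc, dξ_t, dt_t, mul_add, X_T,
        mul_one, mul_neg]
      abel
    · simp [seqg, G_e k .t rfl]
  · rintro (- | k)
    · simp only [seqg, pow_zero, one_smul, neg_mul, add_mul, mul_assoc, dξ_ξ, dt_ξ, mul_add, X_X,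
        mul_neg]
      abel
    · simp [seqg, G_o k .ξ rfl]
  · rintro (- | k)
    · rfl
    · exact (L_o k _).symm
  · intro j k
    have := hn _ (hL j) _ (hL k)
    simpa only [seqℓ, Ix.par, Ix.br, zero_mul, uzpow_zero, one_smul,
      Finsupp.linearCombination_single, Nat.cast_add, Int.cast_natCast] using this
  · rintro (- | k)
    · simp only [seqℓ, seqg, mul_neg, neg_mul, mul_add, add_mul, D_X, mul_assoc, dt_dξ]
    · exact (G_e k _ rfl).symm
  · rintro (- | k)
    · simp only [seqℓ, seqg, mul_neg, neg_mul, mul_add, add_mul, D_X, mul_assoc, dt_dξ]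
    · simp only [seqℓ, seqg, mul_neg, neg_mul, mul_add, add_mul, mul_assoc, L_o]
      rw [← mul_assoc, L_o, mul_assoc, L_o]
  · intro j k
    have := hn _ (hL j) _ (hG k)
    simp only [Ix.par, Ix.br, zero_mul, uzpow_zero, one_smul,
      Finsupp.linearCombination_single] at this
    simp only [seqℓ, seqg, this]
    rw [← add_assoc]
    push_cast
    congr 2
    ring
  · simp only [seqℓ, seqg, mul_neg, neg_mul, mul_add, add_mul, mul_assoc, dξ_dξ, E_X, D_X,
      dt_dξ, X_X]
    abel
  · intro k
    simp only [seqg, mul_neg, neg_mul, mul_add, add_mul, mul_assoc, G_o k .dξ rfl]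
    rw [← mul_assoc (n _), G_o k .ξ rfl, neg_mul, mul_assoc, G_e k .dt rfl]
    abel
  · intro j k
    have := hn _ (hG j) _ (hG k)
    simp only [Ix.par, Ix.br, mul_one, uzpow_one, Units.smul_def, Units.val_neg, Units.val_one,
      neg_smul, one_smul, Finsupp.linearCombination_single] at this
    simp only [seqℓ, seqg, this, sub_eq_add_neg]
    push_cast
    rw [show (j : ℤ) + 1 + (k + 1) + -1 = j + k + 1 by ring]

/-- The algebra `𝒦 ⊗ U(𝔨_{≥ 0})`. -/
abbrev SplitAlgebra : Type := Weyl.parity ᵍ⊗[ℂ] UEA.parity kGeZero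

/-- The elements of `𝔨_{≥ 0}`, in `𝒦 ⊗ U(𝔨_{≥ 0})`. -/
def splitGen (b : Ix) : SplitAlgebra :=
  GradedTensorProduct.includeRight Weyl.parity (UEA.parity kGeZero) (suppGen isSubalgebra_geZero b)

theorem splitRelations_splitAlgebra :
    SplitRelations (GradedTensorProduct.includeLeft Weyl.parity (UEA.parity kGeZero) (.gen .t))
      (GradedTensorProduct.includeLeft Weyl.parity (UEA.parity kGeZero) (.gen .ξ))
      (seqℓ (GradedTensorProduct.includeLeft Weyl.parity (UEA.parity kGeZero) (.gen .dt)) splitGen)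
      (seqg (GradedTensorProduct.includeLeft Weyl.parity (UEA.parity kGeZero) (.gen .ξ))
        (GradedTensorProduct.includeLeft Weyl.parity (UEA.parity kGeZero) (.gen .dt))
        (GradedTensorProduct.includeLeft Weyl.parity (UEA.parity kGeZero) (.gen .dξ))
        splitGen) := by
  refine splitRelations_of_supercommute _ splitGen (fun a ha b hb => ?_) fun x b hb => ?_
  · exact map_suppGen_mul isSubalgebra_geZero
      (GradedTensorProduct.includeRight Weyl.parity (UEA.parity kGeZero)) ha hb
  · have h1 := GradedTensorProduct.tmul_coe_mul_coe_tmul (R := ℂ) Weyl.parity (UEA.parity kGeZero) 1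
      ⟨_, suppGen_mem isSubalgebra_geZero hb⟩ ⟨_, Weyl.gen_mem x⟩ 1
    have h2 := GradedTensorProduct.tmul_one_mul_one_tmul (R := ℂ) Weyl.parity (UEA.parity kGeZero)
      (.gen x) (suppGen isSubalgebra_geZero b)
    rw [one_mul, mul_one] at h1
    exact h1.trans (congrArg _ h2.symm)

/-! ### Supercommuting homomorphisms -/

theorem Weyl.induction {p : Weyl → Prop} (hc : ∀ c : ℂ, p (algebraMap ℂ Weyl c))
    (hg : ∀ x, p (.gen x)) (hm : ∀ a b, p a → p b → p (a * b)) (ha : ∀ a b, p a → p b → p (a + b))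
    (x : Weyl) : p x := by
  obtain ⟨x, rfl⟩ := RingQuot.mkAlgHom_surjective ℂ Weyl.Rel x
  change p (Weyl.mk x)
  induction x using FreeAlgebra.induction with
  | grade0 c => rw [AlgHom.commutes]; exact hc c
  | grade1 x => exact hg x
  | mul a b h h' => rw [map_mul]; exact hm _ _ h h'
  | add a b h h' => rw [map_add]; exact ha _ _ h h'

/-- Supercommutation has only to be checked on generators. -/
theorem supercommute_of_generators {L : LieSuperalgebra} (f : Weyl →ₐ[ℂ] B) (g : UEA L →ₐ[ℂ] B)
    (h0 : ∀ x, Weyl.genPar x = 0 → ∀ y, f (.gen x) * g (UEA.ι L y) = g (UEA.ι L y) * f (.gen x))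
    (h1 : ∀ x, Weyl.genPar x = 1 → ∀ y, f (.gen x) * g (UEA.ι L y) =
      g (UEA.ι L (L.sigma y)) * f (.gen x))
    ⦃i j : ZMod 2⦄ (a : Weyl.parity i) (b : UEA.parity L j) :
    f a * g b = (-1 : ℤˣ) ^ (j * i) • (g b * f a) := by
  have step : ∀ (c : B) (τ : UEA L →ₐ[ℂ] UEA L),
      (∀ y, c * g (UEA.ι L y) = g (τ (UEA.ι L y)) * c) → ∀ y, c * g y = g (τ y) * c := by
    intro c τ h y
    have hy : y ∈ Algebra.adjoin ℂ (Set.range (UEA.ι L)) := by rw [UEA.adjoin_ι]; trivial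
    induction hy using Algebra.adjoin_induction with
    | mem x hx => obtain ⟨y, rfl⟩ := hx; exact h y
    | algebraMap r => simp only [AlgHom.commutes]; exact (Algebra.commutes r c).symm
    | add x y _ _ hx hy => simp only [map_add, mul_add, add_mul, hx, hy]
    | mul x y _ _ hx hy => rw [map_mul, ← mul_assoc, hx, mul_assoc, hy, map_mul, map_mul, mul_assoc]
  have hs : ∀ x : Weyl, (∀ y ∈ UEA.parity L 0, f x * g y = g y * f x) ∧
      ∀ y ∈ UEA.parity L 1, f x * g y = g y * f (Weyl.sigma x) := by
    intro x
    induction x using Weyl.induction with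
    | hc c =>
      simp only [AlgHom.commutes]
      exact ⟨fun y _ => Algebra.commutes c _, fun y _ => Algebra.commutes c _⟩
    | hg x =>
      rcases zmod2_cases (Weyl.genPar x) with hx | hx
      · have := step (f (.gen x)) (AlgHom.id ℂ _) (h0 x hx)
        refine ⟨fun y _ => this y, fun y _ => ?_⟩
        rw [Weyl.sigma_gen, hx, uzpow_zero, one_smul]
        exact this y
      · have := step (f (.gen x)) (UEA.sigma L) (fun y => by rw [UEA.sigma_ι]; exact h1 x hx y)
        constructor
        · intro y hy
          have hy' : UEA.sigma L y = y := Eq.trans hy (by rw [uzpow_zero, one_smul])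
          rw [this, hy']
        · intro y hy
          have hy' : UEA.sigma L y = -y := Eq.trans hy (by simp [Units.smul_def])
          rw [this, hy', Weyl.sigma_gen, hx]
          simp [Units.smul_def]
    | hm a b ha hb =>
      constructor
      · intro y hy
        rw [map_mul, mul_assoc, hb.1 y hy, ← mul_assoc, ha.1 y hy, mul_assoc]
      · intro y hy
        rw [map_mul, mul_assoc, hb.2 y hy, ← mul_assoc, ha.2 y hy, mul_assoc, map_mul, map_mul]
    | ha a b ha hb =>
      constructor
      · intro y hy
        rw [map_add, add_mul, ha.1 y hy, hb.1 y hy, mul_add]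
      · intro y hy
        rw [map_add, add_mul, ha.2 y hy, hb.2 y hy, map_add, map_add, mul_add]
  have ha : Weyl.sigma (a : Weyl) = ((-1 : ℤˣ) ^ i) • (a : Weyl) := a.2
  rcases zmod2_cases j with rfl | rfl
  · rw [(hs a).1 b b.2, zero_mul, uzpow_zero, one_smul]
  · rw [(hs a).2 b b.2, ha, one_mul, Units.smul_def, Units.smul_def, map_zsmul, mul_smul_comm]

/-! ### Homomorphisms out of `𝒦 ⊗ U(𝔨_{≥ 0})` -/

/-- The values `ℓ (n + 1)`, `g n` on the basis elements `L_n`, `G_{n-1/2}` of `𝔨_{≥ 0}`. -/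
def splitMap (ℓ g : ℕ → B) : Ix → B
  | .L n => ℓ (n.toNat + 1)
  | .G n => g n.toNat
  | .t _ => 0
  | .θ _ => 0

/-- A basis element of `𝔨_{≥ 0}`. -/
def geOf (b : Ix) (hb : b ∈ Ix.geZero) : kGeZero := suppOf isSubalgebra_geZero b hb

theorem geOf_mem (b : Ix) (hb : b ∈ Ix.geZero) : geOf b hb ∈ kGeZero.parity b.par :=
  suppOf_mem isSubalgebra_geZero hb

theorem kGeZero_linearMap_ext {M : Type*} [AddCommGroup M] [Module ℂ M] {f g : kGeZero →ₗ[ℂ] M}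
    (h : ∀ b hb, f (geOf b hb) = g (geOf b hb)) : f = g :=
  supp_linearMap_ext isSubalgebra_geZero h

theorem Ix.geZero_cases {p : Ix → Prop} (hL : ∀ k : ℕ, p (.L k))
    (hG : ∀ k : ℕ, p (.G ((k : ℤ) + 1))) : ∀ b ∈ Ix.geZero, p b := by
  intro b hb
  cases b with
  | L m =>
    obtain ⟨j, rfl⟩ := Int.eq_ofNat_of_zero_le (show 0 ≤ m from hb)
    exact hL j
  | G m =>
    obtain ⟨j, hj⟩ := Int.eq_ofNat_of_zero_le (show 0 ≤ m - 1 from sub_nonneg.2 hb)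
    obtain rfl : m = j + 1 := by omega
    exact hG j
  | t k => exact hb.elim
  | θ k => exact hb.elim

namespace SplitRelations

variable {t ξ : B} {ℓ g : ℕ → B}

/-- The elements with positive index satisfy the relations of `𝔨_{≥ 0}`. -/
theorem splitMap_mul (h : SplitRelations t ξ ℓ g) : ∀ a ∈ Ix.geZero, ∀ b ∈ Ix.geZero,
    splitMap ℓ g a * splitMap ℓ g b =
      ((-1 : ℤˣ) ^ (a.par * b.par)) • (splitMap ℓ g b * splitMap ℓ g a) +
      Finsupp.linearCombination ℂ (splitMap ℓ g) (Ix.br a b) := by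
  have LG : ∀ m n : ℤ, 0 ≤ m → 1 ≤ n → splitMap ℓ g (.L m) * splitMap ℓ g (.G n) =
      ((-1 : ℤˣ) ^ (Ix.par (.L m) * Ix.par (.G n))) • (splitMap ℓ g (.G n) * splitMap ℓ g (.L m)) +
      Finsupp.linearCombination ℂ (splitMap ℓ g) (Ix.br (.L m) (.G n)) := by
    intro m n hm hn
    obtain ⟨j, rfl⟩ := Int.eq_ofNat_of_zero_le hm
    obtain ⟨k, hk⟩ := Int.eq_ofNat_of_zero_le (show 0 ≤ n - 1 by omega)
    obtain rfl : n = k + 1 := by omega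
    simp only [Ix.par, Ix.br, splitMap, zero_mul, uzpow_zero, one_smul,
      Finsupp.linearCombination_single]
    rw [show ((k : ℤ) + 1).toNat = k + 1 by omega, Int.toNat_natCast, h.ℓ_g,
      show ((j : ℤ) + (k + 1)).toNat = j + k + 1 by omega]
    congr 2
    push_cast
    ring
  intro a ha b hb
  cases a with
  | L m =>
    cases b with
    | L n =>
      obtain ⟨j, rfl⟩ := Int.eq_ofNat_of_zero_le (show 0 ≤ m from ha)
      obtain ⟨k, rfl⟩ := Int.eq_ofNat_of_zero_le (show 0 ≤ n from hb)
      simp only [Ix.par, Ix.br, splitMap, zero_mul, uzpow_zero, one_smul,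
        Finsupp.linearCombination_single, Int.toNat_natCast, h.ℓ_ℓ j k, Int.cast_natCast]
      congr 2
    | G n => exact LG m n ha hb
    | t k => exact hb.elim
    | θ k => exact hb.elim
  | G m =>
    cases b with
    | L n => exact super_relation_symm (LG n m hb ha)
    | G n =>
      obtain ⟨j, hj⟩ := Int.eq_ofNat_of_zero_le (show 0 ≤ m - 1 from sub_nonneg.2 ha)
      obtain ⟨k, hk⟩ := Int.eq_ofNat_of_zero_le (show 0 ≤ n - 1 from sub_nonneg.2 hb)
      obtain rfl : n = k + 1 := by omega
      obtain rfl : m = j + 1 := by omega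
      simp only [Ix.par, Ix.br, splitMap, mul_one, uzpow_one, Units.smul_def, Units.val_neg,
        Units.val_one, neg_smul, one_smul, Finsupp.linearCombination_single]
      rw [show ((k : ℤ) + 1).toNat = k + 1 by omega, show ((j : ℤ) + 1).toNat = j + 1 by omega,
        h.g_g, show ((j : ℤ) + 1 + (k + 1) - 1).toNat + 1 = j + k + 2 by omega, sub_eq_add_neg]
    | t k => exact hb.elim
    | θ k => exact hb.elim
  | t k => exact ha.elim
  | θ k => exact ha.elim

/-- The homomorphism on `U(𝔨_{≥ 0})` given by the elements `ℓ (n + 1)` and `g n`. -/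
def ueaLift (h : SplitRelations t ξ ℓ g) : UEA kGeZero →ₐ[ℂ] B :=
  UEA.lift (L := kGeZero) (suppMap isSubalgebra_geZero (splitMap ℓ g))
    (fun hx hy => suppMap_mul isSubalgebra_geZero (splitMap ℓ g) h.splitMap_mul hx hy)

theorem ueaLift_ι (h : SplitRelations t ξ ℓ g) (x : kGeZero) :
    h.ueaLift (UEA.ι kGeZero x) = suppMap isSubalgebra_geZero (splitMap ℓ g) x :=
  UEA.lift_ι (L := kGeZero) (suppMap isSubalgebra_geZero (splitMap ℓ g))
    (fun hx hy => suppMap_mul isSubalgebra_geZero (splitMap ℓ g) h.splitMap_mul hx hy) x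

theorem ueaLift_geOf (h : SplitRelations t ξ ℓ g) (b : Ix) (hb : b ∈ Ix.geZero) :
    h.ueaLift (UEA.ι kGeZero (geOf b hb)) = splitMap ℓ g b :=
  (h.ueaLift_ι _).trans (suppMap_suppOf isSubalgebra_geZero _ b hb)

/-- The elements with index `0` satisfy the relations of the Weyl superalgebra. -/
theorem weylRelations (h : SplitRelations t ξ ℓ g) :
    Weyl.Relations t ξ (ℓ 0) (-g 0 - ξ * ℓ 0) := by
  have ξ_t : ∀ x, ξ * (t * x) = t * (ξ * x) := fun x => by rw [← mul_assoc, h.ξ_t, mul_assoc]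
  have ξ_ξ : ∀ x, ξ * (ξ * x) = 0 := fun x => by rw [← mul_assoc, h.ξ_ξ, zero_mul]
  have ℓ_ξ : ∀ x, ℓ 0 * (ξ * x) = ξ * (ℓ 0 * x) := fun x => by rw [← mul_assoc, h.ℓ_ξ, mul_assoc]
  have g_ξ : ∀ x, g 0 * (ξ * x) = -(ξ * (g 0 * x)) - x := fun x => by
    rw [← mul_assoc, h.g_ξ, sub_mul, neg_mul, mul_assoc, pow_zero, one_smul, one_mul]
  refine ⟨h.ξ_t, h.ξ_ξ, by simpa using h.ℓ_t 0, h.ℓ_ξ 0, ?_, ?_, ?_, ?_⟩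
  · simp only [sub_mul, neg_mul, h.g_t, pow_zero, one_smul, mul_assoc, h.ℓ_t, mul_add, mul_sub,
      ξ_t, mul_one, mul_neg]
    abel
  · simp only [sub_mul, neg_mul, h.g_ξ, pow_zero, one_smul, mul_assoc, h.ℓ_ξ, mul_sub,
      ξ_ξ, mul_neg]
    abel
  · simp only [mul_sub, sub_mul, mul_neg, neg_mul, h.ℓ_zero_g, ℓ_ξ, mul_assoc]
  · simp only [mul_sub, sub_mul, mul_neg, neg_mul, g_ξ, ℓ_ξ, mul_assoc, h.g_zero_g_zero, ξ_ξ,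
      h.ℓ_zero_g]
    abel

variable {u : Bˣ}

/-- The homomorphism on `𝒦` with `∂_t ↦ ℓ 0` and `∂_ξ ↦ -g 0 - ξ ℓ 0`. -/
def weylLift (h : SplitRelations (u : B) ξ ℓ g) : Weyl →ₐ[ℂ] B := Weyl.lift h.weylRelations

theorem weylLift_gen (h : SplitRelations (u : B) ξ ℓ g) (x : WeylGen) :
    h.weylLift (.gen x) = Weyl.genVal u ξ (ℓ 0) (-g 0 - ξ * ℓ 0) x :=
  Weyl.lift_gen _ x

theorem supercommute (h : SplitRelations (u : B) ξ ℓ g) ⦃i j : ZMod 2⦄ (a : Weyl.parity i)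
    (b : UEA.parity kGeZero j) :
    h.weylLift a * h.ueaLift b = (-1 : ℤˣ) ^ (j * i) • (h.ueaLift b * h.weylLift a) := by
  have hu : ∀ c : B, c * u = u * c → ↑u⁻¹ * c = c * ↑u⁻¹ := fun c hc =>
    ((show Commute c u from hc).units_inv_right).eq.symm
  -- both sides are linear in the element of the Lie superalgebra
  have lin : ∀ (c : B) (τ : kGeZero →ₗ[ℂ] kGeZero), (∀ b (hb : b ∈ Ix.geZero), c * splitMap ℓ g b =
      h.ueaLift (UEA.ι kGeZero (τ (geOf b hb))) * c) →
      ∀ y, c * h.ueaLift (UEA.ι kGeZero y) = h.ueaLift (UEA.ι kGeZero (τ y)) * c := by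
    intro c τ hb y
    have : LinearMap.mulLeft ℂ c ∘ₗ h.ueaLift.toLinearMap ∘ₗ UEA.ι kGeZero =
        LinearMap.mulRight ℂ c ∘ₗ h.ueaLift.toLinearMap ∘ₗ UEA.ι kGeZero ∘ₗ τ := by
      refine kGeZero_linearMap_ext fun b hb' => ?_
      refine Eq.trans ?_ (hb b hb')
      exact congrArg (c * ·) (h.ueaLift_geOf b hb')
    exact DFunLike.congr_fun this y
  have vL : ∀ k : ℕ, splitMap ℓ g (.L k) = ℓ (k + 1) := fun k => rfl
  have vG : ∀ k : ℕ, splitMap ℓ g (.G ((k : ℤ) + 1)) = g (k + 1) := fun k => rfl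
  refine supercommute_of_generators h.weylLift h.ueaLift ?_ ?_ a b
  · intro x hx
    refine lin _ LinearMap.id fun b hb => ?_
    rw [LinearMap.id_apply, h.ueaLift_geOf, weylLift_gen]
    refine Ix.geZero_cases (p := fun b =>
      Weyl.genVal u ξ (ℓ 0) (-g 0 - ξ * ℓ 0) x * splitMap ℓ g b =
      splitMap ℓ g b * Weyl.genVal u ξ (ℓ 0) (-g 0 - ξ * ℓ 0) x) ?_ ?_ b hb
    · intro k
      have e : ℓ (k + 1) * u = u * ℓ (k + 1) := by simp [h.ℓ_t]
      cases x with
      | t => exact e.symm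
      | tinv => exact hu _ e
      | dt => exact h.ℓ_zero_ℓ _
      | ξ => exact absurd hx one_ne_zero
      | dξ => exact absurd hx one_ne_zero
    · intro k
      have e : g (k + 1) * u = u * g (k + 1) := by simp [h.g_t]
      cases x with
      | t => exact e.symm
      | tinv => exact hu _ e
      | dt => exact h.ℓ_zero_g _
      | ξ => exact absurd hx one_ne_zero
      | dξ => exact absurd hx one_ne_zero
  · intro x hx
    refine lin _ kGeZero.sigma fun b hb => ?_
    rw [kGeZero.sigma_of_mem (geOf_mem b hb), Units.smul_def, map_zsmul, map_zsmul, h.ueaLift_geOf,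
      weylLift_gen]
    refine Ix.geZero_cases (p := fun b =>
      Weyl.genVal u ξ (ℓ 0) (-g 0 - ξ * ℓ 0) x * splitMap ℓ g b =
      ((((-1 : ℤˣ) ^ b.par : ℤˣ) : ℤ) • splitMap ℓ g b) *
        Weyl.genVal u ξ (ℓ 0) (-g 0 - ξ * ℓ 0) x) ?_ ?_ b hb
    · intro k
      simp only [Ix.par, uzpow_zero, Units.val_one, one_smul, vL]
      cases x with
      | t => exact absurd hx zero_ne_one
      | tinv => exact absurd hx zero_ne_one
      | dt => exact absurd hx zero_ne_one
      | ξ => exact (h.ℓ_ξ _).symm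
      | dξ =>
        simp only [Weyl.genVal, sub_mul, mul_sub, neg_mul, mul_neg, h.ℓ_g_zero, mul_assoc,
          h.ℓ_zero_ℓ]
        rw [← mul_assoc (ℓ (k + 1)), h.ℓ_ξ, mul_assoc]
    · intro k
      have eξ : g (k + 1) * ξ = -(ξ * g (k + 1)) := by simp [h.g_ξ]
      simp only [Ix.par, uzpow_one, Units.val_neg, Units.val_one, neg_smul, one_smul, vG]
      cases x with
      | t => exact absurd hx zero_ne_one
      | tinv => exact absurd hx zero_ne_one
      | dt => exact absurd hx zero_ne_one
      | ξ => simp only [Weyl.genVal, neg_mul, eξ, neg_neg]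
      | dξ =>
        simp only [Weyl.genVal, sub_mul, mul_sub, neg_mul, mul_neg, h.g_zero_g, mul_assoc,
          h.ℓ_zero_g, neg_neg]
        rw [← mul_assoc (g (k + 1)), eξ, neg_mul, mul_assoc]
        abel

/-- The homomorphism on `𝒦 ⊗ U(𝔨_{≥ 0})` given by a solution of the split relations. -/
def splitLift (h : SplitRelations (u : B) ξ ℓ g) : SplitAlgebra →ₐ[ℂ] B :=
  GradedTensorProduct.lift Weyl.parity (UEA.parity kGeZero) h.weylLift h.ueaLift h.supercommute

end SplitRelations

/-! ### Changing between the systems of generators -/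

/-- The fields `P ((x - t) ^ k)` in terms of the split generators. -/
def centredP (ξ : B) (ℓ g : ℕ → B) : ℕ → B
  | 0 => ℓ 0
  | k + 1 => ℓ (k + 1) - (((k : ℂ) + 1) / 2) • (ξ * g k)

/-- The fields `Q ((x - t) ^ k)` in terms of the split generators. -/
def centredQ (ξ : B) (ℓ g : ℕ → B) (k : ℕ) : B := g k + (2 : ℂ) • (ξ * ℓ k)

/-- The even split generators in terms of the fields centred at `x = t`. -/
def splitℓ (ξ : B) (p q : ℕ → B) : ℕ → B
  | 0 => p 0
  | k + 1 => p (k + 1) + (((k : ℂ) + 1) / 2) • (ξ * q k)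

/-- The odd split generators in terms of the fields centred at `x = t`. -/
def splitg (ξ : B) (p q : ℕ → B) (k : ℕ) : B := q k - (2 : ℂ) • (ξ * p k)

section Inverse

variable {ξ : B} (h : ξ * ξ = 0)
include h

theorem splitℓ_centred (ℓ g : ℕ → B) : splitℓ ξ (centredP ξ ℓ g) (centredQ ξ ℓ g) = ℓ := by
  ext (- | k)
  · rfl
  · simp only [splitℓ, centredP, centredQ, mul_add, mul_smul_comm]
    rw [← mul_assoc ξ ξ, h, zero_mul, smul_zero, add_zero, sub_add_cancel]

theorem splitg_centred (ℓ g : ℕ → B) : splitg ξ (centredP ξ ℓ g) (centredQ ξ ℓ g) = g := by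
  ext (- | k)
  · simp only [splitg, centredP, centredQ, add_sub_cancel_right]
  · simp only [splitg, centredP, centredQ, mul_sub, mul_smul_comm]
    rw [← mul_assoc ξ ξ, h, zero_mul, smul_zero, sub_zero, add_sub_cancel_right]

theorem centredP_split (p q : ℕ → B) : centredP ξ (splitℓ ξ p q) (splitg ξ p q) = p := by
  ext (- | k)
  · rfl
  · simp only [splitℓ, centredP, splitg, mul_sub, mul_smul_comm]
    rw [← mul_assoc ξ ξ, h, zero_mul, smul_zero, sub_zero, add_sub_cancel_right]

theorem centredQ_split (p q : ℕ → B) : centredQ ξ (splitℓ ξ p q) (splitg ξ p q) = q := by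
  ext (- | k)
  · simp only [splitℓ, centredQ, splitg, sub_add_cancel]
  · simp only [splitℓ, centredQ, splitg, mul_add, mul_smul_comm]
    rw [← mul_assoc ξ ξ, h, zero_mul, smul_zero, add_zero, sub_add_cancel]

end Inverse

/-! ### Compatibility with homomorphisms -/

section Map

variable {C : Type*} [Ring C] [Algebra ℂ C] (F : B →ₐ[ℂ] C) (ξ : B) (p q : ℕ → B)

theorem map_centredP (k : ℕ) :
    F (centredP ξ p q k) = centredP (F ξ) (fun i => F (p i)) (fun i => F (q i)) k := by
  cases k <;> simp [centredP]

theorem map_centredQ (k : ℕ) :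
    F (centredQ ξ p q k) = centredQ (F ξ) (fun i => F (p i)) (fun i => F (q i)) k := by
  simp [centredQ]

theorem map_splitℓ (k : ℕ) :
    F (splitℓ ξ p q k) = splitℓ (F ξ) (fun i => F (p i)) (fun i => F (q i)) k := by
  cases k <;> simp [splitℓ]

theorem map_splitg (k : ℕ) :
    F (splitg ξ p q k) = splitg (F ξ) (fun i => F (p i)) (fun i => F (q i)) k := by
  simp [splitg]

theorem map_polySum (t : B) (e : ℕ → B) (H : ℂ[X][X]) :
    F (polySum t e H) = polySum (F t) (fun i => F (e i)) H := by
  refine span_induction_C span_X_pow (p := fun H => F (polySum t e H) =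
    polySum (F t) (fun i => F (e i)) H) (fun i => ?_) (fun a b ha hb => ?_) (fun a H h => ?_) H
  · rw [polySum_X_pow, polySum_X_pow]
  · rw [map_add, map_add, map_add, ha, hb]
  · rw [polySum_C_mul, polySum_C_mul, map_mul, h, aeval_algHom_apply]

theorem map_centredSum (t : B) (e : ℕ → B) (H : ℂ[X][X]) :
    F (centredSum t e H) = centredSum (F t) (fun i => F (e i)) H :=
  map_polySum F t e _

end Map

/-- Expanding the fields `x ^ i` in the fields `(x - t) ^ k` and arbitrary fields in the fields
`x ^ i` amounts to expanding arbitrary fields in the fields `(x - t) ^ k`. -/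
theorem polySum_centredSum_X_pow (t : B) (e : ℕ → B) :
    polySum t (fun i => centredSum t e (X ^ i)) = centredSum t e := by
  ext1 H
  refine span_induction_C span_X_pow (p := fun H =>
    polySum t (fun i => centredSum t e (X ^ i)) H = centredSum t e H)
    (fun i => ?_) (fun a b ha hb => ?_) (fun a H h => ?_) H
  · rw [polySum_X_pow]
  · rw [map_add, map_add, ha, hb]
  · rw [polySum_C_mul, centredSum_C_mul, h]

theorem centredSum_polySum_cY_pow (t : B) (e : ℕ → B) :
    centredSum t (fun k => polySum t e (cY ^ k)) = polySum t e := by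
  ext1 H
  refine span_induction_C span_cY_pow (p := fun H =>
    centredSum t (fun k => polySum t e (cY ^ k)) H = polySum t e H)
    (fun i => ?_) (fun a b ha hb => ?_) (fun a H h => ?_) H
  · rw [centredSum_cY_pow]
  · rw [map_add, map_add, ha, hb]
  · rw [polySum_C_mul, centredSum_C_mul, h]

/-- Solutions of the split relations give solutions of the relations of `Ū⁺`. -/
theorem SplitRelations.nsRelations {t ξ : B} {ℓ g : ℕ → B} (h : SplitRelations t ξ ℓ g) :
    NSRelations t ξ (fun i => centredSum t (centredP ξ ℓ g) (X ^ i))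
      (fun i => centredSum t (centredQ ξ ℓ g) (X ^ i)) :=
  (h.centredRelations (p := centredP ξ ℓ g) (q := centredQ ξ ℓ g) rfl (fun _ => rfl)
    fun _ => rfl).contactFields.nsRelations

/-- Solutions of the relations of `Ū⁺` give solutions of the split relations. -/
theorem NSRelations.splitRelations {t ξ : B} {L G : ℕ → B} (h : NSRelations t ξ L G) :
    SplitRelations t ξ (splitℓ ξ (fun k => polySum t L (cY ^ k)) fun k => polySum t G (cY ^ k))
      (splitg ξ (fun k => polySum t L (cY ^ k)) fun k => polySum t G (cY ^ k)) :=
  h.contactFields.centredRelations.splitRelations rfl (fun _ => rfl) fun _ => rfl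

/-! ### The decomposition of `Ū⁺` -/

namespace Ubar

theorem t_mul_tinv : t .laurent 1 * tinv = 1 := by
  have := egen_t_mul_t (r := .laurent) (i := 1) (j := -1) trivial trivial
  rw [show (1 : ℤ) + -1 = 0 by ring, egen_t_zero] at this
  rw [← this, t_eq, tinv, ← egen_eq]
  rfl

theorem tinv_mul_t : tinv * t .laurent 1 = 1 := by
  have := egen_t_mul_t (r := .laurent) (i := -1) (j := 1) trivial trivial
  rw [show -1 + (1 : ℤ) = 0 by ring, egen_t_zero] at this
  rw [← this, t_eq, tinv, ← egen_eq]
  rfl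

/-- The element `t` of `Ū⁺`, as a unit. -/
def tUnit : (Ubar .laurent)ˣ := ⟨t .laurent 1, tinv, t_mul_tinv, tinv_mul_t⟩

theorem egen_t (k : ℤ) : egen .laurent (.t k) = ↑(tUnit ^ k) := by
  have h1 : egen .laurent (.t 1) = ↑tUnit := (t_eq .laurent 1).symm
  have h2 : egen .laurent (.t (-1)) = ↑tUnit⁻¹ := egen_eq (Fun.laurent.t_mem trivial)
  induction k using Int.induction_on with
  | zero => rw [zpow_zero, Units.val_one, egen_t_zero]
  | succ k ih =>
    rw [zpow_add_one, Units.val_mul, ← ih, ← h1, egen_t_mul_t (r := .laurent) trivial trivial]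
  | pred k ih =>
    rw [zpow_sub_one, Units.val_mul, ← ih, ← h2, egen_t_mul_t (r := .laurent) trivial trivial]
    rfl

/-- The homomorphism on `Ū⁺` with prescribed values on `t`, `ξ`, `L_{i-1}` and `G_{i-1/2}`. -/
def liftNS {u : Bˣ} {ξ : B} {L G : ℕ → B} (h : NSRelations (u : B) ξ L G) :
    Ubar .laurent →ₐ[ℂ] B :=
  lift .laurent (nsMap u ξ L G) h.nsMap_mul
    (fun i j _ _ => by simp only [nsMap]; rw [zpow_add, Units.val_mul])
    (by simp [nsMap]) (fun i _ => by simp [nsMap]) (by simp [nsMap, h.ξ_ξ])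

section LiftNS

variable {u : Bˣ} {ξ : B} {L G : ℕ → B} (h : NSRelations (u : B) ξ L G)

theorem liftNS_gen (b : Ix) (hb : b ∈ Fun.laurent.ix) :
    liftNS h (gen .laurent b hb) = nsMap u ξ L G b := lift_gen ..

theorem liftNS_t : liftNS h (t .laurent 1) = u := (liftNS_gen h _ _).trans (by simp [nsMap])

theorem liftNS_tinv : liftNS h tinv = ↑u⁻¹ := (liftNS_gen h _ _).trans (by simp [nsMap])

theorem liftNS_ξ : liftNS h (θ .laurent 0) = ξ := (liftNS_gen h _ _).trans (by simp [nsMap])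

theorem liftNS_L (i : ℕ) : liftNS h (Ubar.L .laurent i) = L i :=
  (liftNS_gen h _ _).trans (by simp [nsMap])

theorem liftNS_G (i : ℕ) : liftNS h (Ubar.G .laurent i) = G i :=
  (liftNS_gen h _ _).trans (by simp [nsMap])

/-- Homomorphisms on `Ū⁺` are determined by their values on `t`, `ξ`, `L_{i-1}` and `G_{i-1/2}`. -/
theorem hom_ext_ns {f g : Ubar .laurent →ₐ[ℂ] B} (ht : f (t .laurent 1) = g (t .laurent 1))
    (hξ : f (θ .laurent 0) = g (θ .laurent 0))
    (hL : ∀ i, f (Ubar.L .laurent i) = g (Ubar.L .laurent i))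
    (hG : ∀ i, f (Ubar.G .laurent i) = g (Ubar.G .laurent i)) : f = g := by
  have hu : Units.map (f : Ubar .laurent →* B) tUnit = Units.map (g : Ubar .laurent →* B) tUnit :=
    Units.ext ht
  have ht' : ∀ k : ℤ, f (egen .laurent (.t k)) = g (egen .laurent (.t k)) := by
    intro k
    have := congrArg (fun v : Bˣ => (↑(v ^ k) : B)) hu
    simp only [← map_zpow] at this
    rw [egen_t]
    exact this
  refine hom_ext fun b hb => ?_
  rw [← egen_eq]
  cases b with
  | L m =>
    obtain ⟨i, hi⟩ := Int.eq_ofNat_of_zero_le (show 0 ≤ m + 1 by have : -1 ≤ m := hb; omega)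
    obtain rfl : m = i - 1 := by omega
    rw [← L_eq]; exact hL i
  | G m =>
    obtain ⟨i, rfl⟩ := Int.eq_ofNat_of_zero_le (show 0 ≤ m from hb)
    rw [← G_eq]; exact hG i
  | t k => exact ht' k
  | θ k =>
    rw [← egen_t_mul_ξ (r := .laurent) trivial, map_mul, map_mul, ht' k]
    exact congrArg (g (egen .laurent (.t k)) * ·)
      ((congrArg f (θ_eq .laurent 0)).symm.trans (hξ.trans (congrArg g (θ_eq .laurent 0))))

end LiftNS

variable (r : Fun)

/-- The element `P ((x - t) ^ k) = ∑ (-1)^(k-i) (k choose i) t^(k-i) L_{i-1}`. -/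
def centredL (k : ℕ) : Ubar r := polySum (t r 1) (L r) (cY ^ k)

/-- The element `Q ((x - t) ^ k) = ∑ (-1)^(k-i) (k choose i) t^(k-i) G_{i-1/2}`. -/
def centredG (k : ℕ) : Ubar r := polySum (t r 1) (G r) (cY ^ k)

/-- The elements `L_{-1}` and `(-1) ^ n L'_n` for `n ≥ 0`. -/
def ℓ : ℕ → Ubar r := splitℓ (θ r 0) (centredL r) (centredG r)

/-- The elements `(-1) ^ n G'_{n-1/2}`. -/
def g : ℕ → Ubar r := splitg (θ r 0) (centredL r) (centredG r)

theorem splitRelations : SplitRelations (t r 1) (θ r 0) (ℓ r) (g r) :=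
  (nsRelations r).splitRelations

theorem splitRelations_laurent : SplitRelations (tUnit : Ubar .laurent) (θ .laurent 0)
    (ℓ .laurent) (g .laurent) := splitRelations .laurent

/-- The embedding of `𝒦` in `Ū⁺`. -/
def κ : Weyl →ₐ[ℂ] Ubar .laurent := splitRelations_laurent.weylLift

/-- The homomorphism from `U(𝔨_{≥ 0})` to `Ū⁺` or `Ū⁺⁺`. -/
def ofUEA (r : Fun) : UEA kGeZero →ₐ[ℂ] Ubar r := (splitRelations r).ueaLift

/-- The homomorphism `𝒦 ⊗ U(𝔨_{≥ 0}) → Ū⁺`. -/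
def ofSplit : SplitAlgebra →ₐ[ℂ] Ubar .laurent := splitRelations_laurent.splitLift

theorem ofSplit_tmul (x : Weyl) (y : UEA kGeZero) :
    ofSplit (x ᵍ⊗ₜ[ℂ] y) = κ x * ofUEA .laurent y := rfl

theorem κ_gen (x : WeylGen) : κ (.gen x) = Weyl.genVal tUnit (θ .laurent 0) (ℓ .laurent 0)
    (-g .laurent 0 - θ .laurent 0 * ℓ .laurent 0) x :=
  splitRelations_laurent.weylLift_gen x

theorem ofUEA_geOf (b : Ix) (hb : b ∈ Ix.geZero) :
    ofUEA r (UEA.ι kGeZero (geOf b hb)) = splitMap (ℓ r) (g r) b :=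
  (splitRelations r).ueaLift_geOf b hb

theorem ofSplit_inl (x : Weyl) :
    ofSplit (GradedTensorProduct.includeLeft Weyl.parity (UEA.parity kGeZero) x) = κ x := by
  rw [GradedTensorProduct.includeLeft_apply, ofSplit_tmul, map_one, mul_one]

theorem ofSplit_inr (y : UEA kGeZero) :
    ofSplit (GradedTensorProduct.includeRight Weyl.parity (UEA.parity kGeZero) y) =
      ofUEA .laurent y := by
  rw [GradedTensorProduct.includeRight_apply, ofSplit_tmul, map_one, one_mul]

/-- The unit `t` of `𝒦 ⊗ U(𝔨_{≥ 0})`. -/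
def splitUnit : SplitAlgebraˣ :=
  Units.map
    (GradedTensorProduct.includeLeft Weyl.parity (UEA.parity kGeZero) : Weyl →* SplitAlgebra)
    Weyl.tUnit

/-- The element `ξ` of `𝒦 ⊗ U(𝔨_{≥ 0})`. -/
def splitξ : SplitAlgebra :=
  GradedTensorProduct.includeLeft Weyl.parity (UEA.parity kGeZero) (.gen .ξ)

/-- The even split generators of `𝒦 ⊗ U(𝔨_{≥ 0})`. -/
def modelℓ : ℕ → SplitAlgebra :=
  seqℓ (GradedTensorProduct.includeLeft Weyl.parity (UEA.parity kGeZero) (.gen .dt)) splitGen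

/-- The odd split generators of `𝒦 ⊗ U(𝔨_{≥ 0})`. -/
def modelg : ℕ → SplitAlgebra :=
  seqg splitξ (GradedTensorProduct.includeLeft Weyl.parity (UEA.parity kGeZero) (.gen .dt))
    (GradedTensorProduct.includeLeft Weyl.parity (UEA.parity kGeZero) (.gen .dξ)) splitGen

theorem model_splitRelations :
    SplitRelations (splitUnit : SplitAlgebra) splitξ modelℓ modelg :=
  splitRelations_splitAlgebra

/-- The homomorphism `Ū⁺ → 𝒦 ⊗ U(𝔨_{≥ 0})`. -/
def toSplit : Ubar .laurent →ₐ[ℂ] SplitAlgebra := liftNS model_splitRelations.nsRelations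

theorem toSplit_centredL (k : ℕ) :
    toSplit (centredL .laurent k) = centredP splitξ modelℓ modelg k := by
  rw [centredL, map_polySum, toSplit, liftNS_t]
  simp only [liftNS_L]
  rw [polySum_centredSum_X_pow, centredSum_cY_pow]

theorem toSplit_centredG (k : ℕ) :
    toSplit (centredG .laurent k) = centredQ splitξ modelℓ modelg k := by
  rw [centredG, map_polySum, toSplit, liftNS_t]
  simp only [liftNS_G]
  rw [polySum_centredSum_X_pow, centredSum_cY_pow]

theorem toSplit_ℓ (k : ℕ) : toSplit (ℓ .laurent k) = modelℓ k := by
  rw [ℓ, map_splitℓ]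
  simp only [toSplit_centredL, toSplit_centredG]
  rw [toSplit, liftNS_ξ, splitℓ_centred model_splitRelations.ξ_ξ]

theorem toSplit_g (k : ℕ) : toSplit (g .laurent k) = modelg k := by
  rw [g, map_splitg]
  simp only [toSplit_centredL, toSplit_centredG]
  rw [toSplit, liftNS_ξ, splitg_centred model_splitRelations.ξ_ξ]

theorem ofSplit_splitGen {b : Ix} (hb : b ∈ Ix.geZero) :
    ofSplit (splitGen b) = splitMap (ℓ .laurent) (g .laurent) b := by
  refine (ofSplit_inr _).trans ?_
  rw [suppGen_eq _ hb]
  exact ofUEA_geOf .laurent b hb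

theorem ofSplit_modelℓ (k : ℕ) : ofSplit (modelℓ k) = ℓ .laurent k := by
  cases k with
  | zero => rw [modelℓ, seqℓ, ofSplit_inl, κ_gen]; rfl
  | succ k => rw [modelℓ, seqℓ, ofSplit_splitGen (Int.natCast_nonneg k)]; rfl

theorem ofSplit_modelg (k : ℕ) : ofSplit (modelg k) = g .laurent k := by
  cases k with
  | zero =>
    rw [modelg, seqg, map_neg, map_add, map_mul, splitξ, ofSplit_inl, ofSplit_inl, ofSplit_inl,
      κ_gen, κ_gen, κ_gen]
    simp only [Weyl.genVal]
    abel
  | succ k =>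
    rw [modelg, seqg, ofSplit_splitGen (show (1 : ℤ) ≤ k + 1 by omega)]
    rfl

theorem ofSplit_splitUnit : ofSplit (splitUnit : SplitAlgebra) = t .laurent 1 :=
  (ofSplit_inl _).trans (κ_gen .t)

theorem ofSplit_splitξ : ofSplit splitξ = θ .laurent 0 :=
  (ofSplit_inl _).trans (κ_gen .ξ)

theorem ofSplit_toSplit (x : Ubar .laurent) : ofSplit (toSplit x) = x := by
  have hℓ : (fun k => ofSplit (modelℓ k)) = ℓ .laurent := funext ofSplit_modelℓ
  have hg : (fun k => ofSplit (modelg k)) = g .laurent := funext ofSplit_modelg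
  have : ofSplit.comp toSplit = AlgHom.id ℂ _ := by
    refine hom_ext_ns ?_ ?_ (fun i => ?_) fun i => ?_
    · rw [AlgHom.comp_apply, toSplit, liftNS_t, ofSplit_splitUnit]; rfl
    · rw [AlgHom.comp_apply, toSplit, liftNS_ξ, ofSplit_splitξ]; rfl
    · rw [AlgHom.comp_apply, toSplit, liftNS_L, map_centredSum, ofSplit_splitUnit]
      simp only [map_centredP]
      rw [ofSplit_splitξ, hℓ, hg, ℓ, g, centredP_split (nsRelations .laurent).ξ_ξ]
      simp only [centredL]
      rw [centredSum_polySum_cY_pow, polySum_X_pow]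
      rfl
    · rw [AlgHom.comp_apply, toSplit, liftNS_G, map_centredSum, ofSplit_splitUnit]
      simp only [map_centredQ]
      rw [ofSplit_splitξ, hℓ, hg, ℓ, g, centredQ_split (nsRelations .laurent).ξ_ξ]
      simp only [centredG]
      rw [centredSum_polySum_cY_pow, polySum_X_pow]
      rfl
  exact DFunLike.congr_fun this x

theorem toSplit_splitMap {b : Ix} (hb : b ∈ Ix.geZero) :
    toSplit (splitMap (ℓ .laurent) (g .laurent) b) = splitGen b := by
  refine Ix.geZero_cases (p := fun b => toSplit (splitMap (ℓ .laurent) (g .laurent) b) = splitGen b)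
    (fun k => ?_) (fun k => ?_) b hb
  · exact toSplit_ℓ (k + 1)
  · exact toSplit_g (k + 1)

theorem toSplit_ofSplit (x : SplitAlgebra) : toSplit (ofSplit x) = x := by
  have : toSplit.comp ofSplit = AlgHom.id ℂ _ := by
    refine GradedTensorProduct.algHom_ext Weyl.parity (UEA.parity kGeZero)
      (Weyl.hom_ext fun x => ?_) (UEA.hom_ext fun x => ?_)
    · rw [AlgHom.comp_apply, AlgHom.comp_apply, ofSplit_inl, κ_gen, AlgHom.comp_apply,
        AlgHom.id_apply]
      cases x with
      | t => exact liftNS_t _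
      | tinv => exact liftNS_tinv _
      | ξ => exact liftNS_ξ _
      | dt => exact toSplit_ℓ 0
      | dξ =>
        simp only [Weyl.genVal]
        rw [map_sub, map_neg, map_mul, toSplit_g, toSplit_ℓ, modelg, modelℓ, seqg, seqℓ]
        rw [toSplit, liftNS_ξ, neg_neg, add_sub_cancel_right]
    · have : (toSplit.comp (ofUEA .laurent)).toLinearMap ∘ₗ UEA.ι kGeZero =
          (GradedTensorProduct.includeRight Weyl.parity (UEA.parity kGeZero)).toLinearMap ∘ₗ
            UEA.ι kGeZero := by
        refine kGeZero_linearMap_ext fun b hb => ?_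
        refine (congrArg toSplit (ofUEA_geOf .laurent b hb)).trans ?_
        rw [toSplit_splitMap hb, splitGen, suppGen_eq _ hb]
        rfl
      rw [AlgHom.comp_apply, AlgHom.comp_apply, ofSplit_inr]
      exact DFunLike.congr_fun this x
  exact DFunLike.congr_fun this x

/-- The isomorphism `𝒦 ⊗ U(𝔨_{≥ 0}) ≅ Ū⁺`. -/
def splitEquiv : SplitAlgebra ≃ₐ[ℂ] Ubar .laurent :=
  AlgEquiv.ofAlgHom ofSplit toSplit (AlgHom.ext ofSplit_toSplit) (AlgHom.ext toSplit_ofSplit)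

end Ubar

/-! ### Monomials in the Weyl superalgebra -/

/-- The power `x ^ b` of an element with square zero. -/
def oddPow (x : B) : Bool → B
  | false => 1
  | true => x

/-- The monomial `t ^ a ∂_t ^ c ξ ^ b ∂_ξ ^ d`, indexed by `((a, c), b, d)`. -/
def weylMonomial (t ξ dt dξ : B) (m : (ℕ × ℕ) × Bool × Bool) : B :=
  t ^ m.1.1 * (dt ^ m.1.2 * (oddPow ξ m.2.1 * oddPow dξ m.2.2))

theorem map_weylMonomial {C : Type*} [Ring C] [Algebra ℂ C] (F : B →ₐ[ℂ] C) (t ξ dt dξ : B)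
    (m : (ℕ × ℕ) × Bool × Bool) :
    F (weylMonomial t ξ dt dξ m) = weylMonomial (F t) (F ξ) (F dt) (F dξ) m := by
  obtain ⟨⟨a, c⟩, ⟨⟩ | ⟨⟩, ⟨⟩ | ⟨⟩⟩ := m <;> simp [weylMonomial, oddPow]

namespace Weyl

/-- The space with basis `t ^ a ∂_t ^ c ξ ^ b ∂_ξ ^ d`, where `a` may be negative: the regular
representation of the Weyl superalgebra. -/
abbrev Model : Type := ((ℤ × ℕ) × Bool × Bool) →₀ ℂ

/-- Left multiplication by `t ^ k`. -/
def modelT (k : ℤ) : Module.End ℂ Model :=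
  Finsupp.linearCombination ℂ fun m => Finsupp.single ((m.1.1 + k, m.1.2), m.2) 1

/-- Left multiplication by `∂_t`. -/
def modelDt : Module.End ℂ Model :=
  Finsupp.linearCombination ℂ fun m => Finsupp.single ((m.1.1, m.1.2 + 1), m.2) 1 +
    Finsupp.single ((m.1.1 - 1, m.1.2), m.2) (m.1.1 : ℂ)

/-- Left multiplication by `ξ`. -/
def modelξ : Module.End ℂ Model :=
  Finsupp.linearCombination ℂ fun m => match m with
    | (i, false, d) => Finsupp.single (i, true, d) 1
    | (_, true, _) => 0

/-- Left multiplication by `∂_ξ`. -/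
def modelDξ : Module.End ℂ Model :=
  Finsupp.linearCombination ℂ fun m => match m with
    | (i, false, false) => Finsupp.single (i, false, true) 1
    | (_, false, true) => 0
    | (i, true, false) => Finsupp.single (i, false, false) 1 - Finsupp.single (i, true, true) 1
    | (i, true, true) => Finsupp.single (i, false, true) 1

theorem modelT_add (j k : ℤ) : modelT j * modelT k = modelT (k + j) := by
  ext1 m
  ext1
  simp [modelT, add_assoc]

theorem modelT_zero : modelT 0 = 1 := by
  ext1 m
  ext1
  simp [modelT]

/-- Left multiplication by `t`, as a unit. -/
def modelUnit : (Module.End ℂ Model)ˣ :=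
  ⟨modelT 1, modelT (-1), by rw [modelT_add]; exact modelT_zero, by
    rw [modelT_add]; exact modelT_zero⟩

theorem model_relations : Relations (modelUnit : Module.End ℂ Model) modelξ modelDt modelDξ := by
  constructor <;> refine Finsupp.lhom_ext' fun ⟨⟨a, c⟩, b, d⟩ => LinearMap.ext_ring ?_ <;>
    cases b <;> cases d <;>
    simp [modelUnit, modelT, modelξ, modelDt, modelDξ, add_comm, smul_sub]
  all_goals abel

/-- The regular representation. -/
def model : Weyl →ₐ[ℂ] Module.End ℂ Model := lift model_relations

/-- Applied to `1`, the monomials give distinct basis vectors. -/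
theorem model_weylMonomial (m : (ℕ × ℕ) × Bool × Bool) :
    model (weylMonomial (gen .t) (gen .ξ) (gen .dt) (gen .dξ) m)
      (Finsupp.single ((0, 0), false, false) 1) =
      Finsupp.single (((m.1.1 : ℤ), m.1.2), m.2) 1 := by
  obtain ⟨⟨a, c⟩, b, d⟩ := m
  refine (congrArg (fun f : Module.End ℂ Model => f (Finsupp.single ((0, 0), false, false) 1))
    (map_weylMonomial model _ _ _ _ _)).trans ?_
  rw [model, lift_gen, lift_gen, lift_gen, lift_gen]
  simp only [weylMonomial, genVal, Module.End.mul_apply]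
  have h1 : oddPow modelξ b (oddPow modelDξ d (Finsupp.single ((0, 0), false, false) 1)) =
      Finsupp.single ((0, 0), b, d) 1 := by
    cases b <;> cases d <;> simp [oddPow, modelξ, modelDξ]
  have h2 : (modelDt ^ c) (Finsupp.single ((0, 0), b, d) 1) =
      Finsupp.single ((0, c), b, d) 1 := by
    induction c with
    | zero => rfl
    | succ c ih => rw [pow_succ', Module.End.mul_apply, ih]; simp [modelDt]
  have h3 : ((modelUnit : Module.End ℂ Model) ^ a) (Finsupp.single ((0, c), b, d) 1) =
      Finsupp.single (((a : ℤ), c), b, d) 1 := by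
    induction a with
    | zero => rfl
    | succ a ih => rw [pow_succ', Module.End.mul_apply, ih]; simp [modelUnit, modelT]
  rw [h1, h2, h3]

theorem linearIndependent_weylMonomial :
    LinearIndependent ℂ (weylMonomial (gen .t) (gen .ξ) (gen .dt) (gen .dξ)) := by
  refine LinearIndependent.of_comp
    (LinearMap.applyₗ (Finsupp.single ((0, 0), false, false) 1) ∘ₗ model.toLinearMap) ?_
  have h := (Finsupp.basisSingleOne (R := ℂ) (ι := (ℤ × ℕ) × Bool × Bool)).linearIndependent.comp
    (fun m : (ℕ × ℕ) × Bool × Bool => (((m.1.1 : ℤ), m.1.2), m.2)) (by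
      rintro ⟨⟨a, c⟩, b⟩ ⟨⟨a', c'⟩, b'⟩ h
      simpa using h)
  refine (linearIndependent_equiv' (Equiv.refl _) (funext fun m => ?_)).2 h
  exact (congrFun Finsupp.coe_basisSingleOne _).trans (model_weylMonomial m).symm

instance : Nontrivial Weyl := ⟨_, _, linearIndependent_weylMonomial.ne_zero ((0, 0), false, false)⟩

end Weyl

/-! ### The canonical map `𝔨_{≥ 0} → U(𝔨_{≥ 0})` is injective -/

/-- The action of `𝔨_{≥ 0}` on `𝔨 ⋉ A`. -/
def adjoint : kGeZero →ₗ[ℂ] Module.End ℂ (Ix →₀ ℂ) :=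
  Ix.bracket ∘ₗ (Finsupp.supported ℂ ℂ Ix.geZero).subtype

theorem adjoint_bracket {i j : ZMod 2} {x y : kGeZero} (hx : x ∈ kGeZero.parity i)
    (hy : y ∈ kGeZero.parity j) : adjoint x * adjoint y =
      ((-1 : ℤˣ) ^ (i * j)) • (adjoint y * adjoint x) + adjoint (kGeZero.bracket x y) := by
  refine Finsupp.lhom_ext fun b c => ?_
  refine (kTilde.bracket_jacobi (x := x.1) (y := y.1) (z := Finsupp.single b c) hx hy
    (Finsupp.single_mem_supported ℂ (s := {a : Ix | a.par = b.par}) c rfl)).trans ?_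
  exact add_comm _ _

/-- The functions `L_n t = t ^ (n + 1)` and `G_{n-1/2} t = t ^ n ξ`; the values on functions only
serve to make the map injective. -/
def Ix.actT : Ix → Ix
  | .L n => .t (n + 1)
  | .G n => .θ n
  | .t k => .L k
  | .θ k => .G k

theorem Ix.actT_injective : Function.Injective Ix.actT := by
  intro a b h
  cases a <;> cases b <;> simp_all [Ix.actT]

theorem adjoint_t (x : kGeZero) :
    adjoint x (Finsupp.single (.t 1) 1) = Finsupp.mapDomain Ix.actT x.1 := by
  have : LinearMap.applyₗ (Finsupp.single (.t 1) 1) ∘ₗ adjoint =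
      Finsupp.lmapDomain ℂ ℂ Ix.actT ∘ₗ (Finsupp.supported ℂ ℂ Ix.geZero).subtype := by
    refine kGeZero_linearMap_ext fun b hb => ?_
    refine (Ix.bracket_single b (.t 1) 1 1).trans ?_
    refine Eq.trans ?_ (Finsupp.mapDomain_single (f := Ix.actT) (a := b) (b := (1 : ℂ))).symm
    refine Ix.geZero_cases (p := fun b => ((1 : ℂ) * 1) • b.br (.t 1) = Finsupp.single b.actT 1)
      (fun k => ?_) (fun k => ?_) b hb <;> simp [Ix.br, Ix.actT]
  exact DFunLike.congr_fun this x

/-- The operators by which the elements of `𝔨_{≥ 0}` act can be told apart on the function `t`. -/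
theorem ι_kGeZero_injective : Function.Injective (UEA.ι kGeZero) := by
  let F : UEA kGeZero →ₐ[ℂ] Module.End ℂ (Ix →₀ ℂ) :=
    UEA.lift (B := Module.End ℂ (Ix →₀ ℂ)) adjoint adjoint_bracket
  intro x y hxy
  have h : F (UEA.ι kGeZero x) = F (UEA.ι kGeZero y) := congrArg F hxy
  have h' : adjoint x (Finsupp.single (.t 1) 1) = adjoint y (Finsupp.single (.t 1) 1) := by
    have e := UEA.lift_ι (B := Module.End ℂ (Ix →₀ ℂ)) adjoint adjoint_bracket
    exact DFunLike.congr_fun ((e x).symm.trans (h.trans (e y))) _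
  rw [adjoint_t, adjoint_t] at h'
  exact Subtype.ext (Finsupp.mapDomain_injective Ix.actT_injective h')

/-! ### Lie superalgebras inside an associative superalgebra -/

section Range

variable {K : LieSuperalgebra} {A : Type} [Ring A] [Algebra ℂ A] (P : ZMod 2 → Submodule ℂ A)
  [GradedAlgebra P] (f : K →ₗ[ℂ] A) (hP : ∀ i, ∀ x ∈ K.parity i, f x ∈ P i)
  (hf : ∀ {i j : ZMod 2} {x y : K}, x ∈ K.parity i → y ∈ K.parity j →
    f x * f y = ((-1 : ℤˣ) ^ (i * j)) • (f y * f x) + f (K.bracket x y))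
include hP hf

theorem supercommutator_map (x y : K) :
    LieSuperalgebra.supercommutator P (f x) (f y) = f (K.bracket x y) := by
  have h : ∀ {i j : ZMod 2} {x y : K}, x ∈ K.parity i → y ∈ K.parity j →
      LieSuperalgebra.supercommutator P (f x) (f y) = f (K.bracket x y) := by
    intro i j x y hx hy
    rw [LieSuperalgebra.supercommutator_apply P (hP i x hx) (hP j y hy), hf hx hy,
      add_sub_cancel_left]
  obtain ⟨a, ha, b, hb, rfl⟩ := K.exists_add x
  obtain ⟨c, hc, d, hd, rfl⟩ := K.exists_add y
  simp only [map_add, LinearMap.add_apply, h ha hc, h ha hd, h hb hc, h hb hd]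

/-- A homomorphism from `K` to an associative superalgebra has a Lie subsuperalgebra as image. -/
theorem isSubalgebra_range :
    (LieSuperalgebra.ofAssociative P).IsSubalgebra (LinearMap.range f) where
  homogeneous := by
    rintro _ ⟨x, rfl⟩
    obtain ⟨a, ha, b, hb, rfl⟩ := K.exists_add x
    refine (map_add f a b) ▸ add_mem (Submodule.mem_iSup_of_mem 0 ⟨⟨a, rfl⟩, hP 0 a ha⟩)
      (Submodule.mem_iSup_of_mem 1 ⟨⟨b, rfl⟩, hP 1 b hb⟩)
  bracket_mem := by
    rintro _ _ ⟨x, rfl⟩ ⟨y, rfl⟩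
    exact ⟨_, (supercommutator_map P f hP hf x y).symm⟩

/-- The Lie superalgebra `K` is isomorphic to its image under an injective homomorphism. -/
def isoRange (hinj : Function.Injective f) {S : Submodule ℂ A}
    (hS : (LieSuperalgebra.ofAssociative P).IsSubalgebra S) (h : LinearMap.range f = S) :
    K.Iso hS.toLieSuperalgebra where
  toLinearEquiv := (LinearEquiv.ofInjective f hinj).trans (LinearEquiv.ofEq _ _ h)
  map_parity i x hx := hP i x hx
  map_bracket x y := Subtype.ext (supercommutator_map P f hP hf x y).symm

end Range

/-- The inverse of an isomorphism. -/
def LieSuperalgebra.Iso.symm {K L : LieSuperalgebra} (e : K.Iso L) : L.Iso K where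
  toLinearEquiv := e.toLinearEquiv.symm
  map_parity i x hx := by
    have hs : ∀ y, L.sigma (e.toLinearEquiv y) = e.toLinearEquiv (K.sigma y) := by
      intro y
      obtain ⟨a, ha, b, hb, rfl⟩ := K.exists_add y
      rw [map_add, L.sigma_zero_one (e.map_parity 0 a ha) (e.map_parity 1 b hb),
        K.sigma_zero_one ha hb, map_sub]
    rw [K.mem_parity_iff]
    apply e.toLinearEquiv.injective
    rw [← hs, Units.smul_def, map_zsmul, LinearEquiv.apply_symm_apply, L.sigma_of_mem hx,
      Units.smul_def]
  map_bracket x y := by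
    apply e.toLinearEquiv.injective
    rw [LinearEquiv.apply_symm_apply, e.map_bracket, LinearEquiv.apply_symm_apply,
      LinearEquiv.apply_symm_apply]

namespace UEA

variable {K L : LieSuperalgebra}

theorem map_aux (e : K.Iso L) {i j : ZMod 2} {x y : K} (hx : x ∈ K.parity i)
    (hy : y ∈ K.parity j) :
    (ι L ∘ₗ e.toLinearEquiv.toLinearMap) x * (ι L ∘ₗ e.toLinearEquiv.toLinearMap) y =
      ((-1 : ℤˣ) ^ (i * j)) • ((ι L ∘ₗ e.toLinearEquiv.toLinearMap) y *
        (ι L ∘ₗ e.toLinearEquiv.toLinearMap) x) +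
        (ι L ∘ₗ e.toLinearEquiv.toLinearMap) (K.bracket x y) := by
  refine (ι_mul_ι (e.map_parity i x hx) (e.map_parity j y hy)).trans ?_
  rw [← e.map_bracket]
  rfl

/-- The homomorphism of enveloping algebras induced by an isomorphism. -/
def map (e : K.Iso L) : UEA K →ₐ[ℂ] UEA L :=
  lift (ι L ∘ₗ e.toLinearEquiv.toLinearMap) (map_aux e)

theorem map_ι (e : K.Iso L) (x : K) : map e (ι K x) = ι L (e.toLinearEquiv x) :=
  lift_ι (ι L ∘ₗ e.toLinearEquiv.toLinearMap) (map_aux e) x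

/-- The isomorphism of enveloping algebras induced by an isomorphism. -/
def congr (e : K.Iso L) : UEA K ≃ₐ[ℂ] UEA L :=
  AlgEquiv.ofAlgHom (map e) (map e.symm)
    (hom_ext fun x => by
      rw [AlgHom.comp_apply, map_ι, map_ι]; exact congrArg _ (e.toLinearEquiv.apply_symm_apply x))
    (hom_ext fun x => by
      rw [AlgHom.comp_apply, map_ι, map_ι]; exact congrArg _ (e.toLinearEquiv.symm_apply_apply x))

theorem sigma_map (e : K.Iso L) (x : UEA K) : sigma L (map e x) = map e (sigma K x) := by
  have : (sigma L).comp (map e) = (map e).comp (sigma K) := hom_ext fun x => by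
    rw [AlgHom.comp_apply, AlgHom.comp_apply, map_ι, sigma_ι, sigma_ι, map_ι]
    obtain ⟨a, ha, b, hb, rfl⟩ := K.exists_add x
    rw [map_add, L.sigma_zero_one (e.map_parity 0 a ha) (e.map_parity 1 b hb),
      K.sigma_zero_one ha hb, map_sub, map_sub, map_sub]
  exact DFunLike.congr_fun this x

theorem map_mem_parity (e : K.Iso L) {i : ZMod 2} {x : UEA K} (hx : x ∈ parity K i) :
    map e x ∈ parity L i := by
  have hx' : sigma K x = ((-1 : ℤˣ) ^ i) • x := hx
  show sigma L (map e x) = _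
  rw [sigma_map, hx', Units.smul_def, map_zsmul, Units.smul_def]

end UEA

/-! ### Parity on tensor products -/

theorem exists_add_of_graded {A : Type} [Ring A] [Algebra ℂ A] (P : ZMod 2 → Submodule ℂ A)
    [GradedAlgebra P] (a : A) : ∃ x ∈ P 0, ∃ y ∈ P 1, a = x + y :=
  (LieSuperalgebra.ofAssociative P).exists_add a

/-- The parity of a tensor product of superalgebras is determined by the parity of the pure
tensors. -/
theorem map_tensorParity {A₁ A₂ A : Type} [Ring A₁] [Algebra ℂ A₁] [Ring A₂] [Algebra ℂ A₂]
    [Ring A] [Algebra ℂ A] (P : ZMod 2 → Submodule ℂ A₁) (Q : ZMod 2 → Submodule ℂ A₂)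
    (R : ZMod 2 → Submodule ℂ A) [GradedAlgebra P] [GradedAlgebra Q] [GradedAlgebra R]
    (F : (P ᵍ⊗[ℂ] Q) ≃ₐ[ℂ] A)
    (hF : ∀ i j, ∀ a ∈ P i, ∀ b ∈ Q j, F (a ᵍ⊗ₜ[ℂ] b) ∈ R (i + j)) (k : ZMod 2) :
    (tensorParity P Q k).map F.toLinearMap = R k := by
  have hle : ∀ k, (tensorParity P Q k).map F.toLinearMap ≤ R k := by
    intro k
    rw [Submodule.map_le_iff_le_comap]
    refine Submodule.span_le.2 ?_
    rintro _ ⟨i, j, rfl, a, ha, b, hb, rfl⟩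
    exact hF i j a ha b hb
  have hsup : ∀ z : P ᵍ⊗[ℂ] Q, ∃ x ∈ tensorParity P Q 0, ∃ y ∈ tensorParity P Q 1, z = x + y := by
    intro z
    induction z using TensorProduct.induction_on with
    | zero => exact ⟨0, zero_mem _, 0, zero_mem _, (add_zero 0).symm⟩
    | add z w hz hw =>
      obtain ⟨x, hx, y, hy, rfl⟩ := hz
      obtain ⟨x', hx', y', hy', rfl⟩ := hw
      exact ⟨x + x', add_mem hx hx', y + y', add_mem hy hy', add_add_add_comm _ _ _ _⟩
    | tmul a b =>
      have hm : ∀ {i j k : ZMod 2} {a : A₁} {b : A₂}, i + j = k → a ∈ P i → b ∈ Q j →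
          a ᵍ⊗ₜ[ℂ] b ∈ tensorParity P Q k := fun h ha hb =>
        Submodule.subset_span ⟨_, _, h, _, ha, _, hb, rfl⟩
      obtain ⟨a₀, ha₀, a₁, ha₁, rfl⟩ := exists_add_of_graded P a
      obtain ⟨b₀, hb₀, b₁, hb₁, rfl⟩ := exists_add_of_graded Q b
      refine ⟨a₀ ᵍ⊗ₜ[ℂ] b₀ + a₁ ᵍ⊗ₜ[ℂ] b₁, add_mem (hm rfl ha₀ hb₀) (hm rfl ha₁ hb₁),
        a₀ ᵍ⊗ₜ[ℂ] b₁ + a₁ ᵍ⊗ₜ[ℂ] b₀, add_mem (hm rfl ha₀ hb₁) (hm rfl ha₁ hb₀), ?_⟩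
      have e : ((a₀ + a₁) ⊗ₜ[ℂ] (b₀ + b₁) : A₁ ⊗[ℂ] A₂) =
          a₀ ⊗ₜ b₀ + a₁ ⊗ₜ b₁ + (a₀ ⊗ₜ b₁ + a₁ ⊗ₜ b₀) := by
        simp only [TensorProduct.add_tmul, TensorProduct.tmul_add]
        abel
      exact e
  have hdisj : ∀ v ∈ R 0, v ∈ R 1 → v = 0 := fun v h0 h1 => by
    rw [← DirectSum.decompose_of_mem_same R h0, DirectSum.decompose_of_mem_ne R h1 one_ne_zero]
  refine le_antisymm (hle k) fun v hv => ?_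
  obtain ⟨x, hx, y, hy, hxy⟩ := hsup (F.symm v)
  have hv' : v = F x + F y := by rw [← map_add, ← hxy, AlgEquiv.apply_symm_apply]
  have hx' : F x ∈ R 0 := hle 0 ⟨x, hx, rfl⟩
  have hy' : F y ∈ R 1 := hle 1 ⟨y, hy, rfl⟩
  rcases zmod2_cases k with rfl | rfl
  · have : F y = 0 := hdisj _ ((add_mem_cancel_left hx').1 (hv' ▸ hv)) hy'
    rw [this, add_zero] at hv'
    exact ⟨x, hx, hv'.symm⟩
  · have : F x = 0 := hdisj _ hx' ((add_mem_cancel_right hy').1 (hv' ▸ hv))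
    rw [this, zero_add] at hv'
    exact ⟨y, hy, hv'.symm⟩

/-! ### The elements `L'_n` and `G'_{m-1/2}` -/

namespace Ubar

variable (r : Fun)

theorem polySum_cY_pow (t : B) (e : ℕ → B) (k : ℕ) : polySum t e (cY ^ k) =
    ∑ i ∈ Finset.range (k + 1), ((-1) ^ (k - i) * (k.choose i : ℂ)) • (t ^ (k - i) * e i) := by
  rw [cY, sub_eq_add_neg, add_pow, map_sum]
  refine Finset.sum_congr rfl fun i _ => ?_
  have : (X : ℂ[X][X]) ^ i * (-C (X : ℂ[X])) ^ (k - i) * (k.choose i : ℂ[X][X]) =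
      C (C ((-1) ^ (k - i) * (k.choose i : ℂ)) * X ^ (k - i)) * X ^ i := by
    rw [neg_pow]
    simp only [map_mul, map_pow, map_neg, map_one, map_natCast]
    ring
  rw [this, polySum_C_mul_X_pow, map_mul, aeval_C, map_pow, aeval_X, ← Algebra.smul_def,
    smul_mul_assoc]

theorem neg_one_pow_mul_sub {n i : ℕ} (h : i ≤ n) :
    (-1 : ℂ) ^ n * (-1) ^ (n - i) = (-1) ^ i := by
  obtain ⟨j, rfl⟩ := Nat.exists_eq_add_of_le h
  rw [Nat.add_sub_cancel_left, pow_add, mul_assoc, ← mul_pow]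
  norm_num

theorem Lprime_eq (n : ℕ) : Lprime r n = (-1 : ℂ) ^ n • ℓ r (n + 1) := by
  rw [ℓ, splitℓ, centredL, centredG, polySum_cY_pow, polySum_cY_pow, Lprime, smul_add,
    smul_comm _ (((n : ℂ) + 1) / 2), Finset.mul_sum]
  congr 1
  · rw [Finset.smul_sum]
    refine Finset.sum_congr rfl fun i hi => ?_
    have hi' : i ≤ n + 1 := Nat.lt_succ_iff.1 (Finset.mem_range.1 hi)
    have e := neg_one_pow_mul_sub hi'
    rw [smul_smul, t_eq_pow]
    congr 1
    linear_combination ((n + 1).choose i : ℂ) * e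
  · congr 1
    rw [Finset.smul_sum]
    refine Finset.sum_congr rfl fun i hi => ?_
    have e := neg_one_pow_mul_sub (Nat.lt_succ_iff.1 (Finset.mem_range.1 hi))
    have hc : θ r 0 * t r 1 ^ (n - i) = t r 1 ^ (n - i) * θ r 0 :=
      (show Commute (θ r 0) (t r 1) from (nsRelations r).ξ_t).pow_right _
    rw [mul_smul_comm, smul_smul, ← mul_assoc (θ r 0), hc, ← θ_eq_mul]
    congr 1
    linear_combination -(n.choose i : ℂ) * e

theorem Gprime_eq (n : ℕ) : Gprime r n = (-1 : ℂ) ^ n • g r n := by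
  rw [g, splitg, centredL, centredG, polySum_cY_pow, polySum_cY_pow, Gprime, Finset.mul_sum,
    Finset.smul_sum, ← Finset.sum_sub_distrib, Finset.smul_sum]
  refine Finset.sum_congr rfl fun i hi => ?_
  have e := neg_one_pow_mul_sub (Nat.lt_succ_iff.1 (Finset.mem_range.1 hi))
  have hc : θ r 0 * t r 1 ^ (n - i) = t r 1 ^ (n - i) * θ r 0 :=
    (show Commute (θ r 0) (t r 1) from (nsRelations r).ξ_t).pow_right _
  rw [mul_smul_comm, smul_comm (2 : ℂ), ← smul_sub, smul_smul, ← mul_assoc, ← mul_assoc, hc,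
    ← θ_eq_mul, t_eq_pow, ← e]

/-- The map from `𝔨_{≥ 0}` to `Ū⁺` or `Ū⁺⁺`, which sends `L_n` to `(-1) ^ n L'_n` and `G_{m-1/2}` to
`(-1) ^ m G'_{m-1/2}`. -/
def ofLie : kGeZero →ₗ[ℂ] Ubar r := (ofUEA r).toLinearMap ∘ₗ UEA.ι kGeZero

/-- The basis elements `L_n` and `G_{m+1/2}` of `𝔨_{≥ 0}`. -/
def geIx : ℕ ⊕ ℕ → Ix
  | .inl n => .L n
  | .inr m => .G ((m : ℤ) + 1)

theorem geIx_mem (i : ℕ ⊕ ℕ) : geIx i ∈ Ix.geZero := by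
  cases i with
  | inl n => exact Int.natCast_nonneg n
  | inr m => exact show (1 : ℤ) ≤ m + 1 by omega

/-- The sign relating `L'_n` to `L_n` and `G'_{m+1/2}` to `G_{m+1/2}`. -/
def geSign : ℕ ⊕ ℕ → ℂˣ
  | .inl n => (-1) ^ n
  | .inr m => (-1) ^ (m + 1)

theorem primed_eq (i : ℕ ⊕ ℕ) :
    primed r i = geSign i • ofLie r (geOf (geIx i) (geIx_mem i)) := by
  have h : ofLie r (geOf (geIx i) (geIx_mem i)) = splitMap (ℓ r) (g r) (geIx i) := ofUEA_geOf ..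
  rw [h, Units.smul_def]
  cases i with
  | inl n => exact (Lprime_eq r n).trans (by simp [geSign, geIx, splitMap])
  | inr m => exact (Gprime_eq r (m + 1)).trans (by simp [geSign, geIx, splitMap])

theorem ofLie_range : LinearMap.range (ofLie r) = T r := by
  have htop : Submodule.span ℂ (Set.range fun i => geOf (geIx i) (geIx_mem i)) = ⊤ := by
    rw [eq_top_iff]
    have h := span_suppOf isSubalgebra_geZero
    refine (le_of_eq h.symm).trans (Submodule.span_mono ?_)
    rintro _ ⟨⟨b, hb⟩, rfl⟩
    refine Ix.geZero_cases (p := fun b => ∀ hb, suppOf isSubalgebra_geZero b hb ∈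
      Set.range fun i => geOf (geIx i) (geIx_mem i)) (fun k hb => ⟨.inl k, rfl⟩)
      (fun k hb => ⟨.inr k, rfl⟩) b hb hb
  rw [LinearMap.range_eq_map, ← htop, Submodule.map_span, T]
  apply le_antisymm <;> refine Submodule.span_le.2 ?_
  · rintro _ ⟨_, ⟨i, rfl⟩, rfl⟩
    have : ofLie r (geOf (geIx i) (geIx_mem i)) = (geSign i)⁻¹ • primed r i := by
      rw [primed_eq, inv_smul_smul]
    rw [this, Units.smul_def]
    exact Submodule.smul_mem _ _ (Submodule.subset_span ⟨i, rfl⟩)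
  · rintro _ ⟨i, rfl⟩
    rw [primed_eq, Units.smul_def]
    exact Submodule.smul_mem _ _ (Submodule.subset_span ⟨_, ⟨i, rfl⟩, rfl⟩)

theorem includeRight_injective : Function.Injective
    (GradedTensorProduct.includeRight (R := ℂ) Weyl.parity (UEA.parity kGeZero)) :=
  Algebra.TensorProduct.includeRight_injective (R := ℂ) (A := Weyl) (B := UEA kGeZero)
    (algebraMap ℂ Weyl).injective

/-- The decomposition of `Ū⁺` identifies the map with the inclusion of the second tensor factor. -/
theorem ofUEA_injective : Function.Injective (ofUEA .laurent) := by
  intro x y h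
  rw [← ofSplit_inr, ← ofSplit_inr] at h
  exact includeRight_injective (splitEquiv.injective h)

theorem ofLie_injective : Function.Injective (ofLie .laurent) := fun _ _ h =>
  ι_kGeZero_injective (ofUEA_injective h)

theorem linearIndependent_primed : LinearIndependent ℂ (primed .laurent) := by
  have h1 : LinearIndependent ℂ fun i => geOf (geIx i) (geIx_mem i) := by
    refine LinearIndependent.of_comp (Finsupp.supported ℂ ℂ Ix.geZero).subtype ?_
    have h := (Finsupp.basisSingleOne (R := ℂ) (ι := Ix)).linearIndependent.comp geIx (by
      rintro (i | i) (j | j) h <;> simp_all [geIx])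
    refine (linearIndependent_equiv' (Equiv.refl _) (funext fun m => ?_)).2 h
    exact congrFun Finsupp.coe_basisSingleOne _
  have h2 := (h1.map' (ofLie .laurent) (LinearMap.ker_eq_bot.2 ofLie_injective)).units_smul geSign
  refine (linearIndependent_equiv' (Equiv.refl _) (funext fun i => ?_)).2 h2
  exact (primed_eq .laurent i).symm

/-! ### Parity -/

theorem sigma_egen {b : Ix} (hb : b ∈ r.ix) :
    sigma r (egen r b) = ((-1 : ℤˣ) ^ b.par) • egen r b := by
  rw [egen_eq hb, gen, sigma_mk, sigma_ugen, Units.smul_def, Units.smul_def, map_zsmul]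

theorem sigma_t (k : ℕ) : sigma r (t r k) = t r k := by
  rw [t_eq, sigma_egen r (r.t_mem (r.natCast_mem k)), Ix.par, uzpow_zero, one_smul]

theorem sigma_θ (k : ℕ) : sigma r (θ r k) = -θ r k := by
  rw [θ_eq, sigma_egen r (r.θ_mem (r.natCast_mem k))]
  simp [Ix.par, Units.smul_def]

theorem sigma_L (k : ℕ) : sigma r (L r k) = L r k := by
  rw [L_eq, sigma_egen r (r.L_mem (by omega)), Ix.par, uzpow_zero, one_smul]

theorem sigma_G (k : ℕ) : sigma r (G r k) = -G r k := by
  rw [G_eq, sigma_egen r (r.G_mem (Int.natCast_nonneg k))]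
  simp [Ix.par, Units.smul_def]

theorem sigma_centredL (k : ℕ) : sigma r (centredL r k) = centredL r k := by
  rw [centredL, map_polySum, sigma_t]
  simp only [sigma_L]

theorem sigma_centredG (k : ℕ) : sigma r (centredG r k) = -centredG r k := by
  rw [centredG, map_polySum, sigma_t]
  simp only [sigma_G, polySum_cY_pow, mul_neg, smul_neg, Finset.sum_neg_distrib]

theorem sigma_ℓ (k : ℕ) : sigma r (ℓ r k) = ℓ r k := by
  rw [ℓ, map_splitℓ]
  simp only [sigma_centredL, sigma_centredG, sigma_θ]
  cases k <;> simp [splitℓ]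

theorem sigma_g (k : ℕ) : sigma r (g r k) = -g r k := by
  rw [g, map_splitg]
  simp only [sigma_centredL, sigma_centredG, sigma_θ, splitg, neg_mul, smul_neg]
  abel

theorem sigma_ofUEA (x : UEA kGeZero) :
    sigma r (ofUEA r x) = ofUEA r (UEA.sigma kGeZero x) := by
  have h : (sigma r).comp (ofUEA r) = (ofUEA r).comp (UEA.sigma kGeZero) := UEA.hom_ext fun x => by
    have : ((sigma r).comp (ofUEA r)).toLinearMap ∘ₗ UEA.ι kGeZero =
        ((ofUEA r).comp (UEA.sigma kGeZero)).toLinearMap ∘ₗ UEA.ι kGeZero := by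
      refine kGeZero_linearMap_ext fun b hb => ?_
      show sigma r (ofUEA r (UEA.ι kGeZero (geOf b hb))) =
        ofUEA r (UEA.sigma kGeZero (UEA.ι kGeZero (geOf b hb)))
      rw [UEA.sigma_ι, kGeZero.sigma_of_mem (geOf_mem b hb), Units.smul_def, map_zsmul, map_zsmul,
        ofUEA_geOf]
      refine Ix.geZero_cases (p := fun b => sigma r (splitMap (ℓ r) (g r) b) =
        (((-1 : ℤˣ) ^ b.par : ℤˣ) : ℤ) • splitMap (ℓ r) (g r) b) (fun k => ?_) (fun k => ?_) b hb
      · simp [splitMap, sigma_ℓ, Ix.par]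
      · simp [splitMap, sigma_g, Ix.par]
    exact DFunLike.congr_fun this x
  exact DFunLike.congr_fun h x

theorem sigma_κ (x : Weyl) : sigma .laurent (κ x) = κ (Weyl.sigma x) := by
  have h : (sigma .laurent).comp κ = κ.comp Weyl.sigma := Weyl.hom_ext fun x => by
    have ht : sigma .laurent tinv = tinv := by
      have := sigma_egen .laurent (b := .t (-1)) (Fun.laurent.t_mem trivial)
      rw [egen_eq (Fun.laurent.t_mem trivial)] at this
      simpa [Ix.par, tinv] using this
    rw [AlgHom.comp_apply, AlgHom.comp_apply, Weyl.sigma_gen, Units.smul_def, map_zsmul, κ_gen]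
    cases x with
    | t => exact (sigma_t .laurent 1).trans (one_smul ℤ _).symm
    | tinv => exact ht.trans (one_smul ℤ _).symm
    | ξ => simp [Weyl.genVal, Weyl.genPar, sigma_θ]
    | dt => simp [Weyl.genVal, Weyl.genPar, sigma_ℓ]
    | dξ => simp [Weyl.genVal, Weyl.genPar, sigma_ℓ, sigma_θ, sigma_g, add_comm]
  exact DFunLike.congr_fun h x

theorem ofUEA_mem {i : ZMod 2} {x : UEA kGeZero} (hx : x ∈ UEA.parity kGeZero i) :
    ofUEA r x ∈ parity r i := by
  have hx' : UEA.sigma kGeZero x = ((-1 : ℤˣ) ^ i) • x := hx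
  show sigma r (ofUEA r x) = _
  rw [sigma_ofUEA, hx', Units.smul_def, map_zsmul, Units.smul_def]

theorem κ_mem {i : ZMod 2} {x : Weyl} (hx : x ∈ Weyl.parity i) : κ x ∈ parity .laurent i := by
  have hx' : Weyl.sigma x = ((-1 : ℤˣ) ^ i) • x := hx
  show sigma .laurent (κ x) = _
  rw [sigma_κ, hx', Units.smul_def, map_zsmul, Units.smul_def]

/-! ### The Lie superalgebra `𝒯` -/

theorem ofLie_mem (i : ZMod 2) (x : kGeZero) (hx : x ∈ kGeZero.parity i) :
    ofLie r x ∈ parity r i := ofUEA_mem r (UEA.ι_mem_parity hx)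

theorem ofLie_mul {i j : ZMod 2} {x y : kGeZero} (hx : x ∈ kGeZero.parity i)
    (hy : y ∈ kGeZero.parity j) : ofLie r x * ofLie r y =
      ((-1 : ℤˣ) ^ (i * j)) • (ofLie r y * ofLie r x) + ofLie r (kGeZero.bracket x y) := by
  have h := congrArg (ofUEA r) (UEA.ι_mul_ι hx hy)
  rw [map_add, Units.smul_def, map_zsmul, map_mul, map_mul] at h
  exact h

theorem isSubalgebra_T : UbarLie.IsSubalgebra (T .laurent) := by
  rw [← ofLie_range]
  exact isSubalgebra_range (parity .laurent) (ofLie .laurent) (ofLie_mem .laurent)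
    (ofLie_mul .laurent)

/-- The isomorphism `𝔨_{≥ 0} ≅ 𝒯`. -/
def isoT : kGeZero.Iso isSubalgebra_T.toLieSuperalgebra :=
  isoRange (parity .laurent) (ofLie .laurent) (ofLie_mem .laurent) (ofLie_mul .laurent)
    ofLie_injective isSubalgebra_T (ofLie_range .laurent)

/-- The homomorphism `U(𝒯) → Ū⁺`. -/
def ofT : UEA isSubalgebra_T.toLieSuperalgebra →ₐ[ℂ] Ubar .laurent :=
  (ofUEA .laurent).comp (UEA.map isoT.symm)

theorem ofT_ι (y : Ubar .laurent) (hy : y ∈ T .laurent) :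
    ofT (UEA.ι isSubalgebra_T.toLieSuperalgebra (isSubalgebra_T.of ⟨y, hy⟩)) = y := by
  rw [ofT, AlgHom.comp_apply, UEA.map_ι]
  exact congrArg Subtype.val (isoT.toLinearEquiv.apply_symm_apply (isSubalgebra_T.of ⟨y, hy⟩))

theorem ofT_mem {i : ZMod 2} {x : UEA isSubalgebra_T.toLieSuperalgebra}
    (hx : x ∈ UEA.parity isSubalgebra_T.toLieSuperalgebra i) : ofT x ∈ parity .laurent i :=
  ofUEA_mem .laurent (UEA.map_mem_parity _ hx)

theorem ofT_supercommute ⦃i j : ZMod 2⦄ (a : Weyl.parity i)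
    (b : UEA.parity isSubalgebra_T.toLieSuperalgebra j) :
    κ a * ofT b = (-1 : ℤˣ) ^ (j * i) • (ofT b * κ a) :=
  splitRelations_laurent.supercommute a ⟨_, UEA.map_mem_parity isoT.symm b.2⟩

/-- The homomorphism `𝒦 ⊗ U(𝒯) → Ū⁺`. -/
def weylTensorT :
    (Weyl.parity ᵍ⊗[ℂ] UEA.parity isSubalgebra_T.toLieSuperalgebra) →ₐ[ℂ] Ubar .laurent :=
  GradedTensorProduct.lift _ _ κ ofT ofT_supercommute

theorem weylTensorT_bijective : Function.Bijective weylTensorT := by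
  let e : Weyl ⊗[ℂ] UEA isSubalgebra_T.toLieSuperalgebra ≃ₗ[ℂ] Weyl ⊗[ℂ] UEA kGeZero :=
    TensorProduct.congr (LinearEquiv.refl ℂ Weyl) (UEA.congr isoT.symm).toLinearEquiv
  have h : weylTensorT.toLinearMap = ofSplit.toLinearMap ∘ₗ
      (GradedTensorProduct.of ℂ Weyl.parity (UEA.parity kGeZero)).toLinearMap ∘ₗ e.toLinearMap := by
    refine TensorProduct.ext' fun x y => ?_
    rfl
  have h' : ⇑weylTensorT = splitEquiv ∘ e := congrArg DFunLike.coe h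
  rw [h']
  exact splitEquiv.bijective.comp e.bijective

/-- The isomorphism `𝒦 ⊗ U(𝒯) ≅ Ū⁺`. -/
def weylTensorTEquiv :
    (Weyl.parity ᵍ⊗[ℂ] UEA.parity isSubalgebra_T.toLieSuperalgebra) ≃ₐ[ℂ] Ubar .laurent :=
  AlgEquiv.ofBijective weylTensorT weylTensorT_bijective

theorem weylTensorTEquiv_tmul (x : Weyl) (y : UEA isSubalgebra_T.toLieSuperalgebra) :
    weylTensorTEquiv (x ᵍ⊗ₜ[ℂ] y) = κ x * ofT y := rfl

end Ubar

/-! ### The span of the monomials -/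

namespace Weyl.Relations

variable {t ξ dt dξ : B} (h : Relations t ξ dt dξ)
include h

theorem dt_mul_pow (a : ℕ) : dt * t ^ a = t ^ a * dt + (a : ℂ) • t ^ (a - 1) := by
  induction a with
  | zero => simp
  | succ a ih =>
    have e : (a : ℂ) • (t ^ (a - 1) * t) = (a : ℂ) • t ^ a := by
      rcases a with - | a
      · simp
      · rw [add_tsub_cancel_right, pow_succ]
    rw [pow_succ, ← mul_assoc, ih, add_mul, mul_assoc, h.dt_t, mul_add, ← mul_assoc, smul_mul_assoc,
      e, mul_one, add_tsub_cancel_right]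
    push_cast
    module

/-- Left multiplication by `t`, `ξ`, `∂_t` and `∂_ξ` preserves the span of the monomials. -/
theorem mul_weylMonomial_mem {x : B} (hx : x = t ∨ x = ξ ∨ x = dt ∨ x = dξ)
    (m : (ℕ × ℕ) × Bool × Bool) :
    x * weylMonomial t ξ dt dξ m ∈ Submodule.span ℂ (Set.range (weylMonomial t ξ dt dξ)) := by
  have hm : ∀ m, weylMonomial t ξ dt dξ m ∈
      Submodule.span ℂ (Set.range (weylMonomial t ξ dt dξ)) := fun m =>
    Submodule.subset_span ⟨m, rfl⟩
  obtain ⟨⟨a, c⟩, b, d⟩ := m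
  have ξ_t : ∀ w, ξ * (t ^ a * w) = t ^ a * (ξ * w) := fun w =>
    ((show Commute ξ t from h.ξ_t).pow_right a).left_comm w
  have ξ_dt : ∀ w, ξ * (dt ^ c * w) = dt ^ c * (ξ * w) := fun w =>
    ((show Commute ξ dt from h.dt_ξ.symm).pow_right c).left_comm w
  have dξ_t : ∀ w, dξ * (t ^ a * w) = t ^ a * (dξ * w) := fun w =>
    ((show Commute dξ t from h.dξ_t).pow_right a).left_comm w
  have dξ_dt : ∀ w, dξ * (dt ^ c * w) = dt ^ c * (dξ * w) := fun w =>
    ((show Commute dξ dt from h.dt_dξ.symm).pow_right c).left_comm w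
  rcases hx with rfl | rfl | rfl | rfl
  · have e : x * weylMonomial x ξ dt dξ ((a, c), b, d) =
        weylMonomial x ξ dt dξ ((a + 1, c), b, d) := by
      simp only [weylMonomial, pow_succ', mul_assoc]
    rw [e]
    exact hm _
  · cases b with
    | false =>
      have e : x * weylMonomial t x dt dξ ((a, c), false, d) =
          weylMonomial t x dt dξ ((a, c), true, d) := by
        simp only [weylMonomial, oddPow, ξ_t, ξ_dt, one_mul]
      rw [e]
      exact hm _
    | true =>
      have e : x * weylMonomial t x dt dξ ((a, c), true, d) = 0 := by
        simp only [weylMonomial, oddPow, ξ_t, ξ_dt]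
        rw [← mul_assoc x x, h.ξ_ξ, zero_mul, mul_zero, mul_zero]
      rw [e]
      exact zero_mem _
  · have e : x * weylMonomial t ξ x dξ ((a, c), b, d) = weylMonomial t ξ x dξ ((a, c + 1), b, d) +
        (a : ℂ) • weylMonomial t ξ x dξ ((a - 1, c), b, d) := by
      simp only [weylMonomial]
      rw [← mul_assoc, h.dt_mul_pow, add_mul, smul_mul_assoc, mul_assoc, pow_succ', mul_assoc]
    rw [e]
    exact add_mem (hm _) (Submodule.smul_mem _ _ (hm _))
  · cases b <;> cases d
    · have e : x * weylMonomial t ξ dt x ((a, c), false, false) =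
          weylMonomial t ξ dt x ((a, c), false, true) := by
        simp only [weylMonomial, oddPow, one_mul, mul_one, dξ_t,
          ((show Commute x dt from h.dt_dξ.symm).pow_right c).eq]
      rw [e]
      exact hm _
    · have e : x * weylMonomial t ξ dt x ((a, c), false, true) = 0 := by
        simp only [weylMonomial, oddPow, dξ_t, dξ_dt, one_mul, h.dξ_dξ, mul_zero]
      rw [e]
      exact zero_mem _
    · have e : x * weylMonomial t ξ dt x ((a, c), true, false) =
          weylMonomial t ξ dt x ((a, c), false, false) -
            weylMonomial t ξ dt x ((a, c), true, true) := by
        simp only [weylMonomial, oddPow, dξ_t, dξ_dt, mul_one, h.dξ_ξ, mul_add, mul_neg]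
        abel
      rw [e]
      exact sub_mem (hm _) (hm _)
    · have e : x * weylMonomial t ξ dt x ((a, c), true, true) =
          weylMonomial t ξ dt x ((a, c), false, true) := by
        simp only [weylMonomial, oddPow, dξ_t, dξ_dt, one_mul]
        rw [← mul_assoc x ξ, h.dξ_ξ, add_mul, neg_mul, mul_assoc, h.dξ_dξ, mul_zero, neg_zero,
          zero_add, one_mul]
      rw [e]
      exact hm _

end Weyl.Relations

/-- Elements which supercommute with the generators supercommute with the monomials. -/
theorem mul_weylMonomial_of_commute {t ξ dt dξ c : B} (ε : ℂ) (ht : c * t = t * c)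
    (hdt : c * dt = dt * c) (hξ : c * ξ = ε • (ξ * c)) (hdξ : c * dξ = ε • (dξ * c))
    (m : (ℕ × ℕ) × Bool × Bool) :
    ∃ ε' : ℂ, c * weylMonomial t ξ dt dξ m = ε' • (weylMonomial t ξ dt dξ m * c) := by
  obtain ⟨⟨a, k⟩, b, d⟩ := m
  have ht' : ∀ w, c * (t ^ a * w) = t ^ a * (c * w) := fun w =>
    ((show Commute c t from ht).pow_right a).left_comm w
  have hdt' : ∀ w, c * (dt ^ k * w) = dt ^ k * (c * w) := fun w =>
    ((show Commute c dt from hdt).pow_right k).left_comm w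
  have hb : ∃ ε' : ℂ, c * oddPow ξ b = ε' • (oddPow ξ b * c) := by
    cases b
    · exact ⟨1, by simp [oddPow]⟩
    · exact ⟨ε, hξ⟩
  have hd : ∃ ε' : ℂ, c * oddPow dξ d = ε' • (oddPow dξ d * c) := by
    cases d
    · exact ⟨1, by simp [oddPow]⟩
    · exact ⟨ε, hdξ⟩
  obtain ⟨ε₁, h₁⟩ := hb
  obtain ⟨ε₂, h₂⟩ := hd
  refine ⟨ε₁ * ε₂, ?_⟩
  simp only [weylMonomial]
  rw [ht', hdt', ← mul_assoc c, h₁, smul_mul_assoc, mul_assoc (oddPow ξ b), h₂]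
  simp only [mul_smul_comm, smul_smul, mul_assoc]

namespace Ubar

/-! ### Generators of `Ū⁺⁺` -/

/-- The algebra `Ū⁺⁺` is generated by `t`, `ξ` and the split generators. -/
theorem eq_top_of_split_mem {A : Subalgebra ℂ (Ubar .poly)} (ht : t .poly 1 ∈ A)
    (hξ : θ .poly 0 ∈ A) (hℓ : ∀ k, ℓ .poly k ∈ A) (hg : ∀ k, g .poly k ∈ A) : A = ⊤ := by
  have hP : ∀ k, centredL .poly k ∈ A := by
    intro k
    rw [← congrFun (centredP_split (nsRelations .poly).ξ_ξ (centredL .poly) (centredG .poly)) k]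
    cases k with
    | zero => exact hℓ 0
    | succ k => exact sub_mem (hℓ _) (A.smul_mem (mul_mem hξ (hg _)) _)
  have hQ : ∀ k, centredG .poly k ∈ A := by
    intro k
    rw [← congrFun (centredQ_split (nsRelations .poly).ξ_ξ (centredL .poly) (centredG .poly)) k]
    exact add_mem (hg _) (A.smul_mem (mul_mem hξ (hℓ _)) _)
  have ha : ∀ a : ℂ[X], aeval (t .poly 1) a ∈ A := fun a =>
    Algebra.adjoin_le (Set.singleton_subset_iff.2 ht) (aeval_mem_adjoin_singleton ℂ (t .poly 1))
  have hL : ∀ i, L .poly i ∈ A := fun i => by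
    rw [← polySum_X_pow (t .poly 1) (L .poly) i]
    exact span_induction_C span_cY_pow (p := fun H => polySum (t .poly 1) (L .poly) H ∈ A) hP
      (fun F H hF hH => by rw [map_add]; exact add_mem hF hH)
      (fun a F hF => by rw [polySum_C_mul]; exact mul_mem (ha a) hF) _
  have hG : ∀ i, G .poly i ∈ A := fun i => by
    rw [← polySum_X_pow (t .poly 1) (G .poly) i]
    exact span_induction_C span_cY_pow (p := fun H => polySum (t .poly 1) (G .poly) H ∈ A) hQ
      (fun F H hF hH => by rw [map_add]; exact add_mem hF hH)
      (fun a F hF => by rw [polySum_C_mul]; exact mul_mem (ha a) hF) _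
  refine eq_top_of_gen_mem fun b hb => ?_
  rw [← egen_eq]
  cases b with
  | L m =>
    obtain ⟨i, hi⟩ := Int.eq_ofNat_of_zero_le (show 0 ≤ m + 1 by have : -1 ≤ m := hb; omega)
    obtain rfl : m = i - 1 := by omega
    rw [← L_eq]; exact hL i
  | G m =>
    obtain ⟨i, rfl⟩ := Int.eq_ofNat_of_zero_le (show 0 ≤ m from hb)
    rw [← G_eq]; exact hG i
  | t k =>
    obtain ⟨i, rfl⟩ := Int.eq_ofNat_of_zero_le (show 0 ≤ k from hb)
    rw [← t_eq, t_eq_pow]; exact pow_mem ht i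
  | θ k =>
    obtain ⟨i, rfl⟩ := Int.eq_ofNat_of_zero_le (show 0 ≤ k from hb)
    rw [← θ_eq, θ_eq_mul]; exact mul_mem (pow_mem ht i) hξ

/-- The element `∂_ξ = ξ L_{-1} - G_{-1/2}`. -/
def dξ (r : Fun) : Ubar r := -g r 0 - θ r 0 * ℓ r 0

/-- The monomials in `t`, `∂_t = L_{-1}`, `ξ` and `∂_ξ`. -/
def monomial (r : Fun) : (ℕ × ℕ) × Bool × Bool → Ubar r :=
  weylMonomial (t r 1) (θ r 0) (ℓ r 0) (dξ r)

/-- The span of the products of the monomials with the elements of `U(𝔨_{≥ 0})`. -/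
def monomialSpan (r : Fun) : Submodule ℂ (Ubar r) := Submodule.span ℂ
  (Set.range fun p : ((ℕ × ℕ) × Bool × Bool) × UEA kGeZero => monomial r p.1 * ofUEA r p.2)

/-- The span is stable under multiplication by the generators and contains `1`. -/
theorem monomialSpan_eq_top : monomialSpan .poly = ⊤ := by
  have hR : Weyl.Relations (t .poly 1) (θ .poly 0) (ℓ .poly 0) (dξ .poly) :=
    (splitRelations .poly).weylRelations
  have hS := splitRelations .poly
  -- the elements which preserve the span form a subalgebra
  let A : Subalgebra ℂ (Ubar .poly) :=
    { carrier := {x | ∀ v ∈ monomialSpan .poly, x * v ∈ monomialSpan .poly}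
      mul_mem' := fun {a b} ha hb v hv => by rw [mul_assoc]; exact ha _ (hb v hv)
      add_mem' := fun {a b} ha hb v hv => by rw [add_mul]; exact add_mem (ha v hv) (hb v hv)
      algebraMap_mem' := fun c v hv => by
        rw [← Algebra.smul_def]; exact Submodule.smul_mem _ _ hv }
  have hA : ∀ x, (∀ m y, x * (monomial .poly m * ofUEA .poly y) ∈ monomialSpan .poly) → x ∈ A := by
    intro x hx v hv
    have : monomialSpan .poly ≤ (monomialSpan .poly).comap (LinearMap.mulLeft ℂ x) := by
      refine Submodule.span_le.2 ?_
      rintro _ ⟨⟨m, y⟩, rfl⟩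
      exact hx m y
    exact this hv
  have hgen : ∀ m y, monomial .poly m * ofUEA .poly y ∈ monomialSpan .poly := fun m y =>
    Submodule.subset_span ⟨(m, y), rfl⟩
  have hWeyl : ∀ x, (x = t .poly 1 ∨ x = θ .poly 0 ∨ x = ℓ .poly 0 ∨ x = dξ .poly) → x ∈ A := by
    intro x hx
    refine hA x fun m y => ?_
    have : Submodule.span ℂ (Set.range (monomial .poly)) ≤
        (monomialSpan .poly).comap (LinearMap.mulRight ℂ (ofUEA .poly y)) := by
      refine Submodule.span_le.2 ?_
      rintro _ ⟨m, rfl⟩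
      exact hgen m y
    rw [← mul_assoc]
    exact this (hR.mul_weylMonomial_mem hx m)
  -- elements of `U(𝔨_{≥ 0})` move past the monomials, up to a scalar
  have hN : ∀ (c : Ubar .poly) (z : UEA kGeZero) (ε : ℂ), ofUEA .poly z = c →
      c * t .poly 1 = t .poly 1 * c → c * ℓ .poly 0 = ℓ .poly 0 * c →
      c * θ .poly 0 = ε • (θ .poly 0 * c) → c * dξ .poly = ε • (dξ .poly * c) → c ∈ A := by
    rintro c z ε rfl h1 h2 h3 h4
    refine hA _ fun m y => ?_
    obtain ⟨ε', h⟩ := mul_weylMonomial_of_commute ε h1 h2 h3 h4 m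
    rw [← mul_assoc, monomial, h, smul_mul_assoc, mul_assoc, ← map_mul]
    exact Submodule.smul_mem _ _ (hgen m _)
  have hℓ : ∀ k, ℓ .poly k ∈ A := by
    rintro (- | k)
    · exact hWeyl _ (.inr (.inr (.inl rfl)))
    · refine hN _ _ 1 (ofUEA_geOf .poly (.L k) (Int.natCast_nonneg k)) ?_ ?_ ?_ ?_
      · simp [hS.ℓ_t]
      · exact (hS.ℓ_zero_ℓ _).symm
      · rw [one_smul]; exact hS.ℓ_ξ _
      · rw [one_smul, dξ, mul_sub, sub_mul, mul_neg, neg_mul, hS.ℓ_g_zero, ← mul_assoc, hS.ℓ_ξ,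
          mul_assoc, ← hS.ℓ_zero_ℓ, mul_assoc]
  have hg : ∀ k, g .poly k ∈ A := by
    rintro (- | k)
    · have e : g .poly 0 = -dξ .poly - θ .poly 0 * ℓ .poly 0 := by rw [dξ]; abel
      rw [e]
      exact sub_mem (neg_mem (hWeyl _ (.inr (.inr (.inr rfl)))))
        (mul_mem (hWeyl _ (.inr (.inl rfl))) (hℓ 0))
    · have eξ : g .poly (k + 1) * θ .poly 0 = -(θ .poly 0 * g .poly (k + 1)) := by simp [hS.g_ξ]
      refine hN _ _ (-1) (ofUEA_geOf .poly (.G ((k : ℤ) + 1)) (show (1 : ℤ) ≤ k + 1 by omega))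
        ?_ ?_ ?_ ?_
      · simp [hS.g_t]
      · exact (hS.ℓ_zero_g _).symm
      · rw [neg_smul, one_smul]; exact eξ
      · rw [neg_smul, one_smul, dξ, mul_sub, sub_mul, mul_neg, neg_mul, hS.g_zero_g, ← mul_assoc,
          eξ, neg_mul, mul_assoc, ← hS.ℓ_zero_g, mul_assoc]
        abel
  have htop : A = ⊤ := eq_top_of_split_mem (hWeyl _ (.inl rfl)) (hWeyl _ (.inr (.inl rfl))) hℓ hg
  have h1 : (1 : Ubar .poly) ∈ monomialSpan .poly := by
    have := hgen ((0, 0), false, false) 1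
    simpa [monomial, weylMonomial, oddPow] using this
  refine eq_top_iff.2 fun x _ => ?_
  have hx : x ∈ A := by rw [htop]; trivial
  simpa using hx 1 h1

/-! ### The embedding of `Ū⁺⁺` in `Ū⁺` -/

theorem poly_ix_subset : Fun.poly.ix ⊆ Fun.laurent.ix := by
  intro b hb
  cases b with
  | L m => exact hb
  | G m => exact hb
  | t k => trivial
  | θ k => trivial

/-- The natural homomorphism `Ū⁺⁺ → Ū⁺`. -/
def polyToLaurent : Ubar .poly →ₐ[ℂ] Ubar .laurent :=
  lift .poly (egen .laurent)
    (fun _ ha _ hb => egen_mul_egen (poly_ix_subset ha) (poly_ix_subset hb))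
    (fun _ _ _ _ => egen_t_mul_t (r := .laurent) trivial trivial) egen_t_zero
    (fun _ _ => egen_t_mul_ξ (r := .laurent) trivial) egen_ξ_mul_ξ

theorem polyToLaurent_gen (b : Ix) (hb : b ∈ Fun.poly.ix) (hb' : b ∈ Fun.laurent.ix) :
    polyToLaurent (gen .poly b hb) = gen .laurent b hb' := by
  rw [← egen_eq hb']
  exact lift_gen ..

theorem polyToLaurent_t (k : ℕ) : polyToLaurent (t .poly k) = t .laurent k := polyToLaurent_gen ..

theorem polyToLaurent_θ (k : ℕ) : polyToLaurent (θ .poly k) = θ .laurent k := polyToLaurent_gen ..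

theorem polyToLaurent_L (k : ℕ) : polyToLaurent (L .poly k) = L .laurent k := polyToLaurent_gen ..

theorem polyToLaurent_G (k : ℕ) : polyToLaurent (G .poly k) = G .laurent k := polyToLaurent_gen ..

theorem polyToLaurent_ℓ (k : ℕ) : polyToLaurent (ℓ .poly k) = ℓ .laurent k := by
  simp only [ℓ, map_splitℓ, centredL, centredG, map_polySum, polyToLaurent_t, polyToLaurent_θ,
    polyToLaurent_L, polyToLaurent_G]
  rfl

theorem polyToLaurent_g (k : ℕ) : polyToLaurent (g .poly k) = g .laurent k := by
  simp only [g, map_splitg, centredL, centredG, map_polySum, polyToLaurent_t, polyToLaurent_θ,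
    polyToLaurent_L, polyToLaurent_G]
  rfl

theorem polyToLaurent_ofUEA (x : UEA kGeZero) :
    polyToLaurent (ofUEA .poly x) = ofUEA .laurent x := by
  have h : polyToLaurent.comp (ofUEA .poly) = ofUEA .laurent := UEA.hom_ext fun x => by
    have : (polyToLaurent.comp (ofUEA .poly)).toLinearMap ∘ₗ UEA.ι kGeZero =
        (ofUEA .laurent).toLinearMap ∘ₗ UEA.ι kGeZero := by
      refine kGeZero_linearMap_ext fun b hb => ?_
      show polyToLaurent (ofUEA .poly (UEA.ι kGeZero (geOf b hb))) =
        ofUEA .laurent (UEA.ι kGeZero (geOf b hb))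
      rw [ofUEA_geOf, ofUEA_geOf]
      exact Ix.geZero_cases (p := fun b => polyToLaurent (splitMap (ℓ .poly) (g .poly) b) =
        splitMap (ℓ .laurent) (g .laurent) b) (fun k => polyToLaurent_ℓ _)
        (fun k => polyToLaurent_g _) b hb
    exact DFunLike.congr_fun this x
  exact DFunLike.congr_fun h x

theorem polyToLaurent_monomial (m : (ℕ × ℕ) × Bool × Bool) :
    polyToLaurent (monomial .poly m) =
      κ (weylMonomial (.gen .t) (.gen .ξ) (.gen .dt) (.gen .dξ) m) := by
  rw [monomial, map_weylMonomial, map_weylMonomial, κ_gen, κ_gen, κ_gen, κ_gen, dξ, map_sub,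
    map_neg, map_mul, polyToLaurent_t, polyToLaurent_θ, polyToLaurent_ℓ, polyToLaurent_g]
  rfl

/-- A combination of products of monomials and elements of `U(𝔨_{≥ 0})` which vanishes in `Ū⁺` comes
from zero in `𝒦 ⊗ U(𝔨_{≥ 0})`, and so is trivial by the independence of the monomials. -/
theorem polyToLaurent_injective : Function.Injective polyToLaurent := by
  let M := (ℕ × ℕ) × Bool × Bool
  let Φ : (M →₀ ℂ) ⊗[ℂ] UEA kGeZero →ₗ[ℂ] Ubar .poly := LinearMap.mul' ℂ _ ∘ₗ
    TensorProduct.map (Finsupp.linearCombination ℂ (monomial .poly)) (ofUEA .poly).toLinearMap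
  have hΦ : LinearMap.range Φ = ⊤ := by
    rw [eq_top_iff, ← monomialSpan_eq_top]
    refine Submodule.span_le.2 ?_
    rintro _ ⟨⟨m, y⟩, rfl⟩
    exact ⟨Finsupp.single m 1 ⊗ₜ y, by simp [Φ]⟩
  let w : M → Weyl := weylMonomial (.gen .t) (.gen .ξ) (.gen .dt) (.gen .dξ)
  have hw : Function.Injective (LinearMap.rTensor (UEA kGeZero) (Finsupp.linearCombination ℂ w)) :=
    Module.Flat.rTensor_preserves_injective_linearMap _ Weyl.linearIndependent_weylMonomial
  have hcomp : polyToLaurent.toLinearMap ∘ₗ Φ = ofSplit.toLinearMap ∘ₗ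
      (GradedTensorProduct.of ℂ Weyl.parity (UEA.parity kGeZero)).toLinearMap ∘ₗ
        LinearMap.rTensor (UEA kGeZero) (Finsupp.linearCombination ℂ w) := by
    refine TensorProduct.ext' fun x y => ?_
    have hx : polyToLaurent (Finsupp.linearCombination ℂ (monomial .poly) x) =
        κ (Finsupp.linearCombination ℂ w x) := by
      have : polyToLaurent.toLinearMap ∘ₗ Finsupp.linearCombination ℂ (monomial .poly) =
          κ.toLinearMap ∘ₗ Finsupp.linearCombination ℂ w :=
        Finsupp.lhom_ext' fun m => LinearMap.ext_ring (by simp [polyToLaurent_monomial, w])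
      exact DFunLike.congr_fun this x
    show polyToLaurent (Finsupp.linearCombination ℂ (monomial .poly) x * ofUEA .poly y) =
      κ (Finsupp.linearCombination ℂ w x) * ofUEA .laurent y
    rw [map_mul, hx, polyToLaurent_ofUEA]
  refine (injective_iff_map_eq_zero _).2 fun x hx => ?_
  obtain ⟨z, rfl⟩ : x ∈ LinearMap.range Φ := by rw [hΦ]; trivial
  have h := (DFunLike.congr_fun hcomp z).symm.trans hx
  have hz : z = 0 := hw ((splitEquiv.injective (h.trans (map_zero splitEquiv).symm)).trans
    (map_zero _).symm)
  rw [hz, map_zero]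

theorem map_T : (T .poly).map polyToLaurent.toLinearMap = T .laurent := by
  rw [← ofLie_range, ← ofLie_range, LinearMap.range_eq_map, LinearMap.range_eq_map,
    ← Submodule.map_comp]
  congr 1
  exact LinearMap.ext fun x => polyToLaurent_ofUEA _

theorem sigma_polyToLaurent (x : Ubar .poly) :
    sigma .laurent (polyToLaurent x) = polyToLaurent (sigma .poly x) := by
  have h : (sigma .laurent).comp polyToLaurent = polyToLaurent.comp (sigma .poly) :=
    hom_ext fun b hb => by
      have hj := polyToLaurent_gen b hb (poly_ix_subset hb)
      rw [← egen_eq, ← egen_eq] at hj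
      rw [AlgHom.comp_apply, AlgHom.comp_apply, ← egen_eq, sigma_egen _ hb, hj,
        sigma_egen _ (poly_ix_subset hb), Units.smul_def, Units.smul_def, map_zsmul, hj]
  exact DFunLike.congr_fun h x

/-- The parity of an element of `Ū⁺⁺` can be read off in `Ū⁺`. -/
theorem mem_parity_of_polyToLaurent_mem {i : ZMod 2} {x : Ubar .poly}
    (h : polyToLaurent x ∈ parity .laurent i) : x ∈ parity .poly i := by
  have h' : sigma .laurent (polyToLaurent x) = ((-1 : ℤˣ) ^ i) • polyToLaurent x := h
  show sigma .poly x = _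
  apply polyToLaurent_injective
  rw [← sigma_polyToLaurent, h', Units.smul_def, Units.smul_def, map_zsmul]

/-! ### The decomposition of `Ū⁺⁺` -/

/-- The homomorphism `𝒦⁺ ⊗ U(𝒯) → Ū⁺`. -/
def plusTensorT :
    (Weyl.plusParity ᵍ⊗[ℂ] UEA.parity isSubalgebra_T.toLieSuperalgebra) →ₐ[ℂ] Ubar .laurent :=
  GradedTensorProduct.lift _ _ (κ.comp Weyl.plus.val) ofT
    fun _ _ a b => ofT_supercommute ⟨_, a.2⟩ b

theorem plusTensorT_tmul (x : Weyl.plus) (y : UEA isSubalgebra_T.toLieSuperalgebra) :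
    plusTensorT (x ᵍ⊗ₜ[ℂ] y) = κ x * ofT y := rfl

theorem plusTensorT_injective : Function.Injective plusTensorT := by
  have hw : Function.Injective (LinearMap.rTensor (UEA isSubalgebra_T.toLieSuperalgebra)
      Weyl.plus.val.toLinearMap) :=
    Module.Flat.rTensor_preserves_injective_linearMap _ Subtype.val_injective
  have hcomp : plusTensorT.toLinearMap = weylTensorT.toLinearMap ∘ₗ
      (GradedTensorProduct.of ℂ Weyl.parity
        (UEA.parity isSubalgebra_T.toLieSuperalgebra)).toLinearMap
        ∘ₗ LinearMap.rTensor (UEA isSubalgebra_T.toLieSuperalgebra) Weyl.plus.val.toLinearMap :=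
    TensorProduct.ext' fun x y => rfl
  have h : ⇑plusTensorT = weylTensorT ∘ LinearMap.rTensor (UEA isSubalgebra_T.toLieSuperalgebra)
      Weyl.plus.val.toLinearMap := congrArg DFunLike.coe hcomp
  rw [h]
  exact weylTensorT_bijective.injective.comp hw

theorem ofT_map (y : UEA kGeZero) : ofT (UEA.map isoT y) = ofUEA .laurent y :=
  congrArg (ofUEA .laurent) ((UEA.congr isoT).symm_apply_apply y)

theorem polyToLaurent_dξ : polyToLaurent (dξ .poly) = dξ .laurent := by
  rw [dξ, map_sub, map_neg, map_mul, polyToLaurent_θ, polyToLaurent_ℓ, polyToLaurent_g]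
  rfl

/-- Both images are generated by `t`, `ξ`, `∂_t`, `∂_ξ` and `𝒯`. -/
theorem range_plusTensorT : plusTensorT.range = polyToLaurent.range := by
  apply le_antisymm
  · have hκ : Weyl.plus ≤ polyToLaurent.range.comap κ := by
      refine Algebra.adjoin_le ?_
      rintro _ (rfl | rfl | rfl | rfl) <;>
        rw [Subalgebra.coe_comap, Set.mem_preimage, κ_gen]
      · exact ⟨_, polyToLaurent_t 1⟩
      · exact ⟨_, polyToLaurent_θ 0⟩
      · exact ⟨_, polyToLaurent_ℓ 0⟩
      · exact ⟨_, polyToLaurent_dξ⟩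
    rintro _ ⟨z, rfl⟩
    induction z using TensorProduct.induction_on with
    | zero => exact (map_zero plusTensorT).symm ▸ zero_mem _
    | add z w hz hw => exact (map_add plusTensorT z w).symm ▸ add_mem hz hw
    | tmul x y =>
      exact mul_mem (hκ x.2) ⟨ofUEA .poly (UEA.map isoT.symm y), polyToLaurent_ofUEA _⟩
  · have hκ : ∀ x (hx : x ∈ Weyl.plus), κ x ∈ plusTensorT.range := fun x hx =>
      ⟨(⟨x, hx⟩ : Weyl.plus) ᵍ⊗ₜ[ℂ] 1,
        (plusTensorT_tmul _ _).trans (by rw [map_one, mul_one])⟩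
    have hu : ∀ y, ofUEA .laurent y ∈ plusTensorT.range := fun y =>
      ⟨1 ᵍ⊗ₜ[ℂ] UEA.map isoT y,
        (plusTensorT_tmul _ _).trans (by rw [ofT_map, OneMemClass.coe_one, map_one, one_mul])⟩
    have hg : ∀ x ∈ ({.gen .t, .gen .ξ, .gen .dt, .gen .dξ} : Set Weyl), κ x ∈ plusTensorT.range :=
      fun x hx => hκ x (Algebra.subset_adjoin hx)
    have ht := hg (.gen .t) (by simp)
    have hξ := hg (.gen .ξ) (by simp)
    have hdt := hg (.gen .dt) (by simp)
    have hdξ := hg (.gen .dξ) (by simp)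
    rw [κ_gen] at ht hξ hdt hdξ
    have htop : plusTensorT.range.comap polyToLaurent = ⊤ := by
      refine eq_top_of_split_mem ?_ ?_ (fun k => ?_) fun k => ?_ <;>
        rw [Subalgebra.mem_comap]
      · rw [polyToLaurent_t]; exact ht
      · rw [polyToLaurent_θ]; exact hξ
      · rw [polyToLaurent_ℓ]
        cases k with
        | zero => exact hdt
        | succ k =>
          have : ofUEA .laurent (UEA.ι kGeZero (geOf (.L k) (Int.natCast_nonneg k))) =
              ℓ .laurent (k + 1) := ofUEA_geOf _ _ _
          rw [← this]
          exact hu _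
      · rw [polyToLaurent_g]
        cases k with
        | zero =>
          have := sub_mem (neg_mem hdξ) (mul_mem hξ hdt)
          simp only [Weyl.genVal] at this
          rwa [neg_sub, sub_neg_eq_add, add_comm, add_sub_cancel_right] at this
        | succ k =>
          have hk : (1 : ℤ) ≤ k + 1 := by omega
          have : ofUEA .laurent (UEA.ι kGeZero (geOf (.G ((k : ℤ) + 1)) hk)) =
              g .laurent (k + 1) := ofUEA_geOf _ _ _
          rw [← this]
          exact hu _
    rintro _ ⟨x, rfl⟩
    have hx : x ∈ plusTensorT.range.comap polyToLaurent := by rw [htop]; trivial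
    exact hx

/-- The isomorphism `𝒦⁺ ⊗ U(𝒯) ≅ Ū⁺⁺`. -/
def plusTensorTEquiv :
    (Weyl.plusParity ᵍ⊗[ℂ] UEA.parity isSubalgebra_T.toLieSuperalgebra) ≃ₐ[ℂ] Ubar .poly :=
  (AlgEquiv.ofInjective plusTensorT plusTensorT_injective).trans
    ((Subalgebra.equivOfEq _ _ range_plusTensorT).trans
      (AlgEquiv.ofInjective polyToLaurent polyToLaurent_injective).symm)

theorem polyToLaurent_plusTensorTEquiv
    (z : Weyl.plusParity ᵍ⊗[ℂ] UEA.parity isSubalgebra_T.toLieSuperalgebra) :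
    polyToLaurent (plusTensorTEquiv z) = plusTensorT z :=
  congrArg Subtype.val
    ((AlgEquiv.ofInjective polyToLaurent polyToLaurent_injective).apply_symm_apply
    (Subalgebra.equivOfEq _ _ range_plusTensorT
      (AlgEquiv.ofInjective plusTensorT plusTensorT_injective z)))

theorem L_zero (r : Fun) : ℓ r 0 = L r 0 := by
  rw [ℓ, splitℓ, centredL, pow_zero, ← pow_zero X, polySum_X_pow]

theorem dξ_eq (r : Fun) : dξ r = θ r 0 * L r 0 - G r 0 := by
  have e : centredG r 0 = G r 0 := by rw [centredG, pow_zero, ← pow_zero X, polySum_X_pow]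
  have e' : centredL r 0 = L r 0 := L_zero r
  rw [dξ, L_zero, g, splitg, e, e']
  module

end Ubar

end ContactSuper

end

open ContactSuper

theorem mainTheorem4 :
    -- the elements `L'_n` and `G'_{m-1/2}` form a basis of `𝒯`, a Lie subsuperalgebra of `Ū⁺`
    LinearIndependent ℂ (Ubar.primed .laurent) ∧
    ∃ hT : UbarLie.IsSubalgebra (Ubar.T .laurent),
      -- `𝒦` is identified with its image in `Ū⁺`
      (∃ (κ : Weyl →ₐ[ℂ] Ubar .laurent) (u : UEA hT.toLieSuperalgebra →ₐ[ℂ] Ubar .laurent)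
        (ι : (Weyl.parity ᵍ⊗[ℂ] UEA.parity hT.toLieSuperalgebra) ≃ₐ[ℂ] Ubar .laurent),
        κ (Weyl.gen .t) = Ubar.t .laurent 1 ∧
        κ (Weyl.gen .tinv) = Ubar.tinv ∧
        κ (Weyl.gen .ξ) = Ubar.θ .laurent 0 ∧
        κ (Weyl.gen .dt) = Ubar.L .laurent 0 ∧
        κ (Weyl.gen .dξ) = Ubar.θ .laurent 0 * Ubar.L .laurent 0 - Ubar.G .laurent 0 ∧
        (∀ y (hy : y ∈ Ubar.T .laurent), u (UEA.ι hT.toLieSuperalgebra (hT.of ⟨y, hy⟩)) = y) ∧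
        (∀ x y, ι (x ᵍ⊗ₜ[ℂ] y) = κ x * u y) ∧
        (∀ k, (tensorParity Weyl.parity (UEA.parity hT.toLieSuperalgebra) k).map ι.toLinearMap =
          Ubar.parity .laurent k) ∧
        -- the restriction to `𝒦⁺ ⊗ U(𝒯)`; here `j` is the natural map `Ū⁺⁺ → Ū⁺`
        ∃ (j : Ubar .poly →ₐ[ℂ] Ubar .laurent)
          (ιp : (Weyl.plusParity ᵍ⊗[ℂ] UEA.parity hT.toLieSuperalgebra) ≃ₐ[ℂ] Ubar .poly),
          (∀ (b : Ix) (hb : b ∈ Fun.poly.ix) (hb' : b ∈ Fun.laurent.ix),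
            j (Ubar.gen .poly b hb) = Ubar.gen .laurent b hb') ∧
          Function.Injective j ∧
          (Ubar.T .poly).map j.toLinearMap = Ubar.T .laurent ∧
          (∀ (x : Weyl.plus) y, j (ιp (x ᵍ⊗ₜ[ℂ] y)) = ι ((x : Weyl) ᵍ⊗ₜ[ℂ] y)) ∧
          (∀ k, (tensorParity Weyl.plusParity (UEA.parity hT.toLieSuperalgebra) k).map
            ιp.toLinearMap = Ubar.parity .poly k)) ∧
      Nonempty (hT.toLieSuperalgebra.Iso kGeZero) := by
  refine ⟨Ubar.linearIndependent_primed, Ubar.isSubalgebra_T,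
    ⟨Ubar.κ, Ubar.ofT, Ubar.weylTensorTEquiv, Ubar.κ_gen .t, Ubar.κ_gen .tinv, Ubar.κ_gen .ξ,
      (Ubar.κ_gen .dt).trans (Ubar.L_zero .laurent),
      (Ubar.κ_gen .dξ).trans (Ubar.dξ_eq .laurent), Ubar.ofT_ι, Ubar.weylTensorTEquiv_tmul, ?_,
      Ubar.polyToLaurent, Ubar.plusTensorTEquiv, Ubar.polyToLaurent_gen,
      Ubar.polyToLaurent_injective, Ubar.map_T,
      fun x y => Ubar.polyToLaurent_plusTensorTEquiv (x ᵍ⊗ₜ[ℂ] y), ?_⟩, ⟨Ubar.isoT.symm⟩⟩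
  · exact map_tensorParity Weyl.parity (UEA.parity Ubar.isSubalgebra_T.toLieSuperalgebra)
      (Ubar.parity .laurent) Ubar.weylTensorTEquiv fun i j a ha b hb =>
        SetLike.mul_mem_graded (Ubar.κ_mem ha) (Ubar.ofT_mem hb)
  · refine map_tensorParity Weyl.plusParity (UEA.parity Ubar.isSubalgebra_T.toLieSuperalgebra)
      (Ubar.parity .poly) Ubar.plusTensorTEquiv fun i j a ha b hb =>
        Ubar.mem_parity_of_polyToLaurent_mem ?_
    rw [Ubar.polyToLaurent_plusTensorTEquiv, Ubar.plusTensorT_tmul]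
    exact SetLike.mul_mem_graded (Ubar.κ_mem ha) (Ubar.ofT_mem hb)
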